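/- Let $(a_n)_{n\ge1}$ be a sequence of real numbers with $\sum_{n}|a_n|<\infty$, and let $(\lambda_n)_{n\ge1}$ be a nondecreasing sequence of real numbers with $\lambda_1=1$ and $q:=\sup_n\lambda_{n+1}/\lambda_n$ satisfying $1<q<\infty$. Put $$s_k=\Bigl(\sum_{n:\,q^k\le\lambda_n<q^{k+1}}|a_n|^2\Bigr)^{1/2},\qquad \sigma=\liminf_{k\to\infty}\frac{-\log s_k}{k\log q},\qquad \tau=\limsup_{k\to\infty}\frac{-\log s_k}{k\log q},$$ with values in $[-\infty,+\infty]$, where $-\log 0=+\infty$; assume that $\sigma$ and $\tau$ are finite. Let $(\theta_n)_{n\ge1}$ be independent random variables, each uniformly distributed on $[0,1]$, and let $$S_1(x)=\sum_{n=1}^\infty a_n\sin 2\pi(\lambda_nx+\theta_n),\qquad x\in\mathbb R.$$ For $A\subset\mathbb R$ let $G_{S_1}(A)=\{(x,S_1(x)):x\in A\}\subset\mathbb R^2$, and let $\dim_H$ denote Hausdorff dimension (with $\dim_H\emptyset=0$). Then for every Borel set $A\subset\mathbb R$: (i) If $0<\sigma\le\tau\le1$, then almost surely $$\min\Bigl\{\frac{\dim_HA}{\tau},\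 \dim_HA+1-\tau\Bigr\}\le\dim_HG_{S_1}(A)\le\min\Bigl\{\frac{\dim_HA}{\sigma},\ \dim_HA+1-\sigma\Bigr\}.$$ (ii) If $\tau=0$ and $\dim_HA>0$, then $\dim_HG_{S_1}(A)=1+\dim_HA$ almost surely. -/

import Mathlib

open MeasureTheory ProbabilityTheory Filter Set

noncomputable section

/-- The random sine series at the sample point `ω`. The sequences are indexed from `0`, so `a 0`,
`lam 0`, `θ 0` stand for the first terms of the sequences. -/
def sineSeries {Ω : Type*} (a lam : ℕ → ℝ) (θ : ℕ → Ω → ℝ) (ω : Ω) (x : ℝ) : ℝ :=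
  ∑' n, a n * Real.sin (2 * Real.pi * (lam n * x + θ n ω))

/-- `s_k`, the `ℓ²` size of the coefficients with frequency in `[q ^ k, q ^ (k + 1))`. -/
def blockNorm (a lam : ℕ → ℝ) (q : ℝ) (k : ℕ) : ℝ :=
  Real.sqrt (∑' n, {m : ℕ | q ^ k ≤ lam m ∧ lam m < q ^ (k + 1)}.indicator
    (fun m => |a m| ^ 2) n)

/-- `-log s_k / (k log q)` as an extended real number; it is `+∞` if `s_k = 0` (for `k ≥ 1`,
`q > 1`), because `ENNReal.log 0 = ⊥`. -/
def blockExponent (a lam : ℕ → ℝ) (q : ℝ) (k : ℕ) : EReal :=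
  -ENNReal.log (ENNReal.ofReal (blockNorm a lam q k)) / ((k * Real.log q : ℝ) : EReal)

/-- The lower exponent `σ`. -/
def lowerExponent (a lam : ℕ → ℝ) (q : ℝ) : EReal :=
  liminf (blockExponent a lam q) atTop

/-- The upper exponent `τ`. -/
def upperExponent (a lam : ℕ → ℝ) (q : ℝ) : EReal :=
  limsup (blockExponent a lam q) atTop

/-- The graph of `f` over `A`, in the Euclidean plane. -/
def graphOver (f : ℝ → ℝ) (A : Set ℝ) : Set (EuclideanSpace ℝ (Fin 2)) :=
  (fun x => !₂[x, f x]) '' A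

end

/-!
Write `S` for the series. An increment `S x - S y` is a cosine series with independent uniform
phases, whose coefficients are `2 aₙ sin (π λₙ (x - y))`.

Upper bound: the increment is subgaussian, and for `γ < σ` its variance is at most a constant times
`|x - y| ^ (2γ)`. By Kolmogorov-Chentsov `S` is almost surely locally `γ`-Hölder, and covering the
graph over short intervals by small sets bounds its dimension; then let `γ` tend to `σ`.

Lower bound: the characteristic function of the increment is a product of Bessel functions
`J₀(b ξ)`, each at most `1` in modulus and bounded away from `1` and decaying for large `|b ξ|`.
For `τ' > τ` the terms with `λₙ` of order `1 / |x - y|` carry an `ℓ²` mass of order at least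
`|x - y| ^ τ'`, which gives the small-ball estimate `P (|S x - S y| ≤ r) ≤ D r / |x - y| ^ τ'`.
Integrating it against a Frostman measure on `A` shows that the lift of this measure to the graph
almost surely has finite `t`-energy for every `t` below the claimed dimension.
-/

open scoped ENNReal NNReal Topology

section HausdorffCovers

variable {X : Type*} [EMetricSpace X] [MeasurableSpace X] [BorelSpace X] {d : ℝ} {E : Set X}

lemma hausdorffMeasure_eq_zero_of_forall_exists_cover (hd : 0 < d)
    (h : ∀ ε : ℝ≥0, 0 < ε → ∃ (ι : Type) (_ : Countable ι) (t : ι → Set X), E ⊆ ⋃ i, t i ∧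
      ∑' i, Metric.ediam (t i) ^ d ≤ ε) : μH[d] E = 0 := by
  have hinv : Tendsto (fun n : ℕ => ((1 / ((n : ℝ≥0) + 1) : ℝ≥0) : ℝ≥0∞)) atTop (𝓝 0) :=
    ENNReal.tendsto_coe.2 tendsto_one_div_add_atTop_nhds_zero_nat
  choose ι hι t ht hsum using fun n : ℕ => h (1 / ((n : ℝ≥0) + 1)) (by positivity)
  have hle := Measure.hausdorffMeasure_le_liminf_tsum d E _
    (by simpa [ENNReal.zero_rpow_of_pos (inv_pos.2 hd)] using hinv.ennrpow_const d⁻¹) t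
    (Eventually.of_forall fun n i =>
      (ENNReal.le_rpow_inv_iff hd).2 ((ENNReal.le_tsum i).trans (hsum n)))
    (Eventually.of_forall ht)
  refine le_antisymm (hle.trans ?_) zero_le
  rw [← hinv.liminf_eq]
  exact liminf_le_liminf (Eventually.of_forall hsum)

lemma exists_cover_of_hausdorffMeasure_eq_zero (hd : 0 < d) (h : μH[d] E = 0) {ε : ℝ≥0}
    (hε : 0 < ε) :
    ∃ (t : ℕ → Set X) (r : ℕ → ℝ≥0), E ⊆ ⋃ i, t i ∧ (∀ i, 0 < r i) ∧
      (∀ i, Metric.ediam (t i) ≤ r i) ∧ ∑' i, (r i : ℝ≥0∞) ^ d ≤ ε := by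
  have hε2 : ((ε / 2 : ℝ≥0) : ℝ≥0∞) ≠ 0 := by simpa using hε.ne'
  obtain ⟨δ, hδ0, hδ⟩ := ENNReal.exists_pos_sum_of_countable' hε2 ℕ
  rw [Measure.hausdorffMeasure_apply] at h
  obtain ⟨t, ht, -, hsum⟩ : ∃ t : ℕ → Set X, E ⊆ ⋃ i, t i ∧ (∀ i, Metric.ediam (t i) ≤ 1) ∧
      ∑' i, ⨆ _ : (t i).Nonempty, Metric.ediam (t i) ^ d < ((ε / 2 : ℝ≥0) : ℝ≥0∞) := by
    have hlt := (ENNReal.iSup_eq_zero.1 (ENNReal.iSup_eq_zero.1 h 1) one_pos).trans_lt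
      (pos_iff_ne_zero.2 hε2)
    simpa only [iInf_lt_iff, exists_prop] using hlt
  set w : ℕ → ℝ≥0∞ := fun i => (⨆ _ : (t i).Nonempty, Metric.ediam (t i) ^ d) + δ i
  have hw : ∑' i, w i ≤ ε := by
    rw [ENNReal.tsum_add]
    refine (add_le_add hsum.le hδ.le).trans_eq ?_
    rw [← ENNReal.coe_add, add_halves]
  have hw_top (i : ℕ) : w i ^ d⁻¹ ≠ ∞ := ENNReal.rpow_ne_top_of_nonneg (inv_pos.2 hd).le
    (ne_top_of_le_ne_top ENNReal.coe_ne_top ((ENNReal.le_tsum i).trans hw))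
  refine ⟨t, fun i => (w i ^ d⁻¹).toNNReal, ht, fun i => ?_, fun i => ?_, ?_⟩
  · refine ENNReal.toNNReal_pos (fun h0 => (hδ0 i).ne' ?_) (hw_top i)
    exact (add_eq_zero.1 ((ENNReal.rpow_eq_zero_iff_of_pos (inv_pos.2 hd)).1 h0)).2
  · rw [ENNReal.coe_toNNReal (hw_top i)]
    rcases (t i).eq_empty_or_nonempty with hti | hti
    · simp [hti]
    · rw [ENNReal.le_rpow_inv_iff hd]
      exact le_self_add.trans' (le_iSup_of_le (f := fun _ => Metric.ediam (t i) ^ d) hti le_rfl)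
  · simpa only [ENNReal.coe_toNNReal (hw_top _), ENNReal.rpow_inv_rpow hd.ne'] using hw

end HausdorffCovers

section Capacitability

lemma exists_forall_lt_image_prefix_le {X α : Type*} [CompleteLinearOrder α] {φ : Set X → α}
    (hφ : ∀ E : ℕ → Set X, Monotone E → φ (⋃ n, E n) ≤ ⨆ n, φ (E n)) {f : (ℕ → ℕ) → X} {t : α}
    (ht : t < φ (range f)) :
    ∃ b : ℕ → ℕ, ∀ m, t < φ (f '' {z | ∀ i < m, z i ≤ b i}) := by
  have step (m : ℕ) (E : {E : Set (ℕ → ℕ) // t < φ (f '' E)}) :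
      ∃ N, t < φ (f '' (E ∩ {z | z m ≤ N})) := by
    have hE : f '' E = ⋃ N : ℕ, f '' (E ∩ {z | z m ≤ N}) := by
      rw [← image_iUnion, ← inter_iUnion, iUnion_eq_univ_iff.2 fun z => ⟨z m, le_refl (z m)⟩,
        inter_univ]
    have hmono : Monotone fun N : ℕ => f '' (E ∩ {z | z m ≤ N}) := fun N N' hN =>
      image_mono (inter_subset_inter_right _ fun z hz => le_trans hz hN)
    exact lt_iSup_iff.1 (E.2.trans_le (hE ▸ hφ _ hmono))
  choose N hN using step
  let E : ℕ → {E : Set (ℕ → ℕ) // t < φ (f '' E)} :=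
    Nat.rec ⟨univ, by rwa [image_univ]⟩ fun m E => ⟨_, hN m E⟩
  refine ⟨fun m => N m (E m), fun m => ?_⟩
  suffices h : (E m).1 = {z | ∀ i < m, z i ≤ N i (E i)} by
    rw [← h]
    exact (E m).2
  induction m with
  | zero => simp [E]
  | succ m ih =>
    ext z
    change z ∈ (E m).1 ∧ z m ≤ N m (E m) ↔ _
    rw [ih]
    simp only [mem_ofPred_eq, Nat.forall_lt_succ_right]

lemma exists_prefix_subset_of_isOpen {b : ℕ → ℕ} {V : Set (ℕ → ℕ)} (hV : IsOpen V)
    (hb : Iic b ⊆ V) : ∃ m, {z | ∀ i < m, z i ≤ b i} ⊆ V := by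
  by_contra! hnot
  choose z hzb hzV using fun m => not_subset.1 (hnot m)
  have hcompact : IsCompact (Iic b) := by
    rw [← Icc_bot]
    exact isCompact_Icc
  obtain ⟨y, hyb, φ, hφ, hlim⟩ :=
    hcompact.tendsto_subseq (x := fun m => z m ⊓ b) fun m => mem_Iic.2 inf_le_right
  have hlim' : Tendsto (fun m => z (φ m)) atTop (𝓝 y) := by
    rw [tendsto_pi_nhds] at hlim ⊢
    refine fun i => (hlim i).congr' ?_
    filter_upwards [eventually_gt_atTop i] with m hm
    exact min_eq_left (hzb (φ m) i (hm.trans_le (hφ.id_le m)))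
  obtain ⟨m, hm⟩ := (hlim'.eventually (hV.mem_nhds (hb hyb))).exists
  exact hzV _ hm

theorem exists_isCompact_forall_isOpen_lt {X α : Type*} [TopologicalSpace X]
    [CompleteLinearOrder α] {φ : Set X → α} (hmono : Monotone φ)
    (hφ : ∀ E : ℕ → Set X, Monotone E → φ (⋃ n, E n) ≤ ⨆ n, φ (E n)) {A : Set X}
    (hA : AnalyticSet A) {t : α} (ht : t < φ A) :
    ∃ K ⊆ A, IsCompact K ∧ ∀ U, IsOpen U → K ⊆ U → t < φ U := by
  rw [AnalyticSet] at hA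
  obtain rfl | ⟨f, hf, rfl⟩ := hA
  · exact ⟨∅, Subset.rfl, isCompact_empty, fun U _ hU => ht.trans_le (hmono hU)⟩
  obtain ⟨b, hb⟩ := exists_forall_lt_image_prefix_le hφ ht
  have hcompact : IsCompact (Iic b) := by
    rw [← Icc_bot]
    exact isCompact_Icc
  refine ⟨f '' Iic b, image_subset_range _ _, hcompact.image hf, fun U hU hbU => ?_⟩
  obtain ⟨m, hm⟩ := exists_prefix_subset_of_isOpen (hU.preimage hf) (image_subset_iff.1 hbU)
  exact (hb m).trans_le (hmono (image_subset_iff.2 hm))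

end Capacitability

section DyadicContent

/-- The dyadic interval `[j / 2 ^ k, (j + 1) / 2 ^ k)` of level `k` containing `x`, encoded as the
pair `(k, j)`. -/
noncomputable def dyadicCell (k : ℕ) (x : ℝ) : ℕ × ℤ := (k, ⌊(2 : ℝ) ^ k * x⌋)

/-- The total `s`-dimensional size `∑ 2 ^ (-k s)` of a family of dyadic intervals, as a measure on
the set of all dyadic intervals. -/
noncomputable def dyadicWeight (s : ℝ) : Measure (ℕ × ℤ) :=
  Measure.count.withDensity fun p => ((2⁻¹ : ℝ≥0∞) ^ p.1) ^ s

/-- The family `C` of dyadic intervals covers the set `E`. -/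
def IsDyadicCover (C : Set (ℕ × ℤ)) (E : Set ℝ) : Prop := ∀ x ∈ E, ∃ k, dyadicCell k x ∈ C

/-- The `s`-dimensional dyadic net content of a set, with intervals of length at most one. -/
noncomputable def dyadicContent (s : ℝ) (E : Set ℝ) : ℝ≥0∞ :=
  ⨅ (C : Set (ℕ × ℤ)) (_ : IsDyadicCover C E), dyadicWeight s C

/-- The maximal intervals of a family of dyadic intervals. -/
def maximalCells (U : Set (ℕ × ℤ)) : Set (ℕ × ℤ) :=
  {p | ∃ k x, p = dyadicCell k x ∧ p ∈ U ∧ ∀ l < k, dyadicCell l x ∉ U}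

/-- The intervals of `C` that are contained in an interval of `T`. -/
def subcells (C T : Set (ℕ × ℤ)) : Set (ℕ × ℤ) :=
  {p | p ∈ C ∧ ∃ k l x, k ≤ l ∧ p = dyadicCell l x ∧ dyadicCell k x ∈ T}

variable {s : ℝ} {C C' T T' U : Set (ℕ × ℤ)} {E F K : Set ℝ}

lemma dyadicCell_eq_of_le {k l : ℕ} (hlk : l ≤ k) {x y : ℝ} (h : dyadicCell k x = dyadicCell k y) :
    dyadicCell l x = dyadicCell l y := by
  have floor_eq (z : ℝ) : ⌊(2 : ℝ) ^ l * z⌋ = ⌊(2 : ℝ) ^ k * z⌋ / ((2 ^ (k - l) : ℕ) : ℤ) := by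
    rw [← Int.floor_div_natCast]
    congr 1
    obtain ⟨d, rfl⟩ := Nat.exists_eq_add_of_le hlk
    rw [Nat.add_sub_cancel_left, Nat.cast_pow, Nat.cast_ofNat, pow_add]
    field_simp
  simp only [dyadicCell, Prod.mk.injEq, true_and] at h ⊢
  rw [floor_eq x, floor_eq y, h]

lemma mem_Ico_dyadicCell (k : ℕ) (x : ℝ) :
    x ∈ Ico ((dyadicCell k x).2 / (2 : ℝ) ^ k) (((dyadicCell k x).2 + 1) / (2 : ℝ) ^ k) := by
  have h2 : (0 : ℝ) < 2 ^ k := by positivity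
  simp only [dyadicCell, mem_Ico]
  rw [div_le_iff₀ h2, lt_div_iff₀ h2, mul_comm x]
  exact ⟨Int.floor_le _, Int.lt_floor_add_one _⟩

lemma ediam_Ico_dyadic (k : ℕ) (j : ℤ) :
    Metric.ediam (Ico (j / (2 : ℝ) ^ k) ((j + 1) / (2 : ℝ) ^ k)) = (2⁻¹ : ℝ≥0∞) ^ k := by
  rw [Real.ediam_Ico, ← sub_div, add_sub_cancel_left, ← inv_eq_one_div, ← inv_pow,
    ENNReal.ofReal_pow (by norm_num), ENNReal.ofReal_inv_of_pos (by norm_num), ENNReal.ofReal_ofNat]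

lemma dyadicWeight_eq_tsum (s : ℝ) (C : Set (ℕ × ℤ)) :
    dyadicWeight s C = ∑' p : C, ((2⁻¹ : ℝ≥0∞) ^ p.1.1) ^ s := by
  have hC : MeasurableSet C := C.to_countable.measurableSet
  rw [dyadicWeight, withDensity_apply _ hC, ← lintegral_indicator hC, lintegral_count]
  exact (tsum_subtype C fun p => ((2⁻¹ : ℝ≥0∞) ^ p.1) ^ s).symm

lemma dyadicWeight_singleton (s : ℝ) (p : ℕ × ℤ) :
    dyadicWeight s {p} = ((2⁻¹ : ℝ≥0∞) ^ p.1) ^ s := by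
  rw [dyadicWeight_eq_tsum, tsum_singleton p fun p => ((2⁻¹ : ℝ≥0∞) ^ p.1) ^ s]

lemma dyadicWeight_preimage_translate (s : ℝ) (i : ℤ) (C : Set (ℕ × ℤ)) :
    dyadicWeight s {p | (p.1, p.2 + i) ∈ C} = dyadicWeight s C := by
  rw [dyadicWeight_eq_tsum, dyadicWeight_eq_tsum]
  exact (((Equiv.refl ℕ).prodCongr (Equiv.addRight i)).subtypeEquiv fun _ => Iff.rfl).tsum_eq
    fun p : C => ((2⁻¹ : ℝ≥0∞) ^ p.1.1) ^ s

lemma IsDyadicCover.mono (hC : IsDyadicCover C F) (h : E ⊆ F) : IsDyadicCover C E :=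
  fun x hx => hC x (h hx)

lemma IsDyadicCover.union (hC : IsDyadicCover C E) (hC' : IsDyadicCover C' F) :
    IsDyadicCover (C ∪ C') (E ∪ F) := by
  rintro x (hx | hx)
  · exact (hC x hx).imp fun _ => Or.inl
  · exact (hC' x hx).imp fun _ => Or.inr

lemma dyadicContent_le_dyadicWeight (h : IsDyadicCover C E) :
    dyadicContent s E ≤ dyadicWeight s C := iInf₂_le C h

lemma exists_isDyadicCover_lt {c : ℝ≥0∞} (h : dyadicContent s E < c) :
    ∃ C, IsDyadicCover C E ∧ dyadicWeight s C < c := by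
  simpa [dyadicContent, iInf_lt_iff] using h

lemma dyadicContent_empty (s : ℝ) : dyadicContent s ∅ = 0 :=
  le_antisymm ((dyadicContent_le_dyadicWeight (C := ∅) fun _ hx => hx.elim).trans
    measure_empty.le) zero_le

lemma dyadicContent_mono (s : ℝ) : Monotone (dyadicContent s) := fun _ _ h =>
  le_iInf₂ fun _ hC => dyadicContent_le_dyadicWeight (hC.mono h)

lemma dyadicContent_union_le (s : ℝ) (E F : Set ℝ) :
    dyadicContent s (E ∪ F) ≤ dyadicContent s E + dyadicContent s F :=
  ENNReal.le_iInf₂_add_iInf₂ fun _ hC _ hD =>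
    (dyadicContent_le_dyadicWeight (hC.union hD)).trans (measure_union_le _ _)

lemma dyadicContent_Icc_lt_top (s x y : ℝ) : dyadicContent s (Icc x y) < ∞ := by
  let C : Finset (ℕ × ℤ) := {0} ×ˢ Finset.Icc ⌊x⌋ ⌊y⌋
  have hcov : IsDyadicCover C (Icc x y) := fun z hz => ⟨0, by
    simpa [C, dyadicCell] using ⟨Int.floor_mono hz.1, Int.floor_mono hz.2⟩⟩
  refine (dyadicContent_le_dyadicWeight hcov).trans_lt ?_
  rw [dyadicWeight_eq_tsum, Finset.tsum_subtype' C fun p : ℕ × ℤ => ((2⁻¹ : ℝ≥0∞) ^ p.1) ^ s]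
  refine ENNReal.sum_lt_top.2 fun p hp => ?_
  have hp0 : p.1 = 0 := by simpa [C] using (Finset.mem_product.1 hp).1
  simp [hp0]

lemma dyadicContent_lt_top_of_isBounded (s : ℝ) (hE : Bornology.IsBounded E) :
    dyadicContent s E < ∞ := by
  obtain ⟨R, hR⟩ := hE.subset_closedBall 0
  rw [Real.closedBall_eq_Icc] at hR
  exact (dyadicContent_mono s hR).trans_lt (dyadicContent_Icc_lt_top s _ _)

lemma dyadicContent_Icc_le (hs : 0 ≤ s) {x y : ℝ} (hxy : x < y) (hyx : y ≤ x + 1) :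
    dyadicContent s (Icc x y) ≤ ENNReal.ofReal (2 * 2 ^ s * (y - x) ^ s) := by
  obtain ⟨k, hk_lt, hk_le⟩ : ∃ k : ℕ, (2⁻¹ : ℝ) ^ (k + 1) < y - x ∧ y - x ≤ 2⁻¹ ^ k :=
    exists_nat_pow_near_of_lt_one (sub_pos.2 hxy) (by linarith) (by norm_num) (by norm_num)
  have hcov : IsDyadicCover ({(k, ⌊(2 : ℝ) ^ k * x⌋)} ∪ {(k, ⌊(2 : ℝ) ^ k * x⌋ + 1)})
      (Icc x y) := by
    refine fun z hz => ⟨k, ?_⟩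
    have hle : ⌊(2 : ℝ) ^ k * x⌋ ≤ ⌊(2 : ℝ) ^ k * z⌋ := Int.floor_mono (by gcongr; exact hz.1)
    have hlt : ⌊(2 : ℝ) ^ k * z⌋ < ⌊(2 : ℝ) ^ k * x⌋ + 2 := by
      rw [Int.floor_lt]
      push_cast
      have hlen : (2 : ℝ) ^ k * (z - x) ≤ 1 := by
        calc (2 : ℝ) ^ k * (z - x) ≤ 2 ^ k * 2⁻¹ ^ k := by
              gcongr; exact (sub_le_sub_right hz.2 x).trans hk_le
          _ = 1 := by rw [← mul_pow]; norm_num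
      linarith [Int.lt_floor_add_one ((2 : ℝ) ^ k * x)]
    have hcases : ⌊(2 : ℝ) ^ k * z⌋ = ⌊(2 : ℝ) ^ k * x⌋ ∨
        ⌊(2 : ℝ) ^ k * z⌋ = ⌊(2 : ℝ) ^ k * x⌋ + 1 := by omega
    rcases hcases with h | h <;> simp [dyadicCell, h]
  calc dyadicContent s (Icc x y) ≤ 2 * ((2⁻¹ : ℝ≥0∞) ^ k) ^ s := by
        refine (dyadicContent_le_dyadicWeight hcov).trans ((measure_union_le _ _).trans_eq ?_)
        rw [dyadicWeight_singleton, dyadicWeight_singleton, two_mul]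
    _ = ENNReal.ofReal (2 * (2⁻¹ ^ k) ^ s) := by
        rw [ENNReal.ofReal_mul (by norm_num), ← ENNReal.ofReal_rpow_of_nonneg (by positivity) hs,
          ENNReal.ofReal_pow (by norm_num), ENNReal.ofReal_inv_of_pos (by norm_num),
          ENNReal.ofReal_ofNat]
    _ ≤ ENNReal.ofReal (2 * 2 ^ s * (y - x) ^ s) := by
        rw [mul_assoc, ← Real.mul_rpow (by norm_num) (sub_pos.2 hxy).le]
        gcongr
        rw [pow_succ] at hk_lt
        linarith

lemma hausdorffMeasure_eq_zero_of_dyadicContent_eq_zero (hs : 0 < s) (h : dyadicContent s E = 0) :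
    μH[s] E = 0 := by
  refine hausdorffMeasure_eq_zero_of_forall_exists_cover hs fun ε hε => ?_
  obtain ⟨C, hC, hCw⟩ := exists_isDyadicCover_lt (s := s) (E := E) (c := ε) (by simpa [h] using hε)
  refine ⟨C, C.to_countable, fun p =>
    Ico (p.1.2 / (2 : ℝ) ^ p.1.1) ((p.1.2 + 1) / (2 : ℝ) ^ p.1.1), fun x hx => ?_, ?_⟩
  · obtain ⟨k, hk⟩ := hC x hx
    exact mem_iUnion.2 ⟨⟨_, hk⟩, mem_Ico_dyadicCell k x⟩
  · simpa only [ediam_Ico_dyadic, ← dyadicWeight_eq_tsum] using hCw.le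

/-- Enlarging every interval of a cover by its two neighbours makes the cover open. -/
lemma exists_isOpen_dyadicContent_le (s : ℝ) (hC : IsDyadicCover C E) :
    ∃ U, IsOpen U ∧ E ⊆ U ∧ dyadicContent s U ≤ 3 * dyadicWeight s C := by
  refine ⟨⋃ p ∈ C, Ioo ((p.2 - 1) / (2 : ℝ) ^ p.1) ((p.2 + 2) / (2 : ℝ) ^ p.1),
    isOpen_biUnion fun _ _ => isOpen_Ioo, fun x hx => ?_, ?_⟩
  · obtain ⟨k, hk⟩ := hC x hx
    have hxk := mem_Ico_dyadicCell k x
    refine mem_biUnion hk ⟨lt_of_lt_of_le ?_ hxk.1, hxk.2.trans ?_⟩ <;> simp only [dyadicCell] <;>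
      gcongr <;> linarith
  have hcov : IsDyadicCover ({p | (p.1, p.2 + (-1)) ∈ C} ∪
      ({p | (p.1, p.2 + 0) ∈ C} ∪ {p | (p.1, p.2 + 1) ∈ C}))
      (⋃ p ∈ C, Ioo ((p.2 - 1) / (2 : ℝ) ^ p.1) ((p.2 + 2) / (2 : ℝ) ^ p.1)) := by
    intro x hx
    obtain ⟨⟨k, j⟩, hp, hx⟩ := mem_iUnion₂.1 hx
    have h2 : (0 : ℝ) < 2 ^ k := by positivity
    simp only [mem_Ioo] at hx
    rw [div_lt_iff₀ h2, lt_div_iff₀ h2] at hx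
    have hlow : j - 1 ≤ ⌊(2 : ℝ) ^ k * x⌋ := by rw [Int.le_floor]; push_cast; linarith
    have hupp : ⌊(2 : ℝ) ^ k * x⌋ < j + 2 := by rw [Int.floor_lt]; push_cast; linarith
    have hcases : ⌊(2 : ℝ) ^ k * x⌋ + (-1) = j ∨ ⌊(2 : ℝ) ^ k * x⌋ + 0 = j ∨
        ⌊(2 : ℝ) ^ k * x⌋ + 1 = j := by omega
    refine ⟨k, ?_⟩
    simp only [dyadicCell, mem_union, mem_ofPred_eq]
    rcases hcases with h | h | h <;> simp only [h, hp, true_or, or_true]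
  refine (dyadicContent_le_dyadicWeight hcov).trans ((measure_union_le _ _).trans
    ((add_le_add le_rfl (measure_union_le _ _)).trans_eq ?_))
  simp only [dyadicWeight_preimage_translate]
  ring

lemma dyadicCell_notMem_of_mem_maximalCells {k l : ℕ} {x : ℝ} (h : dyadicCell k x ∈ maximalCells U)
    (hlk : l < k) : dyadicCell l x ∉ U := by
  obtain ⟨k', y, hxy, -, hy⟩ := h
  obtain rfl : k = k' := congrArg Prod.fst hxy
  rw [dyadicCell_eq_of_le hlk.le hxy]
  exact hy l hlk

lemma maximalCells_subset (U : Set (ℕ × ℤ)) : maximalCells U ⊆ U := fun _ ⟨_, _, _, h, _⟩ => h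

lemma IsDyadicCover.maximal (h : IsDyadicCover U E) : IsDyadicCover (maximalCells U) E := by
  classical
  intro x hx
  exact ⟨Nat.find (h x hx), _, x, rfl, Nat.find_spec (h x hx), fun l => Nat.find_min (h x hx)⟩

lemma disjoint_subcells (hT : T ⊆ maximalCells U) (hT' : T' ⊆ maximalCells U) (h : Disjoint T T') :
    Disjoint (subcells C T) (subcells C T') := by
  refine Set.disjoint_left.2 ?_
  rintro p ⟨-, k, l, x, -, rfl, hxT⟩ ⟨-, k', l', y, hkl', hxy, hyT'⟩
  obtain rfl : l = l' := congrArg Prod.fst hxy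
  rw [← dyadicCell_eq_of_le hkl' hxy] at hyT'
  rcases lt_trichotomy k k' with hlt | rfl | hlt
  · exact dyadicCell_notMem_of_mem_maximalCells (hT' hyT') hlt (maximalCells_subset U (hT hxT))
  · exact Set.disjoint_left.1 h hxT hyT'
  · exact dyadicCell_notMem_of_mem_maximalCells (hT hxT) hlt (maximalCells_subset U (hT' hyT'))

lemma IsDyadicCover.diff_union_subcells (hC : IsDyadicCover C E) (hC' : IsDyadicCover C' E)
    (hC'U : C' ⊆ U) (hT : T ⊆ maximalCells U) : IsDyadicCover (C \ T ∪ subcells C' T) E := by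
  intro x hx
  obtain ⟨k, hk⟩ := hC x hx
  by_cases hkT : dyadicCell k x ∈ T
  · obtain ⟨l, hl⟩ := hC' x hx
    refine ⟨l, Or.inr ⟨hl, k, l, x, not_lt.1 fun hlt => ?_, rfl, hkT⟩⟩
    exact dyadicCell_notMem_of_mem_maximalCells (hT hkT) hlt (hC'U hl)
  · exact ⟨k, Or.inl ⟨hk, hkT⟩⟩

/-- In a nearly optimal cover, no subfamily can be replaced by a much lighter one. -/
lemma dyadicWeight_le_subcells_add (hC : IsDyadicCover C E) (hC' : IsDyadicCover C' E)
    (hC'U : C' ⊆ U) (hT : T ⊆ maximalCells U) (hTC : T ⊆ C) {δ : ℝ≥0∞}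
    (hδ : dyadicWeight s C < dyadicContent s E + δ) :
    dyadicWeight s T ≤ dyadicWeight s (subcells C' T) + δ := by
  have hfin : dyadicWeight s (C \ T) ≠ ∞ :=
    ne_top_of_le_ne_top (hδ.trans_le le_top).ne (measure_mono sdiff_subset)
  refine (ENNReal.add_le_add_iff_left hfin).1 ?_
  calc dyadicWeight s (C \ T) + dyadicWeight s T = dyadicWeight s C := by
        rw [add_comm, ← measure_inter_add_sdiff (μ := dyadicWeight s) C
          T.to_countable.measurableSet, inter_eq_right.2 hTC]
    _ ≤ dyadicContent s E + δ := hδ.le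
    _ ≤ dyadicWeight s (C \ T) + dyadicWeight s (subcells C' T) + δ := by
        gcongr
        exact (dyadicContent_le_dyadicWeight (hC.diff_union_subcells hC' hC'U hT)).trans
          (measure_union_le _ _)
    _ = _ := add_assoc _ _ _

/-- Merge nearly optimal covers of the `E n` into the family of maximal intervals of their union;
for each `m`, the maximal intervals contributed by the first `m` covers can be exchanged for
disjoint parts of the `m`-th one. -/
theorem dyadicContent_iUnion_le (s : ℝ) {E : ℕ → Set ℝ} (hE : Monotone E) :
    dyadicContent s (⋃ n, E n) ≤ ⨆ n, dyadicContent s (E n) := by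
  set L := ⨆ n, dyadicContent s (E n)
  have hle (n : ℕ) : dyadicContent s (E n) ≤ L := le_iSup (fun n => dyadicContent s (E n)) n
  refine ENNReal.le_of_forall_pos_le_add fun ε hε hL => ?_
  obtain ⟨δ, hδ0, hδ⟩ := ENNReal.exists_pos_sum_of_countable'
    (ε := ((ε / 2 : ℝ≥0) : ℝ≥0∞)) (by simpa using hε.ne') ℕ
  choose C hC hCw using fun n => exists_isDyadicCover_lt
    (ENNReal.lt_add_right ((hle n).trans_lt hL).ne (hδ0 n).ne')
  let U : Set (ℕ × ℤ) := ⋃ n, C n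
  let T : ℕ → Set (ℕ × ℤ) := fun n => maximalCells U ∩ disjointed C n
  have hTU (n : ℕ) : T n ⊆ maximalCells U := inter_subset_left
  have hcov : IsDyadicCover (⋃ n, T n) (⋃ n, E n) := by
    rw [← inter_iUnion, iUnion_disjointed, inter_eq_left.2 (maximalCells_subset U)]
    refine IsDyadicCover.maximal fun x hx => ?_
    obtain ⟨n, hn⟩ := mem_iUnion.1 hx
    exact (hC n x hn).imp fun _ hk => mem_iUnion.2 ⟨n, hk⟩
  have hdisj (m : ℕ) : Pairwise (Function.onFun Disjoint fun n => subcells (C m) (T n)) :=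
    fun i j hij => disjoint_subcells (hTU i) (hTU j)
      ((disjoint_disjointed C hij).mono inter_subset_right inter_subset_right)
  have hexchange (m n : ℕ) (hnm : n ≤ m) :
      dyadicWeight s (T n) ≤ dyadicWeight s (subcells (C m) (T n)) + δ n :=
    dyadicWeight_le_subcells_add (hC n) ((hC m).mono (hE hnm)) (subset_iUnion C m) (hTU n)
      (inter_subset_right.trans (disjointed_subset C n)) (hCw n)
  refine (dyadicContent_le_dyadicWeight hcov).trans ((measure_iUnion_le _).trans ?_)
  refine ENNReal.tsum_le_of_sum_range_le fun m => ?_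
  calc ∑ n ∈ Finset.range m, dyadicWeight s (T n)
      ≤ ∑ n ∈ Finset.range m, (dyadicWeight s (subcells (C m) (T n)) + δ n) :=
        Finset.sum_le_sum fun n hn => hexchange m n (Finset.mem_range.1 hn).le
    _ ≤ dyadicWeight s (C m) + ∑' n, δ n := by
        rw [Finset.sum_add_distrib, ← measure_biUnion_finset (fun i _ j _ hij => hdisj m hij)
          (fun n _ => (subcells (C m) (T n)).to_countable.measurableSet)]
        gcongr
        · exact iUnion₂_subset fun n _ p hp => hp.1
        · exact ENNReal.sum_le_tsum _
    _ ≤ L + ((ε / 2 : ℝ≥0) : ℝ≥0∞) + ((ε / 2 : ℝ≥0) : ℝ≥0∞) := by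
        gcongr
        exact (hCw m).le.trans (add_le_add (hle m) ((ENNReal.le_tsum m).trans hδ.le))
    _ = L + ε := by rw [add_assoc, ← ENNReal.coe_add, add_halves]

lemma exists_isCompact_dyadicContent_pos {A : Set ℝ} (hA : AnalyticSet A)
    (h : 0 < dyadicContent s A) : ∃ K ⊆ A, IsCompact K ∧ 0 < dyadicContent s K := by
  obtain ⟨c, hc0, hc⟩ := exists_between h
  obtain ⟨K, hKA, hK, hcK⟩ := exists_isCompact_forall_isOpen_lt (dyadicContent_mono s)
    (fun _ => dyadicContent_iUnion_le s) hA hc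
  refine ⟨K, hKA, hK, pos_iff_ne_zero.2 fun h0 => ?_⟩
  obtain ⟨C, hC, hCw⟩ := exists_isDyadicCover_lt (s := s) (c := c / 3)
    (by rw [h0]; exact ENNReal.div_pos hc0.ne' (by simp))
  obtain ⟨U, hU, hKU, hUC⟩ := exists_isOpen_dyadicContent_le s hC
  refine (hcK U hU hKU).not_ge (hUC.trans ?_)
  rw [mul_comm]
  exact ((ENNReal.lt_div_iff_mul_lt (by simp) (by simp)).1 hCw).le

end DyadicContent

section Frostman

variable {s : ℝ} {A K : Set ℝ}

/-- The function `x ↦ dyadicContent s (K ∩ Iic x)`, which for compact `K` is the distribution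
function of a Frostman measure on `K`. -/
noncomputable def contentCDF (s : ℝ) (K : Set ℝ) (x : ℝ) : ℝ := (dyadicContent s (K ∩ Iic x)).toReal

lemma dyadicContent_inter_ne_top (s : ℝ) (hK : Bornology.IsBounded K) (E : Set ℝ) :
    dyadicContent s (K ∩ E) ≠ ∞ :=
  (dyadicContent_lt_top_of_isBounded s (hK.subset inter_subset_left)).ne

lemma contentCDF_mono (s : ℝ) (hK : Bornology.IsBounded K) : Monotone (contentCDF s K) :=
  fun _ _ h => ENNReal.toReal_mono (dyadicContent_inter_ne_top s hK _)
    (dyadicContent_mono s (inter_subset_inter_right _ (Iic_subset_Iic.2 h)))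

lemma contentCDF_le_add (s : ℝ) (hK : Bornology.IsBounded K) {x y : ℝ} (hxy : x ≤ y) :
    contentCDF s K y ≤ contentCDF s K x + (dyadicContent s (K ∩ Ioc x y)).toReal := by
  have hfin := dyadicContent_inter_ne_top s hK
  rw [contentCDF, contentCDF, ← ENNReal.toReal_add (hfin _) (hfin _)]
  refine ENNReal.toReal_mono (ENNReal.add_ne_top.2 ⟨hfin _, hfin _⟩) ?_
  rw [← Iic_union_Ioc_eq_Iic hxy, inter_union_distrib_left]
  exact dyadicContent_union_le _ _ _

lemma continuousWithinAt_contentCDF (hs : 0 < s) (hK : Bornology.IsBounded K) (x : ℝ) :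
    ContinuousWithinAt (contentCDF s K) (Ici x) x := by
  rw [← continuousWithinAt_Ioi_iff_Ici]
  have hlim : Tendsto (fun y => contentCDF s K x + 2 * 2 ^ s * (y - x) ^ s) (𝓝[>] x)
      (𝓝 (contentCDF s K x)) := by
    have hcont : Continuous fun y : ℝ => contentCDF s K x + 2 * 2 ^ s * (y - x) ^ s :=
      continuous_const.add (continuous_const.mul
        ((continuous_id.sub continuous_const).rpow_const fun _ => Or.inr hs.le))
    simpa [Real.zero_rpow hs.ne'] using
      (hcont.tendsto x).mono_left (nhdsWithin_le_nhds (s := Ioi x))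
  refine tendsto_of_tendsto_of_tendsto_of_le_of_le' tendsto_const_nhds hlim ?_ ?_
  · filter_upwards [self_mem_nhdsWithin] with y hy using contentCDF_mono s hK (le_of_lt hy)
  · filter_upwards [Ioo_mem_nhdsGT (lt_add_one x)] with y hy
    have hpos : 0 < y - x := sub_pos.2 hy.1
    refine (contentCDF_le_add s hK hy.1.le).trans (add_le_add_right ?_ _)
    refine ENNReal.toReal_le_of_le_ofReal (by positivity) ?_
    exact (dyadicContent_mono s (inter_subset_right.trans Ioc_subset_Icc_self)).trans
      (dyadicContent_Icc_le hs.le hy.1 hy.2.le)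

/-- `contentCDF s K` as a Stieltjes function. -/
noncomputable def contentStieltjes (hs : 0 < s) (hK : Bornology.IsBounded K) :
    StieltjesFunction ℝ where
  toFun := contentCDF s K
  mono' := contentCDF_mono s hK
  right_continuous' := continuousWithinAt_contentCDF hs hK

lemma measure_contentStieltjes_Ioc_le (hs : 0 < s) (hK : Bornology.IsBounded K) {x y : ℝ}
    (hxy : x ≤ y) : (contentStieltjes hs hK).measure (Ioc x y) ≤ dyadicContent s (K ∩ Ioc x y) := by
  rw [StieltjesFunction.measure_Ioc]
  refine ENNReal.ofReal_le_of_le_toReal (sub_le_iff_le_add'.2 ?_)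
  exact contentCDF_le_add s hK hxy

lemma measure_contentStieltjes_compl (hs : 0 < s) (hK : IsCompact K) :
    (contentStieltjes hs hK.isBounded).measure Kᶜ = 0 := by
  refine measure_null_of_locally_null _ fun x hx => ?_
  obtain ⟨ε, hε, hsub⟩ := Metric.isOpen_iff.1 hK.isClosed.isOpen_compl x hx
  rw [Real.ball_eq_Ioo] at hsub
  refine ⟨Ioc (x - ε / 2) (x + ε / 2), mem_nhdsWithin_of_mem_nhds
    (Ioc_mem_nhds (by linarith) (by linarith)), ?_⟩
  have hdisj : K ∩ Ioc (x - ε / 2) (x + ε / 2) = ∅ :=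
    disjoint_iff_inter_eq_empty.1 <| Set.disjoint_left.2 fun y hyK hy =>
      hsub ⟨by linarith [hy.1], by linarith [hy.2]⟩ hyK
  have hle := measure_contentStieltjes_Ioc_le hs hK.isBounded
    (show x - ε / 2 ≤ x + ε / 2 by linarith)
  rwa [hdisj, dyadicContent_empty, nonpos_iff_eq_zero] at hle

lemma measure_contentStieltjes_univ (hs : 0 < s) (hK : Bornology.IsBounded K) :
    (contentStieltjes hs hK).measure univ = dyadicContent s K := by
  have hbot : Tendsto (contentStieltjes hs hK) atBot (𝓝 0) := by
    obtain ⟨x, hx⟩ := hK.bddBelow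
    refine tendsto_const_nhds.congr' ?_
    filter_upwards [eventually_lt_atBot x] with y hy
    have hdisj : K ∩ Iic y = ∅ := disjoint_iff_inter_eq_empty.1 <| Set.disjoint_left.2
      fun z hzK hz => (hy.trans_le (hx hzK)).not_ge hz
    change 0 = contentCDF s K y
    rw [contentCDF, hdisj, dyadicContent_empty, ENNReal.toReal_zero]
  have htop : Tendsto (contentStieltjes hs hK) atTop (𝓝 (dyadicContent s K).toReal) := by
    obtain ⟨x, hx⟩ := hK.bddAbove
    refine tendsto_const_nhds.congr' ?_
    filter_upwards [eventually_ge_atTop x] with y hy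
    change _ = contentCDF s K y
    have hKy : K ⊆ Iic y := fun z hzK => (hx hzK).trans hy
    rw [contentCDF, inter_eq_left.2 hKy]
  rw [StieltjesFunction.measure_univ _ hbot htop, sub_zero,
    ENNReal.ofReal_toReal (dyadicContent_lt_top_of_isBounded s hK).ne]

theorem exists_measure_closedBall_le_of_dyadicContent_pos (hs : 0 < s) (hK : IsCompact K)
    (hpos : 0 < dyadicContent s K) :
    ∃ μ : Measure ℝ, IsFiniteMeasure μ ∧ μ K ≠ 0 ∧
      ∃ C : ℝ, 0 < C ∧ ∀ x r, 0 < r → μ (Metric.closedBall x r) ≤ ENNReal.ofReal (C * r ^ s) := by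
  set μ := (contentStieltjes hs hK.isBounded).measure
  have huniv : μ univ = dyadicContent s K := measure_contentStieltjes_univ hs hK.isBounded
  have hfin := (dyadicContent_lt_top_of_isBounded s hK.isBounded).ne
  set M := (dyadicContent s K).toReal
  have hM : μ univ = ENNReal.ofReal M := huniv.trans (ENNReal.ofReal_toReal hfin).symm
  refine ⟨μ, ⟨by rw [hM]; exact ENNReal.ofReal_lt_top⟩, ?_, (2 * 2 ^ s + M) * 3 ^ s,
    by positivity, fun x r hr => ?_⟩
  · rw [measure_congr (eventuallyEq_univ.2 (measure_contentStieltjes_compl hs hK)), huniv]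
    exact hpos.ne'
  rw [mul_assoc, ← Real.mul_rpow (by norm_num) hr.le, add_mul,
    ENNReal.ofReal_add (by positivity) (by positivity)]
  rcases le_total (3 * r) 1 with hr3 | hr3
  · calc μ (Metric.closedBall x r) ≤ μ (Ioc (x - 2 * r) (x + r)) := by
          refine measure_mono fun y hy => ?_
          rw [Real.closedBall_eq_Icc] at hy
          exact ⟨by linarith [hy.1], hy.2⟩
      _ ≤ dyadicContent s (Icc (x - 2 * r) (x + r)) :=
          (measure_contentStieltjes_Ioc_le hs hK.isBounded (by linarith)).trans
            (dyadicContent_mono s (inter_subset_right.trans Ioc_subset_Icc_self))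
      _ ≤ ENNReal.ofReal (2 * 2 ^ s * (3 * r) ^ s) := by
          refine (dyadicContent_Icc_le hs.le (by linarith) (by linarith)).trans_eq ?_
          ring_nf
      _ ≤ _ := le_self_add
  · calc μ (Metric.closedBall x r) ≤ ENNReal.ofReal M := hM ▸ measure_mono (subset_univ _)
      _ ≤ ENNReal.ofReal (M * (3 * r) ^ s) := by
          gcongr
          exact le_mul_of_one_le_right ENNReal.toReal_nonneg (Real.one_le_rpow hr3 hs.le)
      _ ≤ _ := le_add_self

/-- Frostman's lemma. -/
theorem exists_measure_closedBall_le_of_lt_dimH (hA : AnalyticSet A) (hs : 0 < s)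
    (h : ENNReal.ofReal s < dimH A) :
    ∃ μ : Measure ℝ, IsFiniteMeasure μ ∧ μ A ≠ 0 ∧
      ∃ C : ℝ, 0 < C ∧ ∀ x r, 0 < r → μ (Metric.closedBall x r) ≤ ENNReal.ofReal (C * r ^ s) := by
  have hpos : 0 < dyadicContent s A := by
    refine pos_iff_ne_zero.2 fun h0 => ENNReal.zero_ne_top ?_
    rw [← hausdorffMeasure_eq_zero_of_dyadicContent_eq_zero hs h0, ← hausdorffMeasure_of_lt_dimH h,
      Real.coe_toNNReal s hs.le]
  obtain ⟨K, hKA, hK, hKpos⟩ := exists_isCompact_dyadicContent_pos hA hpos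
  obtain ⟨μ, hμ, hμK, hC⟩ := exists_measure_closedBall_le_of_dyadicContent_pos hs hK hKpos
  exact ⟨μ, hμ, ne_bot_of_le_ne_bot hμK (measure_mono hKA), hC⟩

end Frostman

section MassDistribution

variable {X : Type*} [EMetricSpace X] [MeasurableSpace X] [BorelSpace X] {ν : Measure X} {E : Set X}
  {t : ℝ≥0}

lemma le_dimH_of_forall_measure_le {C : ℝ≥0} (hE : ν E ≠ 0)
    (h : ∀ s, Metric.ediam s ≠ ∞ → ν s ≤ C * Metric.ediam s ^ (t : ℝ)) : (t : ℝ≥0∞) ≤ dimH E := by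
  refine le_dimH_of_hausdorffMeasure_ne_zero fun h0 => ?_
  have hle : (((C + 1 : ℝ≥0) : ℝ≥0∞))⁻¹ • ν ≤ μH[t] := by
    refine Measure.le_hausdorffMeasure t _ 1 one_pos fun s hs => ?_
    rw [Measure.smul_apply, smul_eq_mul, ENNReal.inv_mul_le_iff (by simp) (by simp)]
    refine (h s (hs.trans_lt ENNReal.one_lt_top).ne).trans ?_
    gcongr
    exact le_self_add
  have hzero := hle E
  rw [h0, Measure.smul_apply, smul_eq_mul, nonpos_iff_eq_zero, mul_eq_zero] at hzero
  exact hzero.elim (by simp) hE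

lemma measure_le_mul_ediam_rpow {x : X} {s : Set X} (hx : x ∈ s) (hs : Metric.ediam s ≠ ∞)
    {M : ℝ≥0} (hM : ∫⁻ y, edist x y ^ (-t : ℝ) ∂ν ≤ M) : ν s ≤ M * Metric.ediam s ^ (t : ℝ) := by
  have hmeas : Measurable fun y => edist x y ^ (-t : ℝ) := measurable_edist_right.pow_const _
  have hmarkov : Metric.ediam s ^ (-t : ℝ) * ν s ≤ M := by
    refine le_trans ?_ ((mul_meas_ge_le_lintegral hmeas (Metric.ediam s ^ (-t : ℝ))).trans hM)
    gcongr
    intro y hy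
    simp only [mem_ofPred_eq, ENNReal.rpow_neg, ENNReal.inv_le_inv]
    gcongr
    exact Metric.edist_le_ediam_of_mem hx hy
  rw [mul_comm, ENNReal.rpow_neg] at hmarkov
  have hdiv := (ENNReal.le_div_iff_mul_le
    (Or.inl (ENNReal.inv_ne_zero.2 (ENNReal.rpow_ne_top_of_nonneg t.2 hs)))
    (Or.inr ENNReal.coe_ne_top)).2 hmarkov
  rwa [div_eq_mul_inv, inv_inv] at hdiv

theorem le_dimH_of_energy_ne_top [SecondCountableTopology X] [SFinite ν] (hE : ν E ≠ 0)
    (henergy : ∫⁻ x, ∫⁻ y, edist x y ^ (-t : ℝ) ∂ν ∂ν ≠ ∞) : (t : ℝ≥0∞) ≤ dimH E := by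
  set V : X → ℝ≥0∞ := fun x => ∫⁻ y, edist x y ^ (-t : ℝ) ∂ν
  have hV : Measurable V := Measurable.lintegral_prod_right'
    (f := fun p : X × X => edist p.1 p.2 ^ (-t : ℝ)) (measurable_edist.pow_const _)
  obtain ⟨M, hM⟩ : ∃ M : ℕ, ν (E ∩ {x | V x ≤ M}) ≠ 0 := by
    by_contra! hnull
    refine hE (measure_mono_null (fun x hx => ?_) (measure_union_null (measure_iUnion_null hnull)
      (t := {x | ¬ V x < ∞}) (ae_lt_top hV henergy)))
    by_cases h : V x < ∞
    · obtain ⟨n, hn⟩ := ENNReal.exists_nat_gt h.ne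
      exact Or.inl (mem_iUnion.2 ⟨n, hx, hn.le⟩)
    · exact Or.inr h
  have hS : MeasurableSet {x | V x ≤ M} := measurableSet_le hV measurable_const
  refine le_dimH_of_forall_measure_le (ν := ν.restrict {x | V x ≤ M}) (C := M)
    (by rwa [Measure.restrict_apply' hS]) fun s hs => ?_
  rw [Measure.restrict_apply' hS]
  rcases (s ∩ {x | V x ≤ M}).eq_empty_or_nonempty with hempty | ⟨x, hx⟩
  · simp [hempty]
  have hsub := Metric.ediam_mono (inter_subset_left (s := s) (t := {x | V x ≤ M}))
  refine (measure_le_mul_ediam_rpow hx (ne_top_of_le_ne_top hs hsub) hx.2).trans ?_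
  rw [ENNReal.coe_natCast]
  gcongr

end MassDistribution

section Graphs

variable {X : Type*} [EMetricSpace X] {f : X → ℝ} {A : Set X} {C γ : ℝ≥0}

lemma dimH_graphOver (f : ℝ → ℝ) (A : Set ℝ) : dimH (graphOver f A) = dimH (A.graphOn f) := by
  let e := (ContinuousLinearEquiv.finTwoArrow ℝ ℝ).symm.trans (EuclideanSpace.equiv (Fin 2) ℝ).symm
  rw [← e.dimH_image, graphOn, image_image]
  rfl

lemma dimH_graphOn_le_div {D : ℝ≥0} (hA : Metric.ediam A ≤ D) (hf : HolderOnWith C γ f A)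
    (hγ : 0 < γ) (hγ1 : γ ≤ 1) : dimH (A.graphOn f) ≤ dimH A / γ := by
  have hid : HolderOnWith (1 * D ^ ((1 : ℝ≥0) - γ : ℝ)) γ id A :=
    HolderOnWith.of_le (fun x hx y hy => (Metric.edist_le_ediam_of_mem hx hy).trans hA)
      (holderWith_id.holderOnWith A) hγ1
  have hgraph : HolderOnWith (max (1 * D ^ ((1 : ℝ≥0) - γ : ℝ)) C) γ (fun x => (x, f x)) A := by
    intro x hx y hy
    rw [Prod.edist_eq, ENNReal.coe_max, max_mul]
    exact max_le_max (hid x hx y hy) (hf x hx y hy)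
  exact hgraph.dimH_image_le hγ

lemma exists_cover_graphOn {T : Set X} {r L : ℝ≥0} (hr : 0 < r) (hT : Metric.ediam T ≤ r)
    (hf : Metric.ediam (f '' T) ≤ L) :
    ∃ P : Fin (⌊L / r⌋₊ + 1) → Set (X × ℝ),
      T.graphOn f ⊆ ⋃ j, P j ∧ ∀ j, Metric.ediam (P j) ≤ r := by
  have hr' : (0 : ℝ) < r := hr
  have hbdd : Bornology.IsBounded (f '' T) :=
    Metric.isBounded_iff_ediam_ne_top.2 (ne_top_of_le_ne_top ENNReal.coe_ne_top hf)
  set m := sInf (f '' T)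
  have hfm (x : X) (hx : x ∈ T) : m ≤ f x := csInf_le hbdd.bddBelow (mem_image_of_mem f hx)
  have hfL (x : X) (hx : x ∈ T) : f x - m ≤ L := by
    have hdiam : sSup (f '' T) - m ≤ L := by
      rwa [Real.ediam_eq hbdd, ENNReal.ofReal_le_iff_le_toReal ENNReal.coe_ne_top] at hf
    linarith [le_csSup hbdd.bddAbove (mem_image_of_mem f hx)]
  refine ⟨fun j => T ×ˢ Icc (m + j * r) (m + (j + 1) * r), ?_, fun j => ?_⟩
  · rintro _ ⟨x, hx, rfl⟩
    have hnonneg : 0 ≤ (f x - m) / r := div_nonneg (sub_nonneg.2 (hfm x hx)) hr'.le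
    have hlt : ⌊(f x - m) / r⌋₊ < ⌊L / r⌋₊ + 1 := by
      refine Nat.lt_succ_of_le (Nat.le_floor (NNReal.coe_le_coe.1 ?_))
      rw [NNReal.coe_natCast, NNReal.coe_div]
      exact (Nat.floor_le hnonneg).trans (by gcongr; exact hfL x hx)
    refine mem_iUnion.2 ⟨⟨_, hlt⟩, hx, ?_, ?_⟩
    · have hle := Nat.floor_le hnonneg
      rw [le_div_iff₀ hr'] at hle
      simp only
      linarith
    · have hgt := Nat.lt_floor_add_one ((f x - m) / r)
      rw [div_lt_iff₀ hr'] at hgt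
      simp only
      linarith
  · refine Metric.ediam_le fun p hp p' hp' => max_le ?_ ?_
    · exact (Metric.edist_le_ediam_of_mem hp.1 hp'.1).trans hT
    · refine (Metric.edist_le_ediam_of_mem hp.2 hp'.2).trans_eq ?_
      rw [Real.ediam_Icc]
      ring_nf
      exact ENNReal.ofReal_coe_nnreal

lemma floor_add_one_mul_rpow_le {r : ℝ≥0} (hr : 0 < r) (hr1 : r ≤ 1) (hγ1 : γ ≤ 1) {d : ℝ} :
    (⌊C * r ^ (γ : ℝ) / r⌋₊ + 1) * r ^ (d + 1 - γ) ≤ (C + 1) * r ^ d := by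
  have hfloor : (⌊C * r ^ (γ : ℝ) / r⌋₊ : ℝ≥0) ≤ C * r ^ (γ : ℝ) / r := Nat.floor_le zero_le
  have hpow : r ^ (γ : ℝ) / r * r ^ (d + 1 - γ) = r ^ d := by
    rw [← NNReal.rpow_sub_one hr.ne', ← NNReal.rpow_add hr.ne']
    ring_nf
  have hexp : d ≤ d + 1 - γ := by
    have : (γ : ℝ) ≤ 1 := hγ1
    linarith
  calc (⌊C * r ^ (γ : ℝ) / r⌋₊ + 1) * r ^ (d + 1 - γ)
      ≤ C * r ^ (γ : ℝ) / r * r ^ (d + 1 - γ) + r ^ (d + 1 - γ) := by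
        rw [add_mul, one_mul]
        gcongr
    _ ≤ C * r ^ d + r ^ d := by
        rw [mul_div_assoc, mul_assoc, hpow]
        exact add_le_add_right (NNReal.rpow_le_rpow_of_exponent_ge hr hr1 hexp) _
    _ = (C + 1) * r ^ d := by ring

lemma hausdorffMeasure_graphOn_eq_zero [MeasurableSpace X] [BorelSpace X]
    (hf : HolderOnWith C γ f A) (hγ1 : γ ≤ 1) {d : ℝ} (hd : 0 < d) (hA : μH[d] A = 0) :
    μH[d + 1 - γ] (A.graphOn f) = 0 := by
  refine hausdorffMeasure_eq_zero_of_forall_exists_cover (by linarith) fun ε hε => ?_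
  obtain ⟨t, r, hcov, hr, htr, hsum⟩ := exists_cover_of_hausdorffMeasure_eq_zero hd hA
    (ε := min 1 (ε / (C + 1))) (by positivity)
  have hr1 (i : ℕ) : r i ≤ 1 := by
    have hle := ((ENNReal.le_tsum i).trans hsum).trans (ENNReal.coe_le_coe.2 (min_le_left _ _))
    rw [← ENNReal.coe_rpow_of_nonneg _ hd.le, ENNReal.coe_le_coe] at hle
    exact not_lt.1 fun hlt => (NNReal.one_lt_rpow hlt hd).not_ge hle
  choose P hP hPr using fun i => exists_cover_graphOn (T := t i ∩ A) (f := f) (hr i)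
    ((Metric.ediam_mono inter_subset_left).trans (htr i)) (L := C * r i ^ (γ : ℝ)) (by
      rw [ENNReal.coe_mul, ENNReal.coe_rpow_of_nonneg _ γ.coe_nonneg]
      exact hf.ediam_image_inter_le_of_le (htr i))
  refine ⟨Σ i, Fin (⌊C * r i ^ (γ : ℝ) / r i⌋₊ + 1), inferInstance, fun p => P p.1 p.2, ?_, ?_⟩
  · rintro _ ⟨x, hx, rfl⟩
    obtain ⟨i, hi⟩ := mem_iUnion.1 (hcov hx)
    obtain ⟨j, hj⟩ := mem_iUnion.1 (hP i (mem_image_of_mem _ ⟨hi, hx⟩))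
    exact mem_iUnion.2 ⟨⟨i, j⟩, hj⟩
  have hpieces (i : ℕ) : ∑' j, Metric.ediam (P i j) ^ (d + 1 - γ) ≤ (C + 1) * (r i : ℝ≥0∞) ^ d := by
    rw [tsum_fintype]
    calc ∑ j, Metric.ediam (P i j) ^ (d + 1 - γ)
        ≤ ∑ _j : Fin (⌊C * r i ^ (γ : ℝ) / r i⌋₊ + 1), (r i : ℝ≥0∞) ^ (d + 1 - γ) := by
          gcongr with j
          · linarith
          · exact hPr i j
      _ ≤ (C + 1) * (r i : ℝ≥0∞) ^ d := by
          rw [Finset.sum_const, Finset.card_univ, Fintype.card_fin, nsmul_eq_mul,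
            ← ENNReal.coe_rpow_of_nonneg _ (by linarith), ← ENNReal.coe_rpow_of_nonneg _ hd.le]
          exact_mod_cast floor_add_one_mul_rpow_le (hr i) (hr1 i) hγ1
  calc ∑' p : Σ i, Fin (⌊C * r i ^ (γ : ℝ) / r i⌋₊ + 1), Metric.ediam (P p.1 p.2) ^ (d + 1 - γ)
      ≤ ∑' i, (C + 1) * (r i : ℝ≥0∞) ^ d := by
        rw [ENNReal.tsum_sigma']
        exact ENNReal.tsum_le_tsum hpieces
    _ ≤ (C + 1) * ((ε / (C + 1) : ℝ≥0) : ℝ≥0∞) := by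
        rw [ENNReal.tsum_mul_left]
        gcongr
        exact hsum.trans (ENNReal.coe_le_coe.2 (min_le_right _ _))
    _ = ε := by
        norm_cast
        field_simp

lemma dimH_graphOn_le_add (hf : HolderOnWith C γ f A) (hγ1 : γ ≤ 1) :
    dimH (A.graphOn f) ≤ dimH A + 1 - γ := by
  borelize X
  have hle (d : ℝ≥0) (hd : dimH A < d) : dimH (A.graphOn f) ≤ ((d + 1 - γ : ℝ≥0) : ℝ≥0∞) := by
    have hd0 : (0 : ℝ) < d := by exact_mod_cast zero_le.trans_lt hd
    refine dimH_le_of_hausdorffMeasure_ne_top ?_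
    rw [NNReal.coe_sub (hγ1.trans le_add_self), NNReal.coe_add, NNReal.coe_one,
      hausdorffMeasure_graphOn_eq_zero hf hγ1 hd0 (hausdorffMeasure_of_dimH_lt hd)]
    exact ENNReal.zero_ne_top
  refine ENNReal.le_sub_of_add_le_right ENNReal.coe_ne_top (tsub_le_iff_right.1 ?_)
  refine le_of_forall_gt fun d hd => ?_
  obtain ⟨d', hd', hdd⟩ := ENNReal.lt_iff_exists_nnreal_btwn.1 hd
  refine lt_of_le_of_lt (tsub_le_iff_right.2 ?_) hdd
  refine (add_le_add_left (hle d' hd') _).trans_eq ?_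
  norm_cast
  exact tsub_add_cancel_of_le (hγ1.trans le_add_self)

end Graphs

section LayerCake

variable {Ω : Type*} [MeasurableSpace Ω] {μ : Measure Ω} {f : Ω → ℝ} {B κ α : ℝ}

lemma measure_eq_zero_of_measure_le_rpow (hκ : 0 < κ)
    (hB : ∀ r, 0 < r → μ {ω | f ω ≤ r} ≤ ENNReal.ofReal (B * r ^ κ)) : μ {ω | f ω ≤ 0} = 0 := by
  have hcont : Continuous fun r : ℝ => ENNReal.ofReal (B * r ^ κ) :=
    ENNReal.continuous_ofReal.comp
      (continuous_const.mul (continuous_id.rpow_const fun _ => Or.inr hκ.le))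
  have hlim : Tendsto (fun r : ℝ => ENNReal.ofReal (B * r ^ κ)) (𝓝[>] 0) (𝓝 0) := by
    simpa [Real.zero_rpow hκ.ne'] using
      (hcont.tendsto 0).mono_left (nhdsWithin_le_nhds (s := Ioi 0))
  refine le_antisymm (ge_of_tendsto hlim ?_) zero_le
  filter_upwards [self_mem_nhdsWithin] with r (hr : 0 < r)
  exact (measure_mono fun ω (hω : f ω ≤ 0) => hω.trans hr.le).trans (hB r hr)

lemma lintegral_ofReal_rpow_neg_le (hf : Measurable f) (hf0 : ∀ ω, 0 ≤ f ω) (hκ : 0 < κ)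
    (hB : ∀ r, 0 < r → μ {ω | f ω ≤ r} ≤ ENNReal.ofReal (B * r ^ κ)) :
    ∫⁻ ω, ENNReal.ofReal (f ω) ^ (-α) ∂μ ≤ ∫⁻ t in Ioi (0 : ℝ), μ {ω | t ≤ f ω ^ (-α)} := by
  rw [← lintegral_eq_lintegral_meas_le μ (Eventually.of_forall fun ω => Real.rpow_nonneg (hf0 ω) _)
    (hf.pow_const _).aemeasurable]
  refine lintegral_mono_ae ?_
  filter_upwards [measure_eq_zero_iff_ae_notMem.1 (measure_eq_zero_of_measure_le_rpow hκ hB)]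
    with ω hω
  rw [ENNReal.ofReal_rpow_of_pos (not_le.1 hω)]

lemma measure_le_rpow_neg_le (hf0 : ∀ ω, 0 ≤ f ω) (hα : 0 < α)
    (hB : ∀ r, 0 < r → μ {ω | f ω ≤ r} ≤ ENNReal.ofReal (B * r ^ κ)) {t : ℝ} (ht : 0 < t) :
    μ {ω | t ≤ f ω ^ (-α)} ≤ ENNReal.ofReal (B * t ^ (-(κ / α))) := by
  have hsub : {ω | t ≤ f ω ^ (-α)} ⊆ {ω | f ω ≤ t ^ (-α⁻¹)} := fun ω (hω : t ≤ f ω ^ (-α)) => by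
    change f ω ≤ t ^ (-α⁻¹)
    rcases (hf0 ω).eq_or_lt with hzero | hpos
    · rw [← hzero]
      positivity
    · have hpow := Real.rpow_le_rpow_of_nonpos ht hω (neg_nonpos.2 (inv_nonneg.2 hα.le))
      rwa [← Real.rpow_mul hpos.le, neg_mul_neg, mul_inv_cancel₀ hα.ne', Real.rpow_one] at hpow
  refine (measure_mono hsub).trans ((hB _ (Real.rpow_pos_of_pos ht _)).trans_eq ?_)
  rw [← Real.rpow_mul ht.le, neg_mul, inv_mul_eq_div]

lemma lintegral_rpow_neg_le_of_lt (hf : Measurable f) (hf0 : ∀ ω, 0 ≤ f ω) (hB0 : 0 ≤ B)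
    (hα : 0 < α) (hακ : α < κ) {T : ℝ} (hT : 0 < T)
    (hB : ∀ r, 0 < r → μ {ω | f ω ≤ r} ≤ ENNReal.ofReal (B * r ^ κ)) :
    ∫⁻ ω, ENNReal.ofReal (f ω) ^ (-α) ∂μ ≤
      ENNReal.ofReal T * μ univ + ENNReal.ofReal (B * (T ^ (1 - κ / α) / (κ / α - 1))) := by
  have hκα : 1 < κ / α := by rwa [one_lt_div hα]
  refine (lintegral_ofReal_rpow_neg_le hf hf0 (hα.trans hακ) hB).trans ?_
  rw [← Ioc_union_Ioi_eq_Ioi hT.le]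
  refine (lintegral_union_le _ _ _).trans (add_le_add ?_ ?_)
  · calc ∫⁻ t in Ioc 0 T, μ {ω | t ≤ f ω ^ (-α)} ≤ ∫⁻ _ in Ioc 0 T, μ univ :=
          lintegral_mono fun t => measure_mono (subset_univ _)
      _ = ENNReal.ofReal T * μ univ := by
          rw [lintegral_const, Measure.restrict_apply_univ, Real.volume_Ioc, sub_zero, mul_comm]
  · calc ∫⁻ t in Ioi T, μ {ω | t ≤ f ω ^ (-α)}
        ≤ ∫⁻ t in Ioi T, ENNReal.ofReal (B * t ^ (-(κ / α))) :=
          setLIntegral_mono' measurableSet_Ioi fun t ht =>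
            measure_le_rpow_neg_le hf0 hα hB (hT.trans ht)
      _ = ENNReal.ofReal (∫ t in Ioi T, B * t ^ (-(κ / α))) := by
          rw [ofReal_integral_eq_lintegral_ofReal]
          · exact (integrableOn_Ioi_rpow_of_lt (by linarith) hT).const_mul B
          · filter_upwards [ae_restrict_mem measurableSet_Ioi] with t ht
            exact mul_nonneg hB0 (Real.rpow_nonneg (hT.trans ht).le _)
      _ = _ := by
          rw [integral_const_mul, integral_Ioi_rpow_of_lt (by linarith) hT,
            show -(κ / α) + 1 = -(κ / α - 1) by ring, neg_div_neg_eq,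
            show -(κ / α - 1) = 1 - κ / α by ring]

lemma setLIntegral_Ioc_measure_le_rpow_neg_le (hf0 : ∀ ω, 0 ≤ f ω) (hB0 : 0 ≤ B) (hα : 0 < α)
    (hκα : κ < α) {T : ℝ} (hT : 0 ≤ T)
    (hB : ∀ r, 0 < r → μ {ω | f ω ≤ r} ≤ ENNReal.ofReal (B * r ^ κ)) :
    ∫⁻ t in Ioc 0 T, μ {ω | t ≤ f ω ^ (-α)} ≤
      ENNReal.ofReal (B * (T ^ (1 - κ / α) / (1 - κ / α))) := by
  have hratio : κ / α < 1 := by rwa [div_lt_one hα]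
  calc ∫⁻ t in Ioc 0 T, μ {ω | t ≤ f ω ^ (-α)}
      ≤ ∫⁻ t in Ioc 0 T, ENNReal.ofReal (B * t ^ (-(κ / α))) :=
        setLIntegral_mono' measurableSet_Ioc fun t ht => measure_le_rpow_neg_le hf0 hα hB ht.1
    _ = ENNReal.ofReal (∫ t in Ioc 0 T, B * t ^ (-(κ / α))) := by
        rw [ofReal_integral_eq_lintegral_ofReal]
        · have hint := intervalIntegral.intervalIntegrable_rpow' (a := 0) (b := T)
            (r := -(κ / α)) (by linarith)
          exact ((intervalIntegrable_iff_integrableOn_Ioc_of_le hT).1 hint).const_mul B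
        · filter_upwards [ae_restrict_mem measurableSet_Ioc] with t ht
          exact mul_nonneg hB0 (Real.rpow_nonneg ht.1.le _)
    _ = _ := by
        rw [integral_const_mul, ← intervalIntegral.integral_of_le hT,
          integral_rpow (Or.inl (by linarith)), Real.zero_rpow (by linarith), sub_zero,
          show -(κ / α) + 1 = 1 - κ / α by ring]

lemma lintegral_rpow_neg_le_of_gt (hf : Measurable f) {h : ℝ} (hh : 0 < h) (hhf : ∀ ω, h ≤ f ω)
    (hB0 : 0 ≤ B) (hκ : 0 < κ) (hκα : κ < α)
    (hB : ∀ r, 0 < r → μ {ω | f ω ≤ r} ≤ ENNReal.ofReal (B * r ^ κ)) :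
    ∫⁻ ω, ENNReal.ofReal (f ω) ^ (-α) ∂μ ≤
      ENNReal.ofReal (B * (h ^ (κ - α) / (1 - κ / α))) := by
  have hα : 0 < α := hκ.trans hκα
  have hf0 (ω : Ω) : 0 ≤ f ω := hh.le.trans (hhf ω)
  have hT : 0 < h ^ (-α) := Real.rpow_pos_of_pos hh _
  have hbeyond : ∫⁻ t in Ioi (h ^ (-α)), μ {ω | t ≤ f ω ^ (-α)} = 0 := by
    rw [setLIntegral_congr_fun measurableSet_Ioi (g := fun _ => 0), lintegral_zero]
    intro t (ht : h ^ (-α) < t)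
    have hempty : {ω | t ≤ f ω ^ (-α)} = ∅ := eq_empty_of_forall_notMem fun ω hω =>
      ((Real.rpow_le_rpow_of_nonpos hh (hhf ω) (by linarith)).trans_lt ht).not_ge hω
    simp only [hempty, measure_empty]
  have hexp : (h ^ (-α)) ^ (1 - κ / α) = h ^ (κ - α) := by
    rw [← Real.rpow_mul hh.le]
    congr 1
    field_simp
    ring
  refine (lintegral_ofReal_rpow_neg_le hf hf0 hκ hB).trans ?_
  rw [← Ioc_union_Ioi_eq_Ioi hT.le, ← hexp]
  refine (lintegral_union_le _ _ _).trans ?_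
  rw [hbeyond, add_zero]
  exact setLIntegral_Ioc_measure_le_rpow_neg_le hf0 hB0 hα hκα hT.le hB

end LayerCake

section OscillatoryIntegrals

/-- First-derivative test, from integration by parts against `1 / φ'`. -/
lemma abs_integral_cos_le {φ φ' φ'' : ℝ → ℝ} {a b m M : ℝ} (hab : a ≤ b) (hm : 0 < m)
    (hφ : ∀ t ∈ Icc a b, HasDerivAt φ (φ' t) t) (hφ' : ∀ t ∈ Icc a b, HasDerivAt φ' (φ'' t) t)
    (hφ'' : ContinuousOn φ'' (Icc a b)) (hlow : ∀ t ∈ Icc a b, m ≤ |φ' t|)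
    (hup : ∀ t ∈ Icc a b, |φ'' t| ≤ M) :
    |∫ t in a..b, Real.cos (φ t)| ≤ 2 / m + M / m ^ 2 * (b - a) := by
  have hIcc : uIcc a b = Icc a b := uIcc_of_le hab
  have hne : ∀ t ∈ Icc a b, φ' t ≠ 0 := fun t ht => abs_pos.1 (hm.trans_le (hlow t ht))
  have hcφ : ContinuousOn φ (Icc a b) := HasDerivAt.continuousOn hφ
  have hcφ' : ContinuousOn φ' (Icc a b) := HasDerivAt.continuousOn hφ'
  have hcw' : ContinuousOn (fun t => -φ'' t / φ' t ^ 2) (Icc a b) :=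
    hφ''.neg.div (hcφ'.pow 2) fun t ht => pow_ne_zero 2 (hne t ht)
  have hparts := intervalIntegral.integral_mul_deriv_eq_deriv_mul (a := a) (b := b)
    (u := fun t => (φ' t)⁻¹) (v := fun t => Real.sin (φ t))
    (fun t ht => (hφ' t (hIcc ▸ ht)).inv (hne t (hIcc ▸ ht)))
    (fun t ht => (hφ t (hIcc ▸ ht)).sin) (hIcc ▸ hcw').intervalIntegrable
    (hIcc ▸ (Real.continuous_cos.comp_continuousOn hcφ).mul hcφ').intervalIntegrable
  have hcancel : ∫ t in a..b, Real.cos (φ t) =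
      ∫ t in a..b, (φ' t)⁻¹ * (Real.cos (φ t) * φ' t) :=
    intervalIntegral.integral_congr fun t ht => by
      have := hne t (hIcc ▸ ht)
      field_simp
  have hboundary : ∀ t ∈ Icc a b, |(φ' t)⁻¹ * Real.sin (φ t)| ≤ 1 / m := fun t ht => by
    rw [abs_mul, abs_inv, ← one_div]
    exact (mul_le_of_le_one_right (by positivity) (Real.abs_sin_le_one _)).trans
      (one_div_le_one_div_of_le hm (hlow t ht))
  have hinterior : ∀ t ∈ Icc a b, |-φ'' t / φ' t ^ 2 * Real.sin (φ t)| ≤ M / m ^ 2 := fun t ht => by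
    have hM : 0 ≤ M := (abs_nonneg _).trans (hup t ht)
    rw [abs_mul, abs_div, abs_neg, abs_pow]
    exact (mul_le_of_le_one_right (by positivity) (Real.abs_sin_le_one _)).trans
      (div_le_div₀ hM (hup t ht) (by positivity) (pow_le_pow_left₀ hm.le (hlow t ht) 2))
  have hremainder := intervalIntegral.norm_integral_le_of_norm_le_const (a := a) (b := b)
    (C := M / m ^ 2) (f := fun t => -φ'' t / φ' t ^ 2 * Real.sin (φ t)) fun t ht =>
      hinterior t (Ioc_subset_Icc_self (uIoc_of_le hab ▸ ht))
  rw [Real.norm_eq_abs, abs_of_nonneg (sub_nonneg.2 hab)] at hremainder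
  rw [hcancel, hparts, show 2 / m = 1 / m + 1 / m by ring]
  refine (abs_sub _ _).trans (add_le_add ((abs_sub _ _).trans (add_le_add ?_ ?_)) hremainder)
  · exact hboundary b (right_mem_Icc.2 hab)
  · exact hboundary a (left_mem_Icc.2 hab)

end OscillatoryIntegrals

section Bessel

/-- The Bessel function `J₀`, the characteristic function of the cosine of a uniform phase. -/
noncomputable def besselZero (u : ℝ) : ℝ :=
  ∫ t in (0 : ℝ)..1, Real.cos (u * Real.cos (2 * Real.pi * t))

lemma besselZero_neg (u : ℝ) : besselZero (-u) = besselZero u := by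
  simp [besselZero]

lemma abs_integral_cos_mul_cos_le_sub {a b : ℝ} (hab : a ≤ b) (u : ℝ) :
    |∫ t in a..b, Real.cos (u * Real.cos (2 * Real.pi * t))| ≤ b - a := by
  have h := intervalIntegral.norm_integral_le_of_norm_le_const (a := a) (b := b) (C := 1)
    (f := fun t => Real.cos (u * Real.cos (2 * Real.pi * t))) fun t _ => Real.abs_cos_le_one _
  rwa [one_mul, abs_of_nonneg (sub_nonneg.2 hab)] at h

lemma abs_besselZero_le_one (u : ℝ) : |besselZero u| ≤ 1 := by
  simpa [besselZero] using abs_integral_cos_mul_cos_le_sub zero_le_one u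

lemma integral_cos_two_pi_mul_sq : ∫ t in (0 : ℝ)..1, Real.cos (2 * Real.pi * t) ^ 2 = 1 / 2 := by
  rw [intervalIntegral.integral_comp_mul_left (fun x => Real.cos x ^ 2) (by positivity),
    integral_cos_sq]
  simp [Real.sin_two_pi]
  field_simp

lemma integral_one_sub_mul_cos_sq (a : ℝ) :
    ∫ t in (0 : ℝ)..1, (1 - a * Real.cos (2 * Real.pi * t) ^ 2) = 1 - a / 2 := by
  rw [intervalIntegral.integral_sub (by simp) (Continuous.intervalIntegrable (by fun_prop) _ _),
    intervalIntegral.integral_const_mul, integral_cos_two_pi_mul_sq, integral_one]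
  ring

lemma one_sub_sq_div_four_le_besselZero (u : ℝ) : 1 - u ^ 2 / 4 ≤ besselZero u := by
  rw [show 1 - u ^ 2 / 4 = 1 - u ^ 2 / 2 / 2 by ring, ← integral_one_sub_mul_cos_sq, besselZero]
  refine intervalIntegral.integral_mono_on zero_le_one
    (Continuous.intervalIntegrable (by fun_prop) _ _)
    (Continuous.intervalIntegrable (by fun_prop) _ _) fun t _ => ?_
  exact le_of_eq_of_le (by ring)
    (Real.one_sub_sq_div_two_le_cos (x := u * Real.cos (2 * Real.pi * t)))

lemma cos_le_one_sub_two_fifths_mul_sq {y : ℝ} (hy : |y| ≤ 1) :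
    Real.cos y ≤ 1 - 2 / 5 * y ^ 2 := by
  have htaylor := (abs_le.1 (Real.cos_bound hy)).2
  have hsq : y ^ 2 ≤ 1 := (sq_le_one_iff_abs_le_one y).2 hy
  have hfour : |y| ^ 4 = y ^ 2 * y ^ 2 := by rw [← sq_abs y]; ring
  nlinarith [sq_nonneg y]

lemma besselZero_le_one_sub_sq_div_five {u : ℝ} (hu : |u| ≤ 1) :
    besselZero u ≤ 1 - u ^ 2 / 5 := by
  rw [show 1 - u ^ 2 / 5 = 1 - 2 * u ^ 2 / 5 / 2 by ring, ← integral_one_sub_mul_cos_sq, besselZero]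
  refine intervalIntegral.integral_mono_on zero_le_one
    (Continuous.intervalIntegrable (by fun_prop) _ _)
    (Continuous.intervalIntegrable (by fun_prop) _ _) fun t _ => ?_
  refine (cos_le_one_sub_two_fifths_mul_sq ?_).trans_eq (by ring)
  rw [abs_mul]
  exact mul_le_one₀ hu (abs_nonneg _) (Real.abs_cos_le_one _)

lemma four_mul_le_sin_two_pi_mul {ε t : ℝ} (hε : 0 ≤ ε) (ht : t ∈ Icc ε (1 / 2 - ε)) :
    4 * ε ≤ Real.sin (2 * Real.pi * t) := by
  have hπ := Real.pi_pos
  rcases le_total t (1 / 4) with h | h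
  · have hjordan := Real.mul_le_sin (x := 2 * Real.pi * t)
      (by have := hε.trans ht.1; positivity) (by nlinarith)
    have hcancel : 2 / Real.pi * (2 * Real.pi * t) = 4 * t := by field_simp; ring
    linarith [ht.1]
  · have hjordan := Real.mul_le_sin (x := Real.pi - 2 * Real.pi * t)
      (by nlinarith [ht.2]) (by nlinarith)
    rw [Real.sin_pi_sub] at hjordan
    have hcancel : 2 / Real.pi * (Real.pi - 2 * Real.pi * t) = 2 - 4 * t := by field_simp; ring
    linarith [ht.2]

lemma besselZero_eq_two_mul_integral (u : ℝ) :
    besselZero u = 2 * ∫ t in (0 : ℝ)..(1 / 2), Real.cos (u * Real.cos (2 * Real.pi * t)) := by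
  set f : ℝ → ℝ := fun t => Real.cos (u * Real.cos (2 * Real.pi * t)) with hf
  have hfc : Continuous f := by fun_prop
  have hhalf : ∫ t in (1 / 2 : ℝ)..1, f t = ∫ t in (0 : ℝ)..(1 / 2), f t := by
    have hshift := intervalIntegral.integral_comp_add_right (a := (0 : ℝ)) (b := 1 / 2) f (1 / 2)
    rw [zero_add, add_halves] at hshift
    rw [← hshift]
    refine intervalIntegral.integral_congr fun t _ => ?_
    simp only [hf]
    rw [show 2 * Real.pi * (t + 1 / 2) = 2 * Real.pi * t + Real.pi by ring, Real.cos_add_pi,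
      mul_neg, Real.cos_neg]
  rw [besselZero, ← intervalIntegral.integral_add_adjacent_intervals
    (hfc.intervalIntegrable 0 (1 / 2)) (hfc.intervalIntegrable (1 / 2) 1), hhalf, two_mul]

lemma abs_integral_cos_mul_cos_le {u ε : ℝ} (hu : 0 < u) (hε : 0 < ε) (hε4 : ε ≤ 1 / 4) :
    |∫ t in ε..(1 / 2 - ε), Real.cos (u * Real.cos (2 * Real.pi * t))| ≤ 1 / (u * ε ^ 2) := by
  have hπ := Real.pi_gt_three
  have hlin (t : ℝ) : HasDerivAt (fun t : ℝ => 2 * Real.pi * t) (2 * Real.pi) t := by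
    simpa using (hasDerivAt_id t).const_mul (2 * Real.pi)
  have hmain := abs_integral_cos_le (a := ε) (b := 1 / 2 - ε)
    (m := u * (4 * ε * (2 * Real.pi))) (M := u * (2 * Real.pi * (2 * Real.pi)))
    (by linarith) (by positivity)
    (fun t _ => (hlin t).cos.const_mul u)
    (fun t _ => ((hlin t).sin.neg.mul_const (2 * Real.pi)).const_mul u)
    (by fun_prop)
    (fun t ht => by
      rw [abs_mul, abs_mul, abs_neg, abs_of_pos hu, abs_of_pos (by positivity : 0 < 2 * Real.pi)]
      gcongr
      exact (four_mul_le_sin_two_pi_mul hε.le ht).trans (le_abs_self _))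
    (fun t _ => by
      rw [abs_mul, abs_mul, abs_neg, abs_mul, abs_of_pos hu,
        abs_of_pos (by positivity : 0 < 2 * Real.pi)]
      exact mul_le_mul_of_nonneg_left (mul_le_mul_of_nonneg_right (mul_le_of_le_one_left
        (by positivity) (Real.abs_cos_le_one _)) (by positivity)) hu.le)
  refine hmain.trans ?_
  have hlen : 1 / 2 - ε - ε ≤ 1 := by linarith
  calc 2 / (u * (4 * ε * (2 * Real.pi))) +
        u * (2 * Real.pi * (2 * Real.pi)) / (u * (4 * ε * (2 * Real.pi))) ^ 2 * (1 / 2 - ε - ε)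
      ≤ 2 / (u * (4 * ε * (2 * Real.pi))) +
        u * (2 * Real.pi * (2 * Real.pi)) / (u * (4 * ε * (2 * Real.pi))) ^ 2 * 1 := by gcongr
    _ = (ε / (4 * Real.pi) + 1 / 16) / (u * ε ^ 2) := by field_simp; ring
    _ ≤ 1 / (u * ε ^ 2) := by
      gcongr
      have hεπ : ε / (4 * Real.pi) ≤ 1 / 4 / (4 * 3) := by gcongr
      linarith

lemma abs_besselZero_le {u ε : ℝ} (hu : 0 < u) (hε : 0 < ε) (hε4 : ε ≤ 1 / 4) :
    |besselZero u| ≤ 4 * ε + 2 / (u * ε ^ 2) := by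
  have hfi (a b : ℝ) :
      IntervalIntegrable (fun t => Real.cos (u * Real.cos (2 * Real.pi * t))) volume a b :=
    Continuous.intervalIntegrable (by fun_prop) a b
  have hleft := abs_integral_cos_mul_cos_le_sub hε.le u
  have hright := abs_integral_cos_mul_cos_le_sub (sub_le_self (1 / 2) hε.le) u
  have hmiddle := abs_integral_cos_mul_cos_le hu hε hε4
  rw [besselZero_eq_two_mul_integral, abs_mul, abs_two,
    ← intervalIntegral.integral_add_adjacent_intervals (hfi 0 (1 / 2 - ε)) (hfi _ _),
    ← intervalIntegral.integral_add_adjacent_intervals (hfi 0 ε) (hfi _ _)]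
  calc _ ≤ 2 * (ε - 0 + 1 / (u * ε ^ 2) + (1 / 2 - (1 / 2 - ε))) := by
        gcongr
        exact (abs_add_le _ _).trans (add_le_add ((abs_add_le _ _).trans (by gcongr)) hright)
    _ = 4 * ε + 2 / (u * ε ^ 2) := by ring

/-- Van der Corput decay; the exponent `1 / 3` is not optimal. -/
lemma abs_besselZero_pow_three_le {u : ℝ} (hu : 1 ≤ u) : |besselZero u| ^ 3 ≤ 33 ^ 3 / u := by
  have hu0 : 0 < u := by linarith
  set v := u ^ (1 / 3 : ℝ) with hv
  have hv1 : 1 ≤ v := Real.one_le_rpow hu (by norm_num)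
  have hvu : v ^ 3 = u := by rw [hv, ← Real.rpow_natCast, ← Real.rpow_mul hu0.le]; norm_num
  have hle : |besselZero u| ≤ 33 / v := by
    refine (abs_besselZero_le (ε := 1 / (4 * v)) hu0 (by positivity)
      (one_div_le_one_div_of_le (by norm_num) (by linarith))).trans_eq ?_
    rw [← hvu]
    field_simp
    ring
  calc |besselZero u| ^ 3 ≤ (33 / v) ^ 3 := by gcongr
    _ = 33 ^ 3 / u := by rw [div_pow, hvu]

/-- By Jensen's inequality for the square, applied to `cos (2 x) = 2 cos² x - 1`. -/
lemma two_mul_besselZero_sq_sub_one_le (u : ℝ) :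
    2 * besselZero u ^ 2 - 1 ≤ besselZero (2 * u) := by
  set X : ℝ → ℝ := fun t => Real.cos (u * Real.cos (2 * Real.pi * t))
  have hXc : Continuous X := by fun_prop
  have hdouble : besselZero (2 * u) = 2 * (∫ t in (0 : ℝ)..1, X t ^ 2) - 1 := by
    simp only [besselZero, mul_assoc 2 u, Real.cos_two_mul]
    rw [intervalIntegral.integral_sub (Continuous.intervalIntegrable (by fun_prop) _ _) (by simp),
      intervalIntegral.integral_const_mul, integral_one, sub_zero]
  have hvariance : ∫ t in (0 : ℝ)..1, (X t - besselZero u) ^ 2 =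
      (∫ t in (0 : ℝ)..1, X t ^ 2) - besselZero u ^ 2 := by
    have hexpand (t : ℝ) : (X t - besselZero u) ^ 2 =
        X t ^ 2 - (2 * besselZero u * X t - besselZero u ^ 2) := by ring
    have hmean : ∫ t in (0 : ℝ)..1, X t = besselZero u := rfl
    simp only [hexpand]
    rw [intervalIntegral.integral_sub (Continuous.intervalIntegrable (by fun_prop) _ _)
      (Continuous.intervalIntegrable (by fun_prop) _ _),
      intervalIntegral.integral_sub (Continuous.intervalIntegrable (by fun_prop) _ _) (by simp),
      intervalIntegral.integral_const_mul, hmean, intervalIntegral.integral_const]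
    simp only [sub_zero, one_smul]
    ring
  have hnonneg : 0 ≤ ∫ t in (0 : ℝ)..1, (X t - besselZero u) ^ 2 :=
    intervalIntegral.integral_nonneg zero_le_one fun t _ => sq_nonneg _
  linarith

/-- For large `u` this is the decay of `J₀`; the doubling inequality then carries the bound down
to `1`, halving the range at each step. -/
lemma exists_abs_besselZero_le_one_sub : ∃ η : ℝ, 0 < η ∧ ∀ u, 1 ≤ u → |besselZero u| ≤ 1 - η := by
  suffices key : ∀ m : ℕ, ∃ η : ℝ, 0 < η ∧ η ≤ 1 ∧
      ∀ u, 66 ^ 3 / 2 ^ m ≤ u → |besselZero u| ≤ 1 - η by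
    obtain ⟨η, hη, -, h⟩ := key 20
    exact ⟨η, hη, fun u hu => h u (le_trans (by norm_num) hu)⟩
  intro m
  induction m with
  | zero =>
    refine ⟨1 / 2, by norm_num, by norm_num, fun u hu => ?_⟩
    rw [pow_zero, div_one] at hu
    refine le_of_pow_le_pow_left₀ three_ne_zero (by norm_num)
      ((abs_besselZero_pow_three_le (by linarith)).trans ?_)
    rw [div_le_iff₀ (by linarith)]
    linarith
  | succ m ih =>
    obtain ⟨η, hη, hη1, h⟩ := ih
    refine ⟨η / 4, by positivity, by linarith, fun u hu => ?_⟩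
    have hprev := (abs_le.1 (h (2 * u) (by
      rw [pow_succ (2 : ℝ), ← div_div, div_le_iff₀ (by norm_num)] at hu
      linarith))).2
    have hdouble := two_mul_besselZero_sq_sub_one_le u
    refine abs_le_of_sq_le_sq ?_ (by linarith)
    nlinarith

lemma exists_abs_besselZero_pow_six_mul_le :
    ∃ c : ℝ, 0 < c ∧ ∀ u, |besselZero u| ^ 6 * (1 + c * u ^ 2) ≤ 1 := by
  obtain ⟨η, hη, hgap⟩ := exists_abs_besselZero_le_one_sub
  obtain ⟨c, hc0, hc5, hcη, hc⟩ : ∃ c : ℝ, 0 < c ∧ c ≤ 1 / 5 ∧ c ≤ η / (2 * 33 ^ 6) ∧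
      c ≤ 1 / (2 * 33 ^ 6) :=
    ⟨min (1 / 5) (min (η / (2 * 33 ^ 6)) (1 / (2 * 33 ^ 6))), by positivity, min_le_left _ _,
      (min_le_right _ _).trans (min_le_left _ _), (min_le_right _ _).trans (min_le_right _ _)⟩
  refine ⟨c, hc0, fun u => ?_⟩
  wlog hu0 : 0 ≤ u generalizing u
  · simpa only [besselZero_neg, neg_sq] using this (-u) (by linarith)
  have hsix : |besselZero u| ^ 6 ≤ |besselZero u| :=
    pow_le_of_le_one (abs_nonneg _) (abs_besselZero_le_one u) (by norm_num)
  rcases le_total u 1 with hsmall | hu1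
  · have hu : |u| ≤ 1 := by rwa [abs_of_nonneg hu0]
    have hJ0 : 0 ≤ besselZero u :=
      le_trans (by nlinarith) (one_sub_sq_div_four_le_besselZero u)
    rw [abs_of_nonneg hJ0] at hsix ⊢
    have hJ := besselZero_le_one_sub_sq_div_five hu
    calc besselZero u ^ 6 * (1 + c * u ^ 2) ≤ (1 - u ^ 2 / 5) * (1 + 1 / 5 * u ^ 2) :=
          mul_le_mul (hsix.trans hJ) (by gcongr) (by positivity) (hJ0.trans hJ)
      _ ≤ 1 := by nlinarith [sq_nonneg (u ^ 2)]
  rcases le_total (u ^ 2) (2 * 33 ^ 6) with hmedium | hlarge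
  · have hcu : c * u ^ 2 ≤ η :=
      calc c * u ^ 2 ≤ η / (2 * 33 ^ 6) * (2 * 33 ^ 6) := by gcongr
        _ = η := by field_simp
    have hJ := hgap u hu1
    calc |besselZero u| ^ 6 * (1 + c * u ^ 2) ≤ (1 - η) * (1 + η) :=
          mul_le_mul (hsix.trans hJ) (by gcongr) (by positivity) ((abs_nonneg _).trans hJ)
      _ ≤ 1 := by nlinarith
  · have hu2 : 0 < u ^ 2 := by positivity
    have hdecay : |besselZero u| ^ 6 ≤ 33 ^ 6 / u ^ 2 :=
      calc |besselZero u| ^ 6 = (|besselZero u| ^ 3) ^ 2 := by ring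
        _ ≤ (33 ^ 3 / u) ^ 2 := by gcongr; exact abs_besselZero_pow_three_le hu1
        _ = 33 ^ 6 / u ^ 2 := by ring
    calc |besselZero u| ^ 6 * (1 + c * u ^ 2) ≤ 33 ^ 6 / u ^ 2 * (1 + c * u ^ 2) := by gcongr
      _ = 33 ^ 6 / u ^ 2 + 33 ^ 6 * c := by field_simp
      _ ≤ 1 / 2 + 33 ^ 6 * (1 / (2 * 33 ^ 6)) := by
          refine add_le_add ?_ (by gcongr)
          rw [div_le_div_iff₀ hu2 (by norm_num)]
          linarith
      _ = 1 := by norm_num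

lemma one_add_sum_le_prod_one_add {ι : Type*} (s : Finset ι) {x : ι → ℝ} (hx : ∀ i, 0 ≤ x i) :
    1 + ∑ i ∈ s, x i ≤ ∏ i ∈ s, (1 + x i) := by
  classical
  induction s using Finset.induction_on with
  | empty => simp
  | insert i s hi ih =>
    rw [Finset.sum_insert hi, Finset.prod_insert hi]
    have hsum : 0 ≤ ∑ j ∈ s, x j := Finset.sum_nonneg fun j _ => hx j
    nlinarith [mul_nonneg (hx i) hsum, mul_le_mul_of_nonneg_left ih (add_nonneg zero_le_one (hx i))]

lemma exists_prod_abs_besselZero_pow_six_le {ι : Type*} :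
    ∃ c : ℝ, 0 < c ∧ ∀ (s : Finset ι) (u : ι → ℝ),
      (∏ i ∈ s, |besselZero (u i)|) ^ 6 ≤ (1 + c * ∑ i ∈ s, u i ^ 2)⁻¹ := by
  obtain ⟨c, hc, hJ⟩ := exists_abs_besselZero_pow_six_mul_le
  refine ⟨c, hc, fun s u => ?_⟩
  calc (∏ i ∈ s, |besselZero (u i)|) ^ 6 = ∏ i ∈ s, |besselZero (u i)| ^ 6 :=
        (Finset.prod_pow ..).symm
    _ ≤ ∏ i ∈ s, (1 + c * u i ^ 2)⁻¹ :=
        Finset.prod_le_prod (fun i _ => by positivity) fun i _ => by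
          rw [← one_div, le_div_iff₀ (by positivity)]
          exact hJ (u i)
    _ = (∏ i ∈ s, (1 + c * u i ^ 2))⁻¹ := Finset.prod_inv_distrib ..
    _ ≤ (1 + c * ∑ i ∈ s, u i ^ 2)⁻¹ := by
        rw [Finset.mul_sum]
        exact inv_anti₀ (by positivity) (one_add_sum_le_prod_one_add s fun i => by positivity)

end Bessel

section Concentration

lemma integral_exp_neg_mul_sq_eq_integral_charFun (ν : Measure ℝ) [IsFiniteMeasure ν] (v : ℝ≥0) :
    ((∫ z, Real.exp (-(v * z ^ 2 / 2)) ∂ν : ℝ) : ℂ) = ∫ ξ, charFun ν ξ ∂(gaussianReal 0 v) := by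
  have hgauss (z : ℝ) : ((Real.exp (-(v * z ^ 2 / 2)) : ℝ) : ℂ) =
      ∫ ξ, Complex.exp (z * ξ * Complex.I) ∂(gaussianReal 0 v) := by
    rw [← charFun_apply_real, charFun_gaussianReal]
    push_cast
    congr 1
    ring
  rw [← integral_complex_ofReal]
  simp_rw [hgauss, charFun_apply_real]
  rw [integral_integral_swap]
  · simp_rw [mul_comm (Complex.ofReal _) (Complex.ofReal _)]
  · refine Integrable.of_bound (C := 1) (Continuous.aestronglyMeasurable (by fun_prop))
      (Eventually.of_forall fun p => ?_)
    rw [Function.uncurry, ← Complex.ofReal_mul, Complex.norm_exp_ofReal_mul_I]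

lemma gaussianPDFReal_le_inv_sqrt (m : ℝ) (v : ℝ≥0) (x : ℝ) : gaussianPDFReal m v x ≤ (√v)⁻¹ := by
  rcases eq_zero_or_pos v with rfl | hv
  · simp
  rw [gaussianPDFReal_def]
  have hexp : Real.exp (-(x - m) ^ 2 / (2 * v)) ≤ 1 := by
    rw [Real.exp_le_one_iff, neg_div]
    exact neg_nonpos.2 (by positivity)
  have hsqrt : √(v : ℝ) ≤ √(2 * Real.pi * v) :=
    Real.sqrt_le_sqrt (le_mul_of_one_le_left v.coe_nonneg (by linarith [Real.pi_gt_three]))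
  exact (mul_le_of_le_one_right (by positivity) hexp).trans
    (inv_anti₀ (Real.sqrt_pos.2 hv) hsqrt)

lemma integral_exp_neg_mul_sq_le_of_norm_charFun_le {ν : Measure ℝ} [IsFiniteMeasure ν] {a : ℝ}
    (ha : 0 < a) (h : ∀ ξ, ‖charFun ν ξ‖ ≤ (1 + (a * ξ) ^ 2)⁻¹) {v : ℝ≥0} (hv : 0 < v) :
    ∫ z, Real.exp (-(v * z ^ 2 / 2)) ∂ν ≤ (√v)⁻¹ * (Real.pi / a) := by
  have hcauchy : ∫ ξ : ℝ, (√v)⁻¹ * (1 + (a * ξ) ^ 2)⁻¹ = (√v)⁻¹ * (Real.pi / a) := by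
    rw [integral_const_mul, Measure.integral_comp_mul_left (fun x => (1 + x ^ 2)⁻¹) a,
      integral_univ_inv_one_add_sq, abs_of_pos (inv_pos.2 ha), smul_eq_mul]
    ring
  calc ∫ z, Real.exp (-(v * z ^ 2 / 2)) ∂ν
      ≤ ‖((∫ z, Real.exp (-(v * z ^ 2 / 2)) ∂ν : ℝ) : ℂ)‖ := by
        rw [Complex.norm_real]
        exact Real.le_norm_self _
    _ ≤ ∫ ξ, ‖charFun ν ξ‖ ∂(gaussianReal 0 v) := by
        rw [integral_exp_neg_mul_sq_eq_integral_charFun]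
        exact norm_integral_le_integral_norm _
    _ = ∫ ξ, gaussianPDFReal 0 v ξ * ‖charFun ν ξ‖ := by
        rw [integral_gaussianReal_eq_integral_smul hv.ne']
        rfl
    _ ≤ ∫ ξ : ℝ, (√v)⁻¹ * (1 + (a * ξ) ^ 2)⁻¹ :=
        integral_mono_of_nonneg
          (Eventually.of_forall fun ξ => mul_nonneg (gaussianPDFReal_nonneg _ _ _) (norm_nonneg _))
          ((integrable_inv_one_add_sq.comp_mul_left' ha.ne').const_mul _)
          (Eventually.of_forall fun ξ => mul_le_mul (gaussianPDFReal_le_inv_sqrt _ _ _) (h ξ)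
            (norm_nonneg _) (by positivity))
    _ = _ := hcauchy

/-- Decay of the characteristic function prevents concentration near the origin: test against the
Gaussian of variance `r²`. -/
lemma measure_abs_le_of_norm_charFun_le {ν : Measure ℝ} [IsFiniteMeasure ν] {a : ℝ}
    (ha : 0 < a) (h : ∀ ξ, ‖charFun ν ξ‖ ≤ (1 + (a * ξ) ^ 2)⁻¹) {r : ℝ} (hr : 0 < r) :
    ν {z | |z| ≤ r} ≤ ENNReal.ofReal (8 * r / a) := by
  obtain ⟨v, hv⟩ : ∃ v : ℝ≥0, (v : ℝ) = (r⁻¹) ^ 2 := ⟨⟨(r⁻¹) ^ 2, by positivity⟩, rfl⟩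
  have hv0 : 0 < v := by rw [← NNReal.coe_pos, hv]; positivity
  have hupper := integral_exp_neg_mul_sq_le_of_norm_charFun_le ha h hv0
  rw [hv, Real.sqrt_sq (by positivity), inv_inv] at hupper
  have hint : Integrable (fun z : ℝ => Real.exp (-((r⁻¹) ^ 2 * z ^ 2 / 2))) ν := by
    refine Integrable.of_bound (C := 1) (Continuous.aestronglyMeasurable (by fun_prop))
      (Eventually.of_forall fun z => ?_)
    rw [Real.norm_eq_abs, Real.abs_exp, Real.exp_le_one_iff]
    exact neg_nonpos.2 (by positivity)
  have hhalf : ∀ z ∈ {z : ℝ | |z| ≤ r}, (1 / 2 : ℝ) ≤ Real.exp (-((r⁻¹) ^ 2 * z ^ 2 / 2)) := by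
    intro z (hz : |z| ≤ r)
    have hle : (r⁻¹) ^ 2 * z ^ 2 ≤ 1 := by
      rw [← mul_pow, sq_le_one_iff_abs_le_one, abs_mul, abs_of_pos (inv_pos.2 hr)]
      exact inv_mul_le_one_of_le₀ hz hr.le
    linarith [Real.add_one_le_exp (-((r⁻¹) ^ 2 * z ^ 2 / 2))]
  have hlower : ν.real {z | |z| ≤ r} * (1 / 2) ≤ ∫ z, Real.exp (-((r⁻¹) ^ 2 * z ^ 2 / 2)) ∂ν :=
    calc ν.real {z | |z| ≤ r} * (1 / 2) = ∫ _ in {z | |z| ≤ r}, (1 / 2 : ℝ) ∂ν := by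
          rw [setIntegral_const, smul_eq_mul]
      _ ≤ ∫ z in {z | |z| ≤ r}, Real.exp (-((r⁻¹) ^ 2 * z ^ 2 / 2)) ∂ν :=
          setIntegral_mono_on (integrable_const _).integrableOn hint.integrableOn
            (measurableSet_le measurable_norm measurable_const) hhalf
      _ ≤ _ := setIntegral_le_integral hint (Eventually.of_forall fun z => (Real.exp_pos _).le)
  rw [← ofReal_measureReal]
  refine ENNReal.ofReal_le_ofReal ?_
  calc ν.real {z | |z| ≤ r} ≤ 2 * (r * (Real.pi / a)) := by linarith
    _ = 2 * Real.pi * r / a := by ring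
    _ ≤ 8 * r / a := by
        gcongr
        linarith [Real.pi_le_four]

lemma lintegral_pow_le_of_hasSubgaussianMGF {Ω : Type*} [MeasurableSpace Ω] {P : Measure Ω}
    {X : Ω → ℝ} {V : ℝ≥0} (h : HasSubgaussianMGF X V P) (hV : 0 < V) (p : ℕ) :
    ∫⁻ ω, ENNReal.ofReal (|X ω| ^ p) ∂P ≤ ENNReal.ofReal (4 * p ^ p * √V ^ p) := by
  have : 0 < √(V : ℝ) := Real.sqrt_pos.2 hV
  set t := (√(V : ℝ))⁻¹ with ht
  have hmgf {t' : ℝ} (ht' : t' ^ 2 = t ^ 2) : ∫ ω, Real.exp (t' * X ω) ∂P ≤ 2 := by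
    have hexp : Real.exp (V * t' ^ 2 / 2) = Real.exp (1 / 2) := by
      rw [ht', ht, inv_pow, Real.sq_sqrt V.coe_nonneg, mul_inv_cancel₀ (NNReal.coe_pos.2 hV).ne']
    have hsq : Real.exp (1 / 2) ^ 2 = Real.exp 1 := by rw [← Real.exp_nat_mul]; norm_num
    exact ((h.mgf_le t').trans_eq hexp).trans
      (by nlinarith [Real.exp_one_lt_d9, Real.exp_pos (1 / 2)])
  have hpoint (ω : Ω) : |X ω| ^ p ≤
      p ^ p * √V ^ p * (Real.exp (t * X ω) + Real.exp (-t * X ω)) := by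
    have hmax := rpow_abs_le_mul_max_exp_of_pos (X ω) (t := t) (Nat.cast_nonneg p) (by positivity)
    rw [Real.rpow_natCast, Real.rpow_natCast, ht, div_inv_eq_mul, mul_pow, ← ht] at hmax
    exact hmax.trans (by gcongr; exact max_le_add_of_nonneg (Real.exp_nonneg _) (Real.exp_nonneg _))
  have hi : Integrable (fun ω => p ^ p * √V ^ p *
      (Real.exp (t * X ω) + Real.exp (-t * X ω))) P :=
    ((h.integrable_exp_mul t).add (h.integrable_exp_mul (-t))).const_mul _
  calc ∫⁻ ω, ENNReal.ofReal (|X ω| ^ p) ∂P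
      ≤ ∫⁻ ω, ENNReal.ofReal (p ^ p * √V ^ p * (Real.exp (t * X ω) + Real.exp (-t * X ω))) ∂P :=
        lintegral_mono fun ω => ENNReal.ofReal_le_ofReal (hpoint ω)
    _ = ENNReal.ofReal (∫ ω, p ^ p * √V ^ p * (Real.exp (t * X ω) + Real.exp (-t * X ω)) ∂P) :=
        (ofReal_integral_eq_lintegral_ofReal hi (Eventually.of_forall fun ω => by positivity)).symm
    _ ≤ ENNReal.ofReal (p ^ p * √V ^ p * (2 + 2)) := by
        rw [integral_const_mul, integral_add (h.integrable_exp_mul t) (h.integrable_exp_mul (-t))]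
        gcongr
        exacts [hmgf rfl, hmgf (neg_sq t)]
    _ = ENNReal.ofReal (4 * p ^ p * √V ^ p) := by congr 1; ring

end Concentration

section UniformPhases

variable {Ω : Type*} [MeasurableSpace Ω] {P : Measure Ω}

/-- `θ` is a sequence of independent phases, each uniformly distributed on `[0, 1]`. -/
structure IndepUniformPhases (θ : ℕ → Ω → ℝ) (P : Measure Ω) : Prop where
  measurable : ∀ n, Measurable (θ n)
  iIndepFun : iIndepFun θ P
  isUniform : ∀ n, pdf.IsUniform (θ n) (Icc (0 : ℝ) 1) P volume

lemma integral_periodic_comp_of_isUniform {X : Ω → ℝ} (hX : Measurable X)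
    (hu : pdf.IsUniform X (Icc (0 : ℝ) 1) P volume) {E : Type*} [NormedAddCommGroup E]
    [NormedSpace ℝ E] {g : ℝ → E} (hg : Continuous g) (hper : Function.Periodic g 1) (c : ℝ) :
    ∫ ω, g (c + X ω) ∂P = ∫ t in (0 : ℝ)..1, g t := by
  have hlaw : P.map X = volume.restrict (Icc (0 : ℝ) 1) := by
    rw [hu, ProbabilityTheory.cond, Real.volume_Icc, sub_zero, ENNReal.ofReal_one, inv_one,
      one_smul]
  calc ∫ ω, g (c + X ω) ∂P = ∫ x, g (c + x) ∂(P.map X) :=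
        (integral_map hX.aemeasurable
          (hg.comp (continuous_const_add c)).aestronglyMeasurable).symm
    _ = ∫ t in c..c + 1, g t := by
        rw [hlaw, integral_Icc_eq_integral_Ioc, ← intervalIntegral.integral_of_le zero_le_one,
          intervalIntegral.integral_comp_add_left, add_zero]
    _ = ∫ t in (0 : ℝ)..1, g t := by rw [hper.intervalIntegral_add_eq c 0, zero_add]

lemma periodic_cos_two_pi_mul : Function.Periodic (fun x : ℝ => Real.cos (2 * Real.pi * x)) 1 := by
  intro x
  simp only [mul_add, mul_one, Real.cos_add_two_pi]

lemma integral_sin_mul_cos_two_pi_mul (u : ℝ) :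
    ∫ t in (0 : ℝ)..1, Real.sin (u * Real.cos (2 * Real.pi * t)) = 0 := by
  set f : ℝ → ℝ := fun t => Real.sin (u * Real.cos (2 * Real.pi * t)) with hf
  have hper : Function.Periodic f 1 := periodic_cos_two_pi_mul.comp fun y => Real.sin (u * y)
  have hodd (t : ℝ) : f (t + 1 / 2) = -f t := by
    simp only [hf]
    rw [show 2 * Real.pi * (t + 1 / 2) = 2 * Real.pi * t + Real.pi by ring, Real.cos_add_pi,
      mul_neg, Real.sin_neg]
  have hshift := intervalIntegral.integral_comp_add_right (a := (0 : ℝ)) (b := 1) f (1 / 2)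
  rw [zero_add, add_comm (1 : ℝ), hper.intervalIntegral_add_eq (1 / 2) 0, zero_add] at hshift
  simp only [hodd, intervalIntegral.integral_neg] at hshift
  linarith

lemma integral_cexp_mul_cos (u : ℝ) :
    ∫ t in (0 : ℝ)..1, Complex.exp ((u * Real.cos (2 * Real.pi * t) : ℝ) * Complex.I) =
      besselZero u := by
  have heuler (t : ℝ) : Complex.exp ((u * Real.cos (2 * Real.pi * t) : ℝ) * Complex.I) =
      ((Real.cos (u * Real.cos (2 * Real.pi * t)) : ℝ) : ℂ) +
        ((Real.sin (u * Real.cos (2 * Real.pi * t)) : ℝ) : ℂ) * Complex.I := by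
    rw [Complex.exp_mul_I, ← Complex.ofReal_cos, ← Complex.ofReal_sin]
  simp only [heuler]
  rw [intervalIntegral.integral_add (Continuous.intervalIntegrable (by fun_prop) _ _)
    (Continuous.intervalIntegrable (by fun_prop) _ _), intervalIntegral.integral_mul_const,
    intervalIntegral.integral_ofReal, intervalIntegral.integral_ofReal,
    integral_sin_mul_cos_two_pi_mul, Complex.ofReal_zero, zero_mul, add_zero, besselZero]

end UniformPhases

section CosineSeries

variable {Ω : Type*} {b : ℕ → ℝ} {θ : ℕ → Ω → ℝ}

/-- The random cosine series `∑ bₙ cos 2π(cₙ + θₙ)`: the increments of a random sine series have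
this form. -/
noncomputable def cosineSeries (b c : ℕ → ℝ) (θ : ℕ → Ω → ℝ) (ω : Ω) : ℝ :=
  ∑' n, b n * Real.cos (2 * Real.pi * (c n + θ n ω))

lemma norm_mul_cos_le (b y : ℝ) : ‖b * Real.cos y‖ ≤ |b| := by
  rw [norm_mul, Real.norm_eq_abs, Real.norm_eq_abs]
  exact mul_le_of_le_one_right (abs_nonneg _) (Real.abs_cos_le_one _)

lemma hasSum_cosineSeries (hb : Summable fun n => |b n|) (c : ℕ → ℝ) (θ : ℕ → Ω → ℝ) (ω : Ω) :
    HasSum (fun n => b n * Real.cos (2 * Real.pi * (c n + θ n ω))) (cosineSeries b c θ ω) :=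
  (Summable.of_norm_bounded hb fun _ => norm_mul_cos_le _ _).hasSum

lemma abs_sum_cosine_le (hb : Summable fun n => |b n|) (c : ℕ → ℝ) (θ : ℕ → Ω → ℝ) (ω : Ω)
    (s : Finset ℕ) :
    |∑ n ∈ s, b n * Real.cos (2 * Real.pi * (c n + θ n ω))| ≤ ∑' n, |b n| :=
  (Finset.abs_sum_le_sum_abs _ _).trans ((Finset.sum_le_sum fun _ _ => norm_mul_cos_le _ _).trans
    (hb.sum_le_tsum _ fun _ _ => abs_nonneg _))

lemma abs_cosineSeries_le (hb : Summable fun n => |b n|) (c : ℕ → ℝ) (θ : ℕ → Ω → ℝ) (ω : Ω) :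
    |cosineSeries b c θ ω| ≤ ∑' n, |b n| :=
  tsum_of_norm_bounded hb.hasSum fun _ => norm_mul_cos_le _ _

variable [MeasurableSpace Ω] {P : Measure Ω}

lemma measurable_sum_cosine (hθ : ∀ n, Measurable (θ n)) (b c : ℕ → ℝ) (s : Finset ℕ) :
    Measurable fun ω => ∑ n ∈ s, b n * Real.cos (2 * Real.pi * (c n + θ n ω)) := by
  fun_prop

lemma measurable_cosineSeries (hθ : ∀ n, Measurable (θ n)) (hb : Summable fun n => |b n|)
    (c : ℕ → ℝ) : Measurable (cosineSeries b c θ) :=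
  measurable_of_tendsto_metrizable (fun N => measurable_sum_cosine hθ b c (Finset.range N))
    (tendsto_pi_nhds.2 fun ω => (hasSum_cosineSeries hb c θ ω).tendsto_sum_nat)

lemma charFun_map_sum_cosine (hθ : IndepUniformPhases θ P) (b c : ℕ → ℝ) (s : Finset ℕ) (ξ : ℝ) :
    charFun (P.map fun ω => ∑ n ∈ s, b n * Real.cos (2 * Real.pi * (c n + θ n ω))) ξ =
      ∏ n ∈ s, (besselZero (ξ * b n) : ℂ) := by
  set g : ℕ → ℝ → ℂ := fun n x =>
    Complex.exp ((ξ * b n * Real.cos (2 * Real.pi * x) : ℝ) * Complex.I) with hg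
  have hgc (n : ℕ) : Continuous (g n) := by simp only [hg]; fun_prop
  have hper (n : ℕ) : Function.Periodic (g n) 1 :=
    periodic_cos_two_pi_mul.comp fun y => Complex.exp ((ξ * b n * y : ℝ) * Complex.I)
  have hprod (ω : Ω) : Complex.exp (ξ *
      (∑ n ∈ s, b n * Real.cos (2 * Real.pi * (c n + θ n ω)) : ℝ) * Complex.I) =
        ∏ n : s, g n (c n + θ n ω) := by
    rw [Finset.prod_coe_sort s (fun n => g n (c n + θ n ω)), ← Complex.exp_sum,
      ← Complex.ofReal_mul, Finset.mul_sum, Complex.ofReal_sum, Finset.sum_mul]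
    simp only [mul_assoc]
  rw [charFun_apply_real, integral_map (measurable_sum_cosine hθ.measurable b c s).aemeasurable
    (Continuous.aestronglyMeasurable (by fun_prop))]
  simp only [hprod]
  rw [iIndepFun.integral_fun_prod_comp (X := fun (n : s) ω => θ n ω)
    (hθ.iIndepFun.precomp Subtype.val_injective) (f := fun n x => g n (c n + x))
    (fun n => (hθ.measurable n).aemeasurable)
    (fun n => ((hgc n).comp (continuous_const_add _)).aestronglyMeasurable),
    Finset.prod_coe_sort s (fun n => ∫ ω, g n (c n + θ n ω) ∂P)]
  refine Finset.prod_congr rfl fun n _ => ?_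
  rw [integral_periodic_comp_of_isUniform (hθ.measurable n) (hθ.isUniform n) (hgc n) (hper n)]
  exact integral_cexp_mul_cos _

variable [IsProbabilityMeasure P]

lemma norm_charFun_map_cosineSeries_le (hθ : IndepUniformPhases θ P)
    (hb : Summable fun n => |b n|) (c : ℕ → ℝ) (s : Finset ℕ) (ξ : ℝ) :
    ‖charFun (P.map (cosineSeries b c θ)) ξ‖ ≤ ∏ n ∈ s, |besselZero (ξ * b n)| := by
  have hlim : Tendsto (fun N => charFun (P.map fun ω => ∑ n ∈ Finset.range N,
      b n * Real.cos (2 * Real.pi * (c n + θ n ω))) ξ) atTop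
      (𝓝 (charFun (P.map (cosineSeries b c θ)) ξ)) := by
    have hcont : Continuous fun z : ℝ => Complex.exp (ξ * z * Complex.I) := by fun_prop
    simp only [charFun_apply_real]
    rw [integral_map (measurable_cosineSeries hθ.measurable hb c).aemeasurable
      hcont.aestronglyMeasurable]
    simp only [integral_map (measurable_sum_cosine hθ.measurable b c _).aemeasurable
      hcont.aestronglyMeasurable]
    refine tendsto_integral_of_dominated_convergence (fun _ => 1) (fun N => ?_)
      (integrable_const _) (fun N => Eventually.of_forall fun ω => ?_)
      (Eventually.of_forall fun ω => ?_)
    · exact hcont.comp_aestronglyMeasurable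
        (measurable_sum_cosine hθ.measurable b c _).aestronglyMeasurable
    · rw [← Complex.ofReal_mul, Complex.norm_exp_ofReal_mul_I]
    · exact (hcont.tendsto _).comp (hasSum_cosineSeries hb c θ ω).tendsto_sum_nat
  refine le_of_tendsto hlim.norm ?_
  obtain ⟨N, hN⟩ := s.exists_nat_subset_range
  filter_upwards [eventually_ge_atTop N] with M hM
  rw [charFun_map_sum_cosine hθ, norm_prod]
  simp only [Complex.norm_real, Real.norm_eq_abs]
  exact Finset.prod_le_prod_of_subset_of_le_one (hN.trans (Finset.range_mono hM))
    (fun n _ => abs_nonneg _) (fun n _ _ => abs_besselZero_le_one _)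

/-- Each of six disjoint groups of coefficients contributes a factor `(1 + c B² ξ²) ^ (-1 / 6)` to
the bound for the characteristic function. -/
theorem exists_measure_abs_cosineSeries_le (hθ : IndepUniformPhases θ P) :
    ∃ D : ℝ, 0 < D ∧ ∀ {b : ℕ → ℝ}, (Summable fun n => |b n|) → ∀ (c : ℕ → ℝ)
      (F : Fin 6 → Finset ℕ), Pairwise (Function.onFun Disjoint F) → ∀ {B : ℝ}, 0 < B →
      (∀ i, B ^ 2 ≤ ∑ n ∈ F i, b n ^ 2) → ∀ {r : ℝ}, 0 < r →
      P {ω | |cosineSeries b c θ ω| ≤ r} ≤ ENNReal.ofReal (D * r / B) := by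
  obtain ⟨κ, hκ, hJ⟩ := exists_prod_abs_besselZero_pow_six_le (ι := ℕ)
  refine ⟨8 / √κ, by positivity, fun {b} hb c F hF {B} hB hBF {r} hr => ?_⟩
  have hm := measurable_cosineSeries hθ.measurable hb c
  have hdecay (ξ : ℝ) :
      ‖charFun (P.map (cosineSeries b c θ)) ξ‖ ≤ (1 + (√κ * B * ξ) ^ 2)⁻¹ := by
    refine (norm_charFun_map_cosineSeries_le hθ hb c (Finset.univ.biUnion F) ξ).trans ?_
    rw [Finset.prod_biUnion fun i _ j _ hij => hF hij]
    refine le_of_pow_le_pow_left₀ (by norm_num : 6 ≠ 0) (by positivity) ?_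
    rw [← Finset.prod_pow]
    calc ∏ i, (∏ n ∈ F i, |besselZero (ξ * b n)|) ^ 6
        ≤ ∏ _i : Fin 6, (1 + (√κ * B * ξ) ^ 2)⁻¹ :=
          Finset.prod_le_prod (fun i _ => by positivity) fun i _ => by
            refine (hJ (F i) fun n => ξ * b n).trans (inv_anti₀ (by positivity) ?_)
            simp only [mul_pow, ← Finset.mul_sum, Real.sq_sqrt hκ.le]
            nlinarith [mul_le_mul_of_nonneg_left (hBF i) (by positivity : 0 ≤ κ * ξ ^ 2)]
      _ = ((1 + (√κ * B * ξ) ^ 2)⁻¹) ^ 6 := by simp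
  have hball := measure_abs_le_of_norm_charFun_le (by positivity) hdecay hr
  have hball_meas : MeasurableSet {z : ℝ | |z| ≤ r} :=
    measurableSet_le measurable_norm measurable_const
  rw [Measure.map_apply hm hball_meas] at hball
  refine hball.trans_eq ?_
  congr 1
  field_simp

lemma hasSubgaussianMGF_mul_cos {X : Ω → ℝ} (hX : Measurable X)
    (hu : pdf.IsUniform X (Icc (0 : ℝ) 1) P volume) (b c : ℝ) :
    HasSubgaussianMGF (fun ω => b * Real.cos (2 * Real.pi * (c + X ω))) (‖b‖₊ ^ 2) P := by
  have hmean : ∫ ω, Real.cos (2 * Real.pi * (c + X ω)) ∂P = 0 := by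
    rw [integral_periodic_comp_of_isUniform hX hu (g := fun x => Real.cos (2 * Real.pi * x))
      (by fun_prop) periodic_cos_two_pi_mul,
      intervalIntegral.integral_comp_mul_left (fun x => Real.cos x) (by positivity), integral_cos]
    simp only [mul_zero, Real.sin_zero, mul_one, Real.sin_two_pi, sub_zero, smul_zero]
  have hhoeffding := hasSubgaussianMGF_of_mem_Icc_of_integral_eq_zero (μ := P)
    (X := fun ω => b * Real.cos (2 * Real.pi * (c + X ω))) (a := -|b|) (b := |b|)
    (Measurable.aemeasurable (by fun_prop))
    (Eventually.of_forall fun ω => abs_le.1 (norm_mul_cos_le b _))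
    (by rw [integral_const_mul, hmean, mul_zero])
  have hparam : ‖|b| - -|b|‖₊ / 2 = ‖b‖₊ := by
    rw [← NNReal.coe_inj, sub_neg_eq_add, ← two_mul]
    simp
  rwa [hparam] at hhoeffding

lemma mgf_sum_cosine_le (hθ : IndepUniformPhases θ P) (b c : ℕ → ℝ) (s : Finset ℕ) (t : ℝ) :
    mgf (fun ω => ∑ n ∈ s, b n * Real.cos (2 * Real.pi * (c n + θ n ω))) P t ≤
      Real.exp ((∑ n ∈ s, b n ^ 2) * t ^ 2 / 2) := by
  have hindep : iIndepFun (fun n ω => b n * Real.cos (2 * Real.pi * (c n + θ n ω))) P :=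
    hθ.iIndepFun.comp (fun n x => b n * Real.cos (2 * Real.pi * (c n + x))) fun n => by fun_prop
  have hsum := HasSubgaussianMGF.sum_of_iIndepFun hindep (s := s) (c := fun n => ‖b n‖₊ ^ 2)
    fun n _ => hasSubgaussianMGF_mul_cos (hθ.measurable n) (hθ.isUniform n) (b n) (c n)
  refine (hsum.mgf_le t).trans_eq ?_
  push_cast
  simp only [Real.norm_eq_abs, sq_abs]

theorem hasSubgaussianMGF_cosineSeries (hθ : IndepUniformPhases θ P)
    (hb : Summable fun n => |b n|) (c : ℕ → ℝ) {V : ℝ≥0}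
    (hV : ∀ s : Finset ℕ, ∑ n ∈ s, b n ^ 2 ≤ V) :
    HasSubgaussianMGF (cosineSeries b c θ) V P := by
  have hm := measurable_cosineSeries hθ.measurable hb c
  have hexp (t : ℝ) {y : ℝ} (hy : |y| ≤ ∑' n, |b n|) :
      ‖Real.exp (t * y)‖ ≤ Real.exp (|t| * ∑' n, |b n|) := by
    rw [Real.norm_eq_abs, Real.abs_exp, Real.exp_le_exp]
    exact (le_abs_self _).trans (by rw [abs_mul]; gcongr)
  refine ⟨fun t => Integrable.of_bound (by fun_prop) (Real.exp (|t| * ∑' n, |b n|))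
    (Eventually.of_forall fun ω => hexp t (abs_cosineSeries_le hb c θ ω)), fun t => ?_⟩
  have hcont : Continuous fun z : ℝ => Real.exp (t * z) := by fun_prop
  have hlim : Tendsto (fun N => mgf (fun ω => ∑ n ∈ Finset.range N,
      b n * Real.cos (2 * Real.pi * (c n + θ n ω))) P t) atTop
      (𝓝 (mgf (cosineSeries b c θ) P t)) := by
    refine tendsto_integral_of_dominated_convergence (fun _ => Real.exp (|t| * ∑' n, |b n|))
      (fun N => ?_) (integrable_const _)
      (fun N => Eventually.of_forall fun ω => hexp t (abs_sum_cosine_le hb c θ ω _))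
      (Eventually.of_forall fun ω => ?_)
    · exact hcont.comp_aestronglyMeasurable
        (measurable_sum_cosine hθ.measurable b c _).aestronglyMeasurable
    · exact (hcont.tendsto _).comp (hasSum_cosineSeries hb c θ ω).tendsto_sum_nat
  refine le_of_tendsto hlim (Eventually.of_forall fun N => ?_)
  refine (mgf_sum_cosine_le hθ b c _ t).trans (Real.exp_le_exp.2 ?_)
  gcongr
  exact hV _

end CosineSeries

section BlockExponents

variable {a lam : ℕ → ℝ} {q : ℝ} {k : ℕ}

/-- The indices of the `k`-th block, that is, those with frequency in `[q ^ k, q ^ (k + 1))`. -/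
def freqBlock (lam : ℕ → ℝ) (q : ℝ) (k : ℕ) : Set ℕ :=
  {m | q ^ k ≤ lam m ∧ lam m < q ^ (k + 1)}

lemma disjoint_freqBlock (hq : 1 < q) {i j : ℕ} (hij : i ≠ j) :
    Disjoint (freqBlock lam q i) (freqBlock lam q j) := by
  wlog hlt : i < j generalizing i j
  · exact (this hij.symm (hij.symm.lt_of_le (not_lt.1 hlt))).symm
  · refine disjoint_left.2 fun m hi hj => ?_
    exact (hi.2.trans_le ((pow_le_pow_right₀ hq.le hlt).trans hj.1)).false

lemma summable_sq_of_summable_abs (ha : Summable fun n => |a n|) :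
    Summable fun n => |a n| ^ 2 := by
  refine Summable.of_nonneg_of_le (fun n => by positivity) (fun n => ?_)
    (ha.mul_left (∑' n, |a n|))
  rw [sq]
  exact mul_le_mul_of_nonneg_right (ha.le_tsum n fun _ _ => abs_nonneg _) (abs_nonneg _)

lemma blockNorm_sq (a lam : ℕ → ℝ) (q : ℝ) (k : ℕ) :
    blockNorm a lam q k ^ 2 = ∑' n, (freqBlock lam q k).indicator (fun m => |a m| ^ 2) n :=
  Real.sq_sqrt (tsum_nonneg fun _ => indicator_nonneg (fun _ _ => by positivity) _)

lemma blockNorm_nonneg (a lam : ℕ → ℝ) (q : ℝ) (k : ℕ) : 0 ≤ blockNorm a lam q k :=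
  Real.sqrt_nonneg _

lemma sum_sq_le_blockNorm_sq (ha : Summable fun n => |a n|) {s : Finset ℕ}
    (hs : ∀ n ∈ s, n ∈ freqBlock lam q k) : ∑ n ∈ s, a n ^ 2 ≤ blockNorm a lam q k ^ 2 := by
  rw [blockNorm_sq]
  refine (Finset.sum_congr rfl fun n hn => ?_).trans_le
    (((summable_sq_of_summable_abs ha).indicator _).sum_le_tsum s fun n _ =>
      indicator_nonneg (fun _ _ => by positivity) _)
  rw [indicator_of_mem (hs n hn), sq_abs]

lemma exists_finset_sq_le_sum_of_lt_blockNorm (ha : Summable fun n => |a n|) {B : ℝ}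
    (hB : 0 ≤ B) (h : B < blockNorm a lam q k) :
    ∃ F : Finset ℕ, (∀ n ∈ F, n ∈ freqBlock lam q k) ∧ B ^ 2 ≤ ∑ n ∈ F, a n ^ 2 := by
  classical
  have hlt : B ^ 2 < ∑' n, (freqBlock lam q k).indicator (fun m => |a m| ^ 2) n := by
    rw [← blockNorm_sq]
    exact pow_lt_pow_left₀ h hB two_ne_zero
  have hsum := ((summable_sq_of_summable_abs ha).indicator (freqBlock lam q k)).hasSum
  obtain ⟨F, hF⟩ := (hsum.eventually (lt_mem_nhds hlt)).exists
  refine ⟨F.filter (· ∈ freqBlock lam q k), fun n hn => (Finset.mem_filter.1 hn).2,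
    hF.le.trans_eq ?_⟩
  rw [Finset.sum_filter]
  refine Finset.sum_congr rfl fun n _ => ?_
  simp only [indicator, sq_abs]

lemma blockExponent_lt_iff (hq : 1 < q) (hk : 1 ≤ k) (t : ℝ) :
    blockExponent a lam q k < t ↔ q ^ (-(k * t)) < blockNorm a lam q k := by
  have hq0 : 0 < q := by linarith
  have hL : 0 < (k : ℝ) * Real.log q := mul_pos (by exact_mod_cast hk) (Real.log_pos hq)
  rw [blockExponent, EReal.div_lt_iff (by exact_mod_cast hL) (EReal.coe_ne_top _)]
  rcases (blockNorm_nonneg a lam q k).eq_or_lt with h0 | h0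
  · rw [← h0]
    simp [(Real.rpow_pos_of_pos hq0 _).le]
  · rw [ENNReal.log_ofReal_of_pos h0, ← EReal.coe_mul, ← EReal.coe_neg, EReal.coe_lt_coe_iff,
      ← Real.log_lt_log_iff (Real.rpow_pos_of_pos hq0 _) h0, Real.log_rpow hq0]
    constructor <;> intro h <;> linarith

lemma eventually_lt_blockNorm (hq : 1 < q) {τ τ' : ℝ}
    (hτ : upperExponent a lam q = (τ : EReal)) (hττ' : τ < τ') :
    ∀ᶠ k : ℕ in atTop, q ^ (-(k * τ')) < blockNorm a lam q k := by
  have hlimsup : limsup (blockExponent a lam q) atTop < (τ' : EReal) :=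
    hτ.trans_lt (EReal.coe_lt_coe_iff.2 hττ')
  filter_upwards [eventually_lt_of_limsup_lt hlimsup, eventually_ge_atTop 1] with k hk hk1
  exact (blockExponent_lt_iff hq hk1 τ').1 hk

lemma eventually_blockNorm_le (hq : 1 < q) {σ γ : ℝ}
    (hσ : lowerExponent a lam q = (σ : EReal)) (hγσ : γ < σ) :
    ∀ᶠ k : ℕ in atTop, blockNorm a lam q k ≤ q ^ (-(k * γ)) := by
  have hliminf : (γ : EReal) < liminf (blockExponent a lam q) atTop :=
    (EReal.coe_lt_coe_iff.2 hγσ).trans_eq hσ.symm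
  filter_upwards [eventually_lt_of_lt_liminf hliminf, eventually_ge_atTop 1] with k hk hk1
  exact not_lt.1 fun h => hk.not_gt ((blockExponent_lt_iff hq hk1 γ).2 h)

lemma summable_blockNorm_sq_mul_rpow (hq : 1 < q) {σ γ : ℝ}
    (hσ : lowerExponent a lam q = (σ : EReal)) (hγσ : γ < σ) :
    Summable fun k : ℕ => blockNorm a lam q k ^ 2 * q ^ (((k : ℝ) + 1) * (2 * γ)) := by
  have hq0 : 0 < q := by linarith
  obtain ⟨γ', hγγ', hγ'σ⟩ := exists_between hγσ
  have hgeo : Summable fun k : ℕ => q ^ (2 * γ) * (q ^ (-(2 * (γ' - γ)))) ^ k :=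
    (summable_geometric_of_lt_one (by positivity)
      (Real.rpow_lt_one_of_one_lt_of_neg hq (by linarith))).mul_left _
  refine Summable.of_norm_bounded_eventually_nat hgeo ?_
  filter_upwards [eventually_blockNorm_le hq hσ hγ'σ] with k hk
  have hk0 := blockNorm_nonneg a lam q k
  rw [Real.norm_of_nonneg (by positivity)]
  calc blockNorm a lam q k ^ 2 * q ^ (((k : ℝ) + 1) * (2 * γ))
      ≤ (q ^ (-(k * γ'))) ^ 2 * q ^ (((k : ℝ) + 1) * (2 * γ)) := by gcongr
    _ = q ^ (2 * γ) * (q ^ (-(2 * (γ' - γ)))) ^ k := by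
        rw [← Real.rpow_natCast (q ^ (-(k * γ'))), ← Real.rpow_natCast (q ^ (-(2 * (γ' - γ)))),
          ← Real.rpow_mul hq0.le, ← Real.rpow_mul hq0.le, ← Real.rpow_add hq0,
          ← Real.rpow_add hq0]
        congr 1
        push_cast
        ring

/-- Sobolev regularity of every order below the lower exponent. -/
lemma exists_sum_sq_mul_rpow_le (ha : Summable fun n => |a n|) (hlam : ∀ n, 1 ≤ lam n)
    (hq : 1 < q) {σ γ : ℝ} (hσ : lowerExponent a lam q = (σ : EReal)) (hγ : 0 ≤ γ)
    (hγσ : γ < σ) :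
    ∃ V : ℝ, 0 < V ∧ ∀ s : Finset ℕ, ∑ n ∈ s, a n ^ 2 * lam n ^ (2 * γ) ≤ V := by
  have hq0 : 0 < q := by linarith
  choose κ hκ using fun n => exists_nat_pow_near (hlam n) hq
  set T : ℕ → ℝ := fun k => blockNorm a lam q k ^ 2 * q ^ (((k : ℝ) + 1) * (2 * γ))
  have hT0 (k : ℕ) : 0 ≤ T k := by positivity
  have hblock (s : Finset ℕ) (k : ℕ) :
      ∑ n ∈ s with κ n = k, a n ^ 2 * lam n ^ (2 * γ) ≤ T k := by
    have hmem : ∀ n ∈ s.filter (κ · = k), n ∈ freqBlock lam q k := fun n hn =>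
      (Finset.mem_filter.1 hn).2 ▸ hκ n
    calc ∑ n ∈ s with κ n = k, a n ^ 2 * lam n ^ (2 * γ)
        ≤ ∑ n ∈ s with κ n = k, a n ^ 2 * q ^ (((k : ℝ) + 1) * (2 * γ)) := by
          refine Finset.sum_le_sum fun n hn => ?_
          have hle : lam n ≤ q ^ ((k : ℝ) + 1) := by
            exact_mod_cast (hmem n hn).2.le
          have h0 : 0 ≤ lam n := zero_le_one.trans (hlam n)
          rw [Real.rpow_mul hq0.le]
          gcongr
      _ ≤ T k := by
          rw [← Finset.sum_mul]
          exact mul_le_mul_of_nonneg_right (sum_sq_le_blockNorm_sq ha hmem) (by positivity)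
  have hTs : Summable T := summable_blockNorm_sq_mul_rpow hq hσ hγσ
  have hTnn : 0 ≤ ∑' k, T k := tsum_nonneg hT0
  refine ⟨∑' k, T k + 1, by linarith, fun s => ?_⟩
  calc ∑ n ∈ s, a n ^ 2 * lam n ^ (2 * γ)
      = ∑ k ∈ s.image κ, ∑ n ∈ s with κ n = k, a n ^ 2 * lam n ^ (2 * γ) :=
        (Finset.sum_fiberwise_of_maps_to (fun n hn => Finset.mem_image_of_mem κ hn) _).symm
    _ ≤ ∑ k ∈ s.image κ, T k := Finset.sum_le_sum fun k _ => hblock s k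
    _ ≤ ∑' k, T k := hTs.sum_le_tsum _ fun k _ => hT0 k
    _ ≤ _ := le_add_of_nonneg_right zero_le_one

end BlockExponents

section SineSeries

variable {Ω : Type*} {a lam : ℕ → ℝ} {q : ℝ}

lemma norm_mul_sin_le (b y : ℝ) : ‖b * Real.sin y‖ ≤ |b| := by
  rw [norm_mul, Real.norm_eq_abs, Real.norm_eq_abs]
  exact mul_le_of_le_one_right (abs_nonneg _) (Real.abs_sin_le_one _)

lemma hasSum_sineSeries (ha : Summable fun n => |a n|) (lam : ℕ → ℝ) (θ : ℕ → Ω → ℝ) (ω : Ω)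
    (x : ℝ) : HasSum (fun n => a n * Real.sin (2 * Real.pi * (lam n * x + θ n ω)))
      (sineSeries a lam θ ω x) :=
  (Summable.of_norm_bounded ha fun _ => norm_mul_sin_le _ _).hasSum

lemma continuous_sineSeries (ha : Summable fun n => |a n|) (lam : ℕ → ℝ) (θ : ℕ → Ω → ℝ)
    (ω : Ω) : Continuous (sineSeries a lam θ ω) :=
  continuous_tsum (fun n => by fun_prop) ha fun _ _ => norm_mul_sin_le _ _

lemma abs_sineSeries_le (ha : Summable fun n => |a n|) (lam : ℕ → ℝ) (θ : ℕ → Ω → ℝ) (ω : Ω)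
    (x : ℝ) : |sineSeries a lam θ ω x| ≤ ∑' n, |a n| :=
  tsum_of_norm_bounded ha.hasSum fun _ => norm_mul_sin_le _ _

lemma summable_abs_increment (ha : Summable fun n => |a n|) (lam : ℕ → ℝ) (h : ℝ) :
    Summable fun n => |2 * a n * Real.sin (Real.pi * (lam n * h))| := by
  refine Summable.of_nonneg_of_le (fun n => abs_nonneg _) (fun n => ?_) (ha.mul_left 2)
  refine (norm_mul_sin_le _ _).trans_eq ?_
  rw [abs_mul, abs_two]

lemma sineSeries_sub (ha : Summable fun n => |a n|) (lam : ℕ → ℝ) (θ : ℕ → Ω → ℝ) (ω : Ω)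
    (x y : ℝ) : sineSeries a lam θ ω x - sineSeries a lam θ ω y =
      cosineSeries (fun n => 2 * a n * Real.sin (Real.pi * (lam n * (x - y))))
        (fun n => lam n * ((x + y) / 2)) θ ω := by
  refine ((hasSum_sineSeries ha lam θ ω x).sub (hasSum_sineSeries ha lam θ ω y)).unique ?_
  convert! hasSum_cosineSeries (summable_abs_increment ha lam (x - y))
    (fun n => lam n * ((x + y) / 2)) θ ω using 2 with n
  rw [← mul_sub, Real.sin_sub_sin]
  ring_nf

lemma measurable_sineSeries_comp [MeasurableSpace Ω] {θ : ℕ → Ω → ℝ}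
    (hθ : ∀ n, Measurable (θ n)) (ha : Summable fun n => |a n|) (lam : ℕ → ℝ) {β : Type*}
    [MeasurableSpace β] {g : β → Ω} {x : β → ℝ} (hg : Measurable g) (hx : Measurable x) :
    Measurable fun p => sineSeries a lam θ (g p) (x p) := by
  refine measurable_of_tendsto_metrizable (f := fun N p => ∑ n ∈ Finset.range N,
    a n * Real.sin (2 * Real.pi * (lam n * x p + θ n (g p)))) (fun N => by fun_prop) ?_
  exact tendsto_pi_nhds.2 fun p => (hasSum_sineSeries ha lam θ (g p) (x p)).tendsto_sum_nat

lemma exists_pow_mul_le_lt (hq : 1 < q) {K : ℕ} {c h : ℝ} (hh : 0 < h) (hK : q ^ K * h ≤ c) :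
    ∃ k, K ≤ k ∧ q ^ k * h ≤ c ∧ c < q ^ (k + 1) * h := by
  have hpos : 0 < q ^ K * h := mul_pos (pow_pos (by linarith) K) hh
  obtain ⟨n, hle, hlt⟩ := exists_nat_pow_near ((one_le_div hpos).2 hK) hq
  refine ⟨K + n, le_self_add, ?_, ?_⟩
  · rw [le_div_iff₀ hpos] at hle
    exact (by ring : q ^ (K + n) * h = q ^ n * (q ^ K * h)).trans_le hle
  · rw [div_lt_iff₀ hpos] at hlt
    exact hlt.trans_eq (by ring)

lemma two_mul_abs_le_abs_sin_pi_mul {z : ℝ} (hz : |z| ≤ 1 / 2) :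
    2 * |z| ≤ |Real.sin (Real.pi * z)| := by
  have hjordan := Real.mul_abs_le_abs_sin (x := Real.pi * z) (by
    rw [abs_mul, abs_of_pos Real.pi_pos]
    nlinarith [Real.pi_pos])
  rwa [abs_mul, abs_of_pos Real.pi_pos, ← mul_assoc, div_mul_cancel₀ _ Real.pi_ne_zero] at hjordan

lemma sin_sq_le_abs_rpow {γ : ℝ} (hγ : 0 ≤ γ) (hγ1 : γ ≤ 1) (y : ℝ) :
    Real.sin y ^ 2 ≤ |y| ^ (2 * γ) :=
  calc Real.sin y ^ 2 = |Real.sin y| ^ (2 : ℝ) := by rw [Real.rpow_two, sq_abs]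
    _ ≤ |Real.sin y| ^ (2 * γ) :=
        Real.rpow_le_rpow_of_exponent_ge' (abs_nonneg _) (Real.abs_sin_le_one y)
          (by positivity) (by linarith)
    _ ≤ |y| ^ (2 * γ) := Real.rpow_le_rpow (abs_nonneg _) Real.abs_sin_le_abs (by positivity)

lemma exists_pairwise_disjoint_sq_le_sum (ha : Summable fun n => |a n|) (hq : 1 < q) {B : ℝ}
    (hB : 0 ≤ B) {k N : ℕ} (h : ∀ i : Fin N, B < blockNorm a lam q (k + i)) :
    ∃ F : Fin N → Finset ℕ, Pairwise (Function.onFun Disjoint F) ∧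
      (∀ i, ∀ n ∈ F i, n ∈ freqBlock lam q (k + i)) ∧ ∀ i, B ^ 2 ≤ ∑ n ∈ F i, a n ^ 2 := by
  choose F hFmem hFsum using fun i => exists_finset_sq_le_sum_of_lt_blockNorm ha hB (h i)
  refine ⟨F, fun i j hij => ?_, hFmem, hFsum⟩
  refine Finset.disjoint_coe.1 ((disjoint_freqBlock hq ?_).mono (hFmem i) (hFmem j))
  exact fun hij' => hij (Fin.ext (by omega))

lemma mul_sq_le_sum_increment_sq (hq : 1 < q) {k N : ℕ} {z : ℝ} (hz : q ^ (k + N) * |z| ≤ 1 / 2)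
    (i : Fin N) {F : Finset ℕ} (hF : ∀ n ∈ F, n ∈ freqBlock lam q (k + i)) {B : ℝ}
    (hB : B ^ 2 ≤ ∑ n ∈ F, a n ^ 2) :
    (q ^ k * |z| * B) ^ 2 ≤ ∑ n ∈ F, (2 * a n * Real.sin (Real.pi * (lam n * z))) ^ 2 := by
  have hq0 : 0 < q := by linarith
  calc (q ^ k * |z| * B) ^ 2 ≤ (q ^ k * |z|) ^ 2 * ∑ n ∈ F, a n ^ 2 := by
        rw [mul_pow]
        gcongr
    _ = ∑ n ∈ F, (q ^ k * |z|) ^ 2 * a n ^ 2 := Finset.mul_sum _ _ _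
    _ ≤ ∑ n ∈ F, (2 * a n * Real.sin (Real.pi * (lam n * z))) ^ 2 := by
        refine Finset.sum_le_sum fun n hn => ?_
        have hlower : q ^ k ≤ lam n := (pow_le_pow_right₀ hq.le (by omega)).trans (hF n hn).1
        have hupper : lam n ≤ q ^ (k + N) :=
          (hF n hn).2.le.trans (pow_le_pow_right₀ hq.le (by omega))
        have habs : |lam n * z| = lam n * |z| := by
          rw [abs_mul, abs_of_nonneg ((pow_nonneg hq0.le k).trans hlower)]
        have hsin : 2 * (q ^ k * |z|) ≤ |Real.sin (Real.pi * (lam n * z))| := by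
          refine le_trans ?_ (two_mul_abs_le_abs_sin_pi_mul (habs.trans_le ?_))
          · rw [habs]
            gcongr
          · exact (mul_le_mul_of_nonneg_right hupper (abs_nonneg z)).trans hz
        have hsq := pow_le_pow_left₀ (by positivity) hsin 2
        rw [sq_abs] at hsq
        nlinarith [sq_nonneg (a n), mul_le_mul_of_nonneg_left hsq (sq_nonneg (a n)),
          mul_nonneg (sq_nonneg (q ^ k * |z|)) (sq_nonneg (a n))]

variable [MeasurableSpace Ω] {P : Measure Ω} [IsProbabilityMeasure P] {θ : ℕ → Ω → ℝ}

theorem exists_measure_abs_sineSeries_sub_le (hθ : IndepUniformPhases θ P)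
    (ha : Summable fun n => |a n|) (hq : 1 < q) {τ τ' : ℝ}
    (hτ : upperExponent a lam q = (τ : EReal)) (hττ' : τ < τ') (hτ' : 0 < τ') :
    ∃ D h₀ : ℝ, 0 < D ∧ 0 < h₀ ∧ ∀ x y, 0 < |x - y| → |x - y| ≤ h₀ → ∀ r, 0 < r →
      P {ω | |sineSeries a lam θ ω x - sineSeries a lam θ ω y| ≤ r} ≤
        ENNReal.ofReal (D * r / |x - y| ^ τ') := by
  have hq0 : 0 < q := by linarith
  obtain ⟨D, hD, hball⟩ := exists_measure_abs_cosineSeries_le hθ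
  obtain ⟨K, hK⟩ := eventually_atTop.1 (eventually_lt_blockNorm hq hτ hττ')
  refine ⟨D * (2 * q ^ 7), 1 / (2 * q ^ 6) / q ^ K, by positivity, by positivity,
    fun x y hxy hxy0 r hr => ?_⟩
  set h := |x - y| with hh
  rw [le_div_iff₀' (by positivity)] at hxy0
  obtain ⟨k, hKk, hk, hk'⟩ := exists_pow_mul_le_lt hq hxy hxy0
  have hscale : q ^ (k + 6) * h ≤ 1 / 2 := by
    rw [le_div_iff₀ (by positivity)] at hk
    rw [pow_add]
    linarith
  have hblock (i : Fin 6) : h ^ τ' < blockNorm a lam q (k + i) := by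
    refine lt_of_le_of_lt ?_ (hK (k + i) (by omega))
    have hle : h ≤ (q ^ (k + (i : ℕ)))⁻¹ := by
      rw [le_inv_comm₀ hxy (by positivity), ← one_div, le_div_iff₀ hxy]
      have hpow : q ^ (k + (i : ℕ)) ≤ q ^ (k + 6) := pow_le_pow_right₀ hq.le (by omega)
      linarith [mul_le_mul_of_nonneg_right hpow hxy.le]
    calc h ^ τ' ≤ ((q ^ (k + (i : ℕ)))⁻¹) ^ τ' := Real.rpow_le_rpow hxy.le hle hτ'.le
      _ = q ^ (-(((k + (i : ℕ) : ℕ) : ℝ) * τ')) := by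
          rw [← Real.rpow_natCast, ← Real.rpow_neg hq0.le, ← Real.rpow_mul hq0.le, neg_mul]
  obtain ⟨F, hFdisj, hFmem, hFsum⟩ :=
    exists_pairwise_disjoint_sq_le_sum ha hq (by positivity) hblock
  have hconc := hball (summable_abs_increment ha lam (x - y)) (fun n => lam n * ((x + y) / 2)) F
    hFdisj (by positivity) (fun i => mul_sq_le_sum_increment_sq hq hscale i (hFmem i) (hFsum i)) hr
  simp only [sineSeries_sub ha]
  refine hconc.trans (ENNReal.ofReal_le_ofReal ?_)
  have hinv : 1 ≤ 2 * q ^ 7 * (q ^ k * h) := by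
    rw [div_lt_iff₀ (by positivity)] at hk'
    exact hk'.le.trans_eq (by ring)
  rw [div_le_div_iff₀ (by positivity) (by positivity)]
  calc D * r * h ^ τ' ≤ D * r * h ^ τ' * (2 * q ^ 7 * (q ^ k * h)) :=
        le_mul_of_one_le_right (by positivity) hinv
    _ = D * (2 * q ^ 7) * r * (q ^ k * h * h ^ τ') := by ring

theorem exists_hasSubgaussianMGF_sineSeries_sub (hθ : IndepUniformPhases θ P)
    (ha : Summable fun n => |a n|) (hlam : ∀ n, 1 ≤ lam n) (hq : 1 < q) {σ γ : ℝ}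
    (hσ : lowerExponent a lam q = (σ : EReal)) (hγ : 0 ≤ γ) (hγσ : γ < σ) (hγ1 : γ ≤ 1) :
    ∃ V : ℝ≥0, 0 < V ∧ ∀ x y, HasSubgaussianMGF
      (fun ω => sineSeries a lam θ ω x - sineSeries a lam θ ω y)
      (V * (Real.toNNReal |x - y|) ^ (2 * γ)) P := by
  obtain ⟨V, hV, hVs⟩ := exists_sum_sq_mul_rpow_le ha hlam hq hσ hγ hγσ
  refine ⟨(4 * Real.pi ^ (2 * γ) * V).toNNReal, Real.toNNReal_pos.2 (by positivity),
    fun x y => ?_⟩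
  simp only [sineSeries_sub ha]
  refine hasSubgaussianMGF_cosineSeries hθ (summable_abs_increment ha lam (x - y)) _ fun s => ?_
  rw [NNReal.coe_mul, NNReal.coe_rpow, Real.coe_toNNReal _ (by positivity),
    Real.coe_toNNReal _ (abs_nonneg _)]
  have hterm (n : ℕ) : (2 * a n * Real.sin (Real.pi * (lam n * (x - y)))) ^ 2 ≤
      4 * Real.pi ^ (2 * γ) * |x - y| ^ (2 * γ) * (a n ^ 2 * lam n ^ (2 * γ)) := by
    have hl : 0 ≤ lam n := zero_le_one.trans (hlam n)
    have hsin := sin_sq_le_abs_rpow hγ hγ1 (Real.pi * (lam n * (x - y)))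
    rw [abs_mul, abs_mul, abs_of_pos Real.pi_pos, abs_of_nonneg hl,
      Real.mul_rpow Real.pi_pos.le (by positivity), Real.mul_rpow hl (abs_nonneg _)] at hsin
    calc _ = 4 * a n ^ 2 * Real.sin (Real.pi * (lam n * (x - y))) ^ 2 := by ring
      _ ≤ _ := mul_le_mul_of_nonneg_left hsin (by positivity)
      _ = _ := by ring
  calc ∑ n ∈ s, (2 * a n * Real.sin (Real.pi * (lam n * (x - y)))) ^ 2
      ≤ 4 * Real.pi ^ (2 * γ) * |x - y| ^ (2 * γ) * ∑ n ∈ s, a n ^ 2 * lam n ^ (2 * γ) := by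
        rw [Finset.mul_sum]
        exact Finset.sum_le_sum fun n _ => hterm n
    _ ≤ 4 * Real.pi ^ (2 * γ) * |x - y| ^ (2 * γ) * V := by gcongr; exact hVs s
    _ = _ := by ring

end SineSeries

section DyadicChaining

lemma holderOnWith_of_dist_le {X Y : Type*} [PseudoMetricSpace X] [PseudoMetricSpace Y]
    {f : X → Y} {s : Set X} {C γ : ℝ≥0}
    (h : ∀ x ∈ s, ∀ y ∈ s, dist (f x) (f y) ≤ C * dist x y ^ (γ : ℝ)) : HolderOnWith C γ f s := by
  intro x hx y hy
  rw [edist_dist, edist_dist, ENNReal.ofReal_rpow_of_nonneg dist_nonneg γ.coe_nonneg,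
    ← ENNReal.ofReal_coe_nnreal, ← ENNReal.ofReal_mul C.coe_nonneg]
  exact ENNReal.ofReal_le_ofReal (h x hx y hy)

/-- The largest multiple of `2 ^ (-m)` that is at most `x`, for `0 ≤ x`. -/
noncomputable def dyadicFloor (m : ℕ) (x : ℝ) : ℝ := ⌊2 ^ m * x⌋₊ / 2 ^ m

variable {m : ℕ} {x y : ℝ}

lemma floor_two_pow_mul_le (hx : x ≤ 1) : ⌊2 ^ m * x⌋₊ ≤ 2 ^ m :=
  Nat.floor_le_of_le (by push_cast; exact mul_le_of_le_one_right (by positivity) hx)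

lemma div_two_pow_mem_Icc {j : ℕ} (hj : j ≤ 2 ^ m) : (j : ℝ) / 2 ^ m ∈ Icc (0 : ℝ) 1 :=
  ⟨by positivity, div_le_one_of_le₀ (by exact_mod_cast hj) (by positivity)⟩

lemma floor_le_floor_add_one_of_sub_le (hx : 0 ≤ x) (hxy : y - x ≤ 2⁻¹ ^ m) :
    ⌊2 ^ m * y⌋₊ ≤ ⌊2 ^ m * x⌋₊ + 1 := by
  rw [← Nat.floor_add_one (by positivity)]
  refine Nat.floor_mono ?_
  rw [inv_pow, ← one_div, le_div_iff₀' (by positivity)] at hxy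
  linarith

lemma dyadicFloor_eq_div_two_pow_succ (m : ℕ) (x : ℝ) :
    dyadicFloor m x = ((2 * ⌊2 ^ m * x⌋₊ : ℕ) : ℝ) / 2 ^ (m + 1) := by
  rw [dyadicFloor, pow_succ]
  push_cast
  field_simp

lemma tendsto_dyadicFloor (hx : 0 ≤ x) : Tendsto (fun m => dyadicFloor m x) atTop (𝓝 x) := by
  refine ((tendsto_nat_floor_mul_div_atTop (R := ℝ) hx).comp
    (tendsto_pow_atTop_atTop_of_one_lt (one_lt_two (α := ℝ)))).congr fun m => ?_
  rw [Function.comp_apply, dyadicFloor, mul_comm x]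

variable {X : Type*} [PseudoMetricSpace X] {f : ℝ → X} {C ρ : ℝ}

lemma dist_dyadic_le_of_le_succ (hC : 0 ≤ C) (hρ : 0 ≤ ρ)
    (h : ∀ m j : ℕ, j < 2 ^ m → dist (f (j / 2 ^ m)) (f ((j + 1 : ℕ) / 2 ^ m)) ≤ C * ρ ^ m)
    {i j : ℕ} (hij : i ≤ j) (hji : j ≤ i + 1) (hj : j ≤ 2 ^ m) :
    dist (f (i / 2 ^ m)) (f (j / 2 ^ m)) ≤ C * ρ ^ m := by
  rcases hij.eq_or_lt with rfl | hlt
  · rw [dist_self]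
    positivity
  · obtain rfl : j = i + 1 := le_antisymm hji hlt
    exact h m i hj

lemma dist_dyadicFloor_le (hC : 0 ≤ C) (hρ : 0 ≤ ρ) (hρ1 : ρ < 1)
    (hf : ContinuousOn f (Icc 0 1))
    (h : ∀ m j : ℕ, j < 2 ^ m → dist (f (j / 2 ^ m)) (f ((j + 1 : ℕ) / 2 ^ m)) ≤ C * ρ ^ m)
    (hx : x ∈ Icc (0 : ℝ) 1) (m : ℕ) :
    dist (f (dyadicFloor m x)) (f x) ≤ C * ρ * ρ ^ m / (1 - ρ) := by
  refine dist_le_of_le_geometric_of_tendsto (f := fun m => f (dyadicFloor m x)) ρ (C * ρ) hρ1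
    (fun m => ?_) ((hf x hx).tendsto.comp (tendsto_nhdsWithin_iff.2 ⟨tendsto_dyadicFloor hx.1,
      Eventually.of_forall fun m => div_two_pow_mem_Icc (floor_two_pow_mul_le hx.2)⟩)) m
  have hhalf : ⌊2 ^ (m + 1) * x⌋₊ / 2 = ⌊2 ^ m * x⌋₊ := by
    rw [← Nat.cast_mul_floor_div_cancel two_ne_zero (2 ^ m * x), pow_succ', mul_assoc,
      Nat.cast_ofNat]
  rw [dyadicFloor_eq_div_two_pow_succ, mul_assoc, ← pow_succ']
  exact dist_dyadic_le_of_le_succ hC hρ h (by omega) (by omega) (floor_two_pow_mul_le hx.2)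

lemma dist_le_of_dyadic {γ : ℝ} (hC : 0 ≤ C) (hγ : 0 < γ) (hf : ContinuousOn f (Icc 0 1))
    (h : ∀ m j : ℕ, j < 2 ^ m →
      dist (f (j / 2 ^ m)) (f ((j + 1 : ℕ) / 2 ^ m)) ≤ C * ((2 : ℝ) ^ (-γ)) ^ m)
    (hx : x ∈ Icc (0 : ℝ) 1) (hy : y ∈ Icc (0 : ℝ) 1) (hxy : x < y) :
    dist (f x) (f y) ≤
      C * (2 * 2 ^ (-γ) / (1 - 2 ^ (-γ)) + 1) * 2 ^ γ * (y - x) ^ γ := by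
  set ρ : ℝ := 2 ^ (-γ) with hρ
  have hρ0 : 0 < ρ := by positivity
  have hρ1 : 0 < 1 - ρ := sub_pos.2 (Real.rpow_lt_one_of_one_lt_of_neg one_lt_two (by linarith))
  have hyx : 0 < y - x := sub_pos.2 hxy
  obtain ⟨m, hlt, hle⟩ := exists_nat_pow_near_of_lt_one hyx (by linarith [hx.1, hy.2])
    (inv_pos.2 (zero_lt_two (α := ℝ))) (by norm_num)
  have hmid : dist (f (dyadicFloor m x)) (f (dyadicFloor m y)) ≤ C * ρ ^ m :=
    dist_dyadic_le_of_le_succ hC hρ0.le h (Nat.floor_mono (by gcongr))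
      (floor_le_floor_add_one_of_sub_le hx.1 hle) (floor_two_pow_mul_le hy.2)
  have hscale : ρ ^ m ≤ 2 ^ γ * (y - x) ^ γ := by
    rw [← Real.mul_rpow zero_le_two hyx.le]
    calc ρ ^ m = ((2⁻¹ : ℝ) ^ m) ^ γ := by
          rw [hρ, Real.rpow_neg zero_le_two, ← Real.inv_rpow zero_le_two, ← Real.rpow_natCast,
            ← Real.rpow_natCast, ← Real.rpow_mul (by positivity), ← Real.rpow_mul (by positivity),
            mul_comm]
      _ ≤ (2 * (y - x)) ^ γ := by
          rw [pow_succ] at hlt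
          gcongr
          linarith
  have hchain {z : ℝ} (hz : z ∈ Icc (0 : ℝ) 1) :=
    dist_dyadicFloor_le hC hρ0.le (by linarith) hf h hz m
  calc dist (f x) (f y) ≤ dist (f (dyadicFloor m x)) (f x) +
        dist (f (dyadicFloor m x)) (f (dyadicFloor m y)) + dist (f (dyadicFloor m y)) (f y) := by
        rw [dist_comm _ (f x)]
        exact dist_triangle4 _ _ _ _
    _ ≤ C * ρ * ρ ^ m / (1 - ρ) + C * ρ ^ m + C * ρ * ρ ^ m / (1 - ρ) :=
        add_le_add (add_le_add (hchain hx) hmid) (hchain hy)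
    _ = C * (2 * ρ / (1 - ρ) + 1) * ρ ^ m := by ring
    _ ≤ C * (2 * ρ / (1 - ρ) + 1) * (2 ^ γ * (y - x) ^ γ) := by gcongr
    _ = C * (2 * ρ / (1 - ρ) + 1) * 2 ^ γ * (y - x) ^ γ := by ring

theorem exists_holderOnWith_of_dyadic {γ : ℝ≥0} (hC : 0 ≤ C) (hγ : 0 < γ)
    (hf : ContinuousOn f (Icc 0 1))
    (h : ∀ m j : ℕ, j < 2 ^ m →
      dist (f (j / 2 ^ m)) (f ((j + 1 : ℕ) / 2 ^ m)) ≤ C * ((2 : ℝ) ^ (-γ : ℝ)) ^ m) :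
    ∃ C' : ℝ≥0, HolderOnWith C' γ f (Icc 0 1) := by
  have hle := fun {x y} => dist_le_of_dyadic (x := x) (y := y) hC hγ hf h
  set C' := C * (2 * 2 ^ (-γ : ℝ) / (1 - 2 ^ (-γ : ℝ)) + 1) * (2 : ℝ) ^ (γ : ℝ)
  refine ⟨C'.toNNReal, holderOnWith_of_dist_le fun x hx y hy => ?_⟩
  have hcoe (z : ℝ) (hz : 0 ≤ z) : C' * z ^ (γ : ℝ) ≤ C'.toNNReal * z ^ (γ : ℝ) :=
    mul_le_mul_of_nonneg_right (Real.le_coe_toNNReal C') (by positivity)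
  rcases lt_trichotomy x y with hxy | rfl | hxy
  · refine (hle hx hy hxy).trans (hcoe _ (by linarith)) |>.trans_eq ?_
    rw [dist_comm, Real.dist_eq, abs_of_pos (sub_pos.2 hxy)]
  · rw [dist_self]
    positivity
  · rw [dist_comm (f x)]
    refine (hle hy hx hxy).trans (hcoe _ (by linarith)) |>.trans_eq ?_
    rw [Real.dist_eq, abs_of_pos (sub_pos.2 hxy)]

end DyadicChaining

section KolmogorovChentsov

variable {Ω X : Type*} [MeasurableSpace Ω] {P : Measure Ω} [PseudoMetricSpace X]
  {f : Ω → ℝ → X} {K β : ℝ} {p : ℕ}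

/-- The sum over all dyadic increments in `[0, 1]` of the `p`-th powers of their `γ`-Hölder
ratios. -/
noncomputable def dyadicHolderSum (f : ℝ → X) (γ : ℝ) (p : ℕ) : ℝ≥0∞ :=
  ∑' m : ℕ, ∑ j ∈ Finset.range (2 ^ m), ENNReal.ofReal
    ((dist (f (j / 2 ^ m)) (f ((j + 1 : ℕ) / 2 ^ m)) / ((2 : ℝ) ^ (-γ)) ^ m) ^ p)

lemma dist_dyadic_le_of_dyadicHolderSum_ne_top {f : ℝ → X} {γ : ℝ} (hp : p ≠ 0)
    (h : dyadicHolderSum f γ p ≠ ∞) {m j : ℕ} (hj : j < 2 ^ m) :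
    dist (f (j / 2 ^ m)) (f ((j + 1 : ℕ) / 2 ^ m)) ≤
      max 1 (dyadicHolderSum f γ p).toReal * ((2 : ℝ) ^ (-γ)) ^ m := by
  rw [← div_le_iff₀ (by positivity)]
  set R := dist (f (j / 2 ^ m)) (f ((j + 1 : ℕ) / 2 ^ m)) / ((2 : ℝ) ^ (-γ)) ^ m
  have hterm : ENNReal.ofReal (R ^ p) ≤ dyadicHolderSum f γ p :=
    (Finset.single_le_sum (f := fun j : ℕ => ENNReal.ofReal
      ((dist (f (j / 2 ^ m)) (f ((j + 1 : ℕ) / 2 ^ m)) / ((2 : ℝ) ^ (-γ)) ^ m) ^ p))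
      (fun _ _ => zero_le) (Finset.mem_range.2 hj)).trans
      (ENNReal.le_tsum (f := fun m => ∑ j ∈ Finset.range (2 ^ m), _) m)
  rcases le_total R 1 with hR | hR
  · exact hR.trans (le_max_left _ _)
  · exact (le_self_pow₀ hR hp).trans
      (((ENNReal.ofReal_le_iff_le_toReal h).1 hterm).trans (le_max_right _ _))

lemma lintegral_dyadic_ratio_pow_le {γ : ℝ}
    (hfm : ∀ x y, Measurable fun ω => dist (f ω x) (f ω y))
    (hmom : ∀ x ∈ Icc (0 : ℝ) 1, ∀ y ∈ Icc (0 : ℝ) 1,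
      ∫⁻ ω, ENNReal.ofReal (dist (f ω x) (f ω y) ^ p) ∂P ≤
        ENNReal.ofReal (K * dist x y ^ (1 + β)))
    {m j : ℕ} (hj : j < 2 ^ m) :
    ∫⁻ ω, ENNReal.ofReal
        ((dist (f ω (j / 2 ^ m)) (f ω ((j + 1 : ℕ) / 2 ^ m)) / ((2 : ℝ) ^ (-γ)) ^ m) ^ p) ∂P ≤
      ENNReal.ofReal ((2 ^ m)⁻¹ * (K * ((2 : ℝ) ^ (γ * p - β)) ^ m)) := by
  have hstep : dist ((j : ℝ) / 2 ^ m) ((j + 1 : ℕ) / 2 ^ m) = 2⁻¹ ^ m := by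
    rw [dist_comm, Real.dist_eq, ← sub_div, Nat.cast_succ, add_sub_cancel_left, inv_pow,
      one_div, abs_of_pos (by positivity)]
  have hratio : 0 ≤ ((((2 : ℝ) ^ (-γ)) ^ m) ^ p)⁻¹ := by positivity
  simp only [div_pow, div_eq_inv_mul (dist _ _ ^ p), ENNReal.ofReal_mul hratio]
  rw [lintegral_const_mul _ ((hfm _ _).pow_const p).ennreal_ofReal]
  refine (mul_le_mul_right (hmom _ (div_two_pow_mem_Icc hj.le) _ (div_two_pow_mem_Icc hj))
    _).trans_eq ?_
  rw [← ENNReal.ofReal_mul hratio, hstep, inv_pow, Real.inv_rpow (by positivity)]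
  simp only [← Real.rpow_natCast, ← Real.rpow_mul zero_le_two, ← Real.rpow_neg zero_le_two]
  rw [mul_left_comm, mul_left_comm _ K, ← Real.rpow_add two_pos, ← Real.rpow_add two_pos]
  ring_nf

lemma lintegral_dyadicHolderSum_ne_top {γ : ℝ}
    (hfm : ∀ x y, Measurable fun ω => dist (f ω x) (f ω y)) (hγ : γ * p < β)
    (hmom : ∀ x ∈ Icc (0 : ℝ) 1, ∀ y ∈ Icc (0 : ℝ) 1,
      ∫⁻ ω, ENNReal.ofReal (dist (f ω x) (f ω y) ^ p) ∂P ≤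
        ENNReal.ofReal (K * dist x y ^ (1 + β))) :
    ∫⁻ ω, dyadicHolderSum (f ω) γ p ∂P ≠ ∞ := by
  have hterm (m j : ℕ) : Measurable fun ω => ENNReal.ofReal
      ((dist (f ω (j / 2 ^ m)) (f ω ((j + 1 : ℕ) / 2 ^ m)) / ((2 : ℝ) ^ (-γ)) ^ m) ^ p) :=
    (((hfm _ _).div_const _).pow_const p).ennreal_ofReal
  simp only [dyadicHolderSum]
  rw [lintegral_tsum fun m => (Finset.measurable_sum _ fun j _ => hterm m j).aemeasurable]
  have hgeo : Summable fun m : ℕ => K * ((2 : ℝ) ^ (γ * p - β)) ^ m :=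
    (summable_geometric_of_lt_one (by positivity)
      (Real.rpow_lt_one_of_one_lt_of_neg one_lt_two (by linarith))).mul_left K
  refine ne_top_of_le_ne_top hgeo.tsum_ofReal_ne_top (ENNReal.tsum_le_tsum fun m => ?_)
  rw [lintegral_finsetSum _ fun j _ => hterm m j]
  refine (Finset.sum_le_card_nsmul _ _ _ fun j hj =>
    lintegral_dyadic_ratio_pow_le hfm hmom (Finset.mem_range.1 hj)).trans_eq ?_
  rw [Finset.card_range, nsmul_eq_mul, ← ENNReal.ofReal_natCast,
    ← ENNReal.ofReal_mul (by positivity), Nat.cast_pow, Nat.cast_ofNat,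
    mul_inv_cancel_left₀ (by positivity)]

/-- The **Kolmogorov–Chentsov criterion** on the unit interval. -/
theorem ae_exists_holderOnWith_of_lintegral_dist_pow_le
    (hfc : ∀ ω, ContinuousOn (f ω) (Icc 0 1))
    (hfm : ∀ x y, Measurable fun ω => dist (f ω x) (f ω y)) (hp : p ≠ 0)
    (hmom : ∀ x ∈ Icc (0 : ℝ) 1, ∀ y ∈ Icc (0 : ℝ) 1,
      ∫⁻ ω, ENNReal.ofReal (dist (f ω x) (f ω y) ^ p) ∂P ≤
        ENNReal.ofReal (K * dist x y ^ (1 + β)))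
    {γ : ℝ≥0} (hγ0 : 0 < γ) (hγ : γ * p < β) :
    ∀ᵐ ω ∂P, ∃ C : ℝ≥0, HolderOnWith C γ (f ω) (Icc 0 1) := by
  have hmeas : Measurable fun ω => dyadicHolderSum (f ω) γ p :=
    Measurable.tsum fun m => Finset.measurable_sum _ fun j _ =>
      (((hfm _ _).div_const _).pow_const p).ennreal_ofReal
  filter_upwards [ae_lt_top hmeas (lintegral_dyadicHolderSum_ne_top hfm hγ hmom)] with ω hω
  exact exists_holderOnWith_of_dyadic (by positivity) hγ0 (hfc ω) fun m j hj =>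
    dist_dyadic_le_of_dyadicHolderSum_ne_top hp hω.ne hj

end KolmogorovChentsov

section HolderPaths

variable {Ω : Type*} [MeasurableSpace Ω] {P : Measure Ω} {θ : ℕ → Ω → ℝ} {a lam : ℕ → ℝ} {q : ℝ}

lemma exists_lintegral_abs_sineSeries_sub_pow_le [IsProbabilityMeasure P]
    (hθ : IndepUniformPhases θ P) (ha : Summable fun n => |a n|) (hlam : ∀ n, 1 ≤ lam n)
    (hq : 1 < q) {σ γ : ℝ} (hσ : lowerExponent a lam q = (σ : EReal)) (hγ : 0 ≤ γ) (hγσ : γ < σ)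
    (hγ1 : γ ≤ 1) {p : ℕ} (hp : p ≠ 0) :
    ∃ K : ℝ, ∀ x y,
      ∫⁻ ω, ENNReal.ofReal (|sineSeries a lam θ ω x - sineSeries a lam θ ω y| ^ p) ∂P ≤
        ENNReal.ofReal (K * |x - y| ^ (γ * p)) := by
  obtain ⟨V, hV, hsub⟩ := exists_hasSubgaussianMGF_sineSeries_sub hθ ha hlam hq hσ hγ hγσ hγ1
  refine ⟨4 * p ^ p * √V ^ p, fun x y => ?_⟩
  rcases eq_or_ne x y with rfl | hxy
  · simp only [sub_self, abs_zero, zero_pow hp, ENNReal.ofReal_zero, lintegral_zero, zero_le]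
  have hpos : 0 < |x - y| := abs_pos.2 (sub_ne_zero.2 hxy)
  refine (lintegral_pow_le_of_hasSubgaussianMGF (hsub x y)
    (mul_pos hV (NNReal.rpow_pos (Real.toNNReal_pos.2 hpos))) p).trans_eq ?_
  rw [NNReal.coe_mul, NNReal.coe_rpow, Real.coe_toNNReal _ hpos.le, Real.sqrt_mul V.coe_nonneg,
    mul_comm 2 γ, Real.rpow_mul hpos.le, Real.rpow_two, Real.sqrt_sq (by positivity), mul_pow,
    Real.rpow_mul hpos.le, Real.rpow_natCast, mul_assoc (4 * _)]

theorem ae_exists_holderOnWith_sineSeries [IsProbabilityMeasure P] (hθ : IndepUniformPhases θ P)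
    (ha : Summable fun n => |a n|) (hlam : ∀ n, 1 ≤ lam n) (hq : 1 < q) {σ : ℝ}
    (hσ : lowerExponent a lam q = (σ : EReal)) (hσ1 : σ ≤ 1) {γ : ℝ≥0} (hγ : 0 < γ) (hγσ : γ < σ)
    (u : ℝ) :
    ∀ᵐ ω ∂P, ∃ C : ℝ≥0, HolderOnWith C γ (sineSeries a lam θ ω) (Icc u (u + 1)) := by
  obtain ⟨γ', hγγ', hγ'σ⟩ := exists_between hγσ
  have hγ' : 0 ≤ γ' := γ.coe_nonneg.trans hγγ'.le
  obtain ⟨p, hp⟩ := exists_nat_gt (1 / (γ' - γ))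
  have hp0 : p ≠ 0 := by
    rintro rfl
    exact absurd hp (not_lt.2 (by simpa using hγγ'.le))
  rw [div_lt_iff₀' (sub_pos.2 hγγ')] at hp
  obtain ⟨K, hK⟩ := exists_lintegral_abs_sineSeries_sub_pow_le hθ ha hlam hq hσ hγ' hγ'σ
    (hγ'σ.le.trans hσ1) hp0
  have hcrit := ae_exists_holderOnWith_of_lintegral_dist_pow_le (P := P) (K := K) (γ := γ)
    (f := fun ω x => sineSeries a lam θ ω (u + x)) (β := γ' * p - 1) (p := p)
    (fun ω => ((continuous_sineSeries ha lam θ ω).comp (continuous_const_add u)).continuousOn)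
    (fun x y => (measurable_sineSeries_comp hθ.measurable ha lam measurable_id'
      measurable_const).dist (measurable_sineSeries_comp hθ.measurable ha lam measurable_id'
      measurable_const)) hp0
    (fun x _ y _ => by
      simpa only [Real.dist_eq, add_sub_add_left_eq_sub, add_sub_cancel] using hK (u + x) (u + y))
    hγ (by linarith)
  filter_upwards [hcrit] with ω ⟨C, hC⟩
  refine ⟨C, fun x hx y hy => ?_⟩
  have hmem {z : ℝ} (hz : z ∈ Icc u (u + 1)) : z - u ∈ Icc (0 : ℝ) 1 :=
    ⟨sub_nonneg.2 hz.1, by linarith [hz.2]⟩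
  simpa only [add_sub_cancel, edist_sub_right] using hC _ (hmem hx) _ (hmem hy)

end HolderPaths

section RandomEnergy

variable {Ω Y X : Type*} [MeasurableSpace Ω] {P : Measure Ω}

lemma le_dimH_image_of_energy_ne_top [MeasurableSpace Y] [EMetricSpace X] [MeasurableSpace X]
    [BorelSpace X] [SecondCountableTopology X] {μ : Measure Y} [SFinite μ] {f : Y → X}
    (hf : Measurable f) {A : Set Y} (hA : μ A ≠ 0) {t : ℝ≥0}
    (henergy : ∫⁻ x, ∫⁻ y, edist (f x) (f y) ^ (-t : ℝ) ∂μ ∂μ ≠ ∞) :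
    (t : ℝ≥0∞) ≤ dimH (f '' A) := by
  have hkernel : Measurable fun p : X × X => edist p.1 p.2 ^ (-t : ℝ) :=
    measurable_edist.pow_const _
  refine le_dimH_of_energy_ne_top (ν := μ.map f) (fun h0 => hA ?_) ?_
  · exact measure_mono_null (subset_preimage_image f A)
      (nonpos_iff_eq_zero.1 ((Measure.le_map_apply hf.aemeasurable _).trans_eq h0))
  · rw [lintegral_map hkernel.lintegral_prod_right' hf]
    exact ne_of_eq_of_ne (lintegral_congr fun x =>
      lintegral_map (hkernel.comp measurable_prodMk_left) hf) henergy

lemma exists_lintegral_edist_rpow_neg_le [PseudoMetricSpace X] [MeasurableSpace X]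
    [OpensMeasurableSpace X] {μ : Measure X} [IsFiniteMeasure μ] {C α s : ℝ} (hC : 0 ≤ C)
    (hα : 0 < α) (hαs : α < s)
    (hball : ∀ x r, 0 < r → μ (Metric.closedBall x r) ≤ ENNReal.ofReal (C * r ^ s)) :
    ∃ M : ℝ≥0∞, M ≠ ∞ ∧ ∀ x, ∫⁻ y, edist x y ^ (-α) ∂μ ≤ M := by
  refine ⟨ENNReal.ofReal 1 * μ univ + ENNReal.ofReal (C * (1 ^ (1 - s / α) / (s / α - 1))),
    by finiteness, fun x => ?_⟩
  simp only [edist_dist x]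
  refine lintegral_rpow_neg_le_of_lt (continuous_const.dist continuous_id).measurable
    (fun _ => dist_nonneg) hC hα hαs one_pos fun r hr =>
      (measure_mono fun y hy => ?_).trans (hball x r hr)
  rw [Metric.mem_closedBall, dist_comm]
  exact hy

lemma ae_energy_ne_top [MeasurableSpace Y] [SFinite P] {μ : Measure Y} [IsFiniteMeasure μ]
    {k : Ω → Y → Y → ℝ≥0∞} (hk : Measurable fun p : (Ω × Y) × Y => k p.1.1 p.1.2 p.2)
    {M : ℝ≥0∞} (hM : M ≠ ∞) (h : ∀ x, ∫⁻ y, ∫⁻ ω, k ω x y ∂P ∂μ ≤ M) :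
    ∀ᵐ ω ∂P, ∫⁻ x, ∫⁻ y, k ω x y ∂μ ∂μ ≠ ∞ := by
  have hpot : Measurable fun p : Ω × Y => ∫⁻ y, k p.1 p.2 y ∂μ := hk.lintegral_prod_right'
  have hexpect : ∫⁻ ω, ∫⁻ x, ∫⁻ y, k ω x y ∂μ ∂μ ∂P ≠ ∞ := by
    rw [lintegral_lintegral_swap hpot.aemeasurable]
    refine ne_top_of_le_ne_top (b := ∫⁻ _, M ∂μ) ?_ (lintegral_mono fun x => ?_)
    · rw [lintegral_const]
      finiteness
    · have hx : Measurable fun p : Ω × Y => k p.1 x p.2 :=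
        hk.comp (by fun_prop : Measurable fun p : Ω × Y => ((p.1, x), p.2))
      exact (lintegral_lintegral_swap hx.aemeasurable).trans_le (h x)
  filter_upwards [ae_lt_top hpot.lintegral_prod_right' hexpect] with ω hω using hω.ne

theorem ae_le_dimH_image_of_lintegral_edist_rpow_le [SFinite P] [EMetricSpace X]
    [MeasurableSpace X] [BorelSpace X] [SecondCountableTopology X] {G : Ω → ℝ → X}
    (hG : Measurable fun p : Ω × ℝ => G p.1 p.2) {A : Set ℝ} (hA : AnalyticSet A) {t α : ℝ≥0}
    (hα : 0 < α) (hαA : α < dimH A) {E R : ℝ≥0∞} (hE : E ≠ ∞) (hR : R ≠ ∞)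
    (hker : ∀ x y, ∫⁻ ω, edist (G ω x) (G ω y) ^ (-t : ℝ) ∂P ≤ E * edist x y ^ (-α : ℝ) + R) :
    ∀ᵐ ω ∂P, (t : ℝ≥0∞) ≤ dimH (G ω '' A) := by
  obtain ⟨s, hαs, hsA⟩ := ENNReal.lt_iff_exists_nnreal_btwn.1 hαA
  replace hαs : α < s := ENNReal.coe_lt_coe.1 hαs
  obtain ⟨μ, _, hμA, C, hC, hball⟩ := exists_measure_closedBall_le_of_lt_dimH hA
    (NNReal.coe_pos.2 (hα.trans hαs)) (by rwa [ENNReal.ofReal_coe_nnreal])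
  obtain ⟨M, hM, hpot⟩ := exists_lintegral_edist_rpow_neg_le hC.le (NNReal.coe_pos.2 hα)
    (NNReal.coe_lt_coe.2 hαs) hball
  have henergy := ae_energy_ne_top (P := P) (μ := μ)
    (k := fun ω x y => edist (G ω x) (G ω y) ^ (-t : ℝ))
    (((hG.comp measurable_fst).edist (hG.comp (by fun_prop :
      Measurable fun p : (Ω × ℝ) × ℝ => (p.1.1, p.2)))).pow_const _)
    (M := E * M + R * μ univ) (by finiteness) fun x => by
      refine (lintegral_mono (hker x)).trans ?_
      rw [lintegral_add_right _ measurable_const, lintegral_const, lintegral_const_mul' _ _ hE]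
      gcongr
      exact hpot x
  filter_upwards [henergy] with ω hω
  exact le_dimH_image_of_energy_ne_top (hG.comp measurable_prodMk_left) hμA hω

end RandomEnergy

section RandomGraphs

variable {Ω : Type*} [MeasurableSpace Ω] {P : Measure Ω}

lemma ofReal_rpow_neg_le_of_le {x y : ℝ} {t : ℝ≥0} (h : x ≤ y) :
    ENNReal.ofReal y ^ (-t : ℝ) ≤ ENNReal.ofReal x ^ (-t : ℝ) := by
  rw [ENNReal.rpow_neg, ENNReal.rpow_neg, ENNReal.inv_le_inv]
  gcongr

theorem ae_le_dimH_graphOn_of_lintegral_rpow_le [IsFiniteMeasure P] {F : Ω → ℝ → ℝ}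
    (hF : Measurable fun p : Ω × ℝ => F p.1 p.2) {A : Set ℝ} (hA : AnalyticSet A) {t α : ℝ≥0}
    (hα : 0 < α) (hαA : α < dimH A) {E h₀ : ℝ} (hE : 0 < E) (hh₀ : 0 < h₀)
    (hker : ∀ x y, 0 < |x - y| → |x - y| ≤ h₀ →
      ∫⁻ ω, ENNReal.ofReal (max |x - y| |F ω x - F ω y|) ^ (-t : ℝ) ∂P ≤
        ENNReal.ofReal (E * |x - y| ^ (-α : ℝ))) :
    ∀ᵐ ω ∂P, (t : ℝ≥0∞) ≤ dimH (A.graphOn (F ω)) := by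
  refine ae_le_dimH_image_of_lintegral_edist_rpow_le (G := fun ω x => (x, F ω x))
    (measurable_snd.prodMk hF) hA hα hαA (E := ENNReal.ofReal E)
    (R := ENNReal.ofReal h₀ ^ (-t : ℝ) * P univ) (by finiteness) (ENNReal.mul_ne_top
      (ENNReal.rpow_ne_top_of_ne_zero (ENNReal.ofReal_pos.2 hh₀).ne' ENNReal.ofReal_ne_top)
      (measure_ne_top P _)) fun x y => ?_
  simp only [edist_dist, Prod.dist_eq, Real.dist_eq]
  rcases (abs_nonneg (x - y)).eq_or_lt with h0 | h0
  · rw [← h0, ENNReal.ofReal_zero, ENNReal.zero_rpow_of_neg (by simpa using hα),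
      ENNReal.mul_top (ENNReal.ofReal_pos.2 hE).ne', top_add]
    exact le_top
  rcases le_total |x - y| h₀ with hnear | hfar
  · refine (hker x y h0 hnear).trans (le_add_right ?_)
    rw [ENNReal.ofReal_mul hE.le, ENNReal.ofReal_rpow_of_pos h0]
  · refine le_add_left ?_
    rw [← lintegral_const]
    exact lintegral_mono fun ω => ofReal_rpow_neg_le_of_le (hfar.trans (le_max_left _ _))

variable {Z : Ω → ℝ} {D h τ : ℝ} {t : ℝ≥0}

lemma lintegral_max_abs_rpow_neg_le_of_lt_one [IsProbabilityMeasure P] (hZ : Measurable Z)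
    (hD : 0 < D) (hh : 0 < h) (ht : 0 < t) (ht1 : t < 1)
    (hball : ∀ r, 0 < r → P {ω | |Z ω| ≤ r} ≤ ENNReal.ofReal (D * r / h ^ τ)) :
    ∫⁻ ω, ENNReal.ofReal (max h |Z ω|) ^ (-t : ℝ) ∂P ≤
      ENNReal.ofReal ((1 + D / (1 / t - 1)) * h ^ (-(t * τ))) := by
  have hT : 0 < h ^ (-(t * τ)) := by positivity
  have h1t : 0 < 1 / (t : ℝ) - 1 := sub_pos.2 ((one_lt_div (NNReal.coe_pos.2 ht)).2 ht1)
  have hbound := lintegral_rpow_neg_le_of_lt (μ := P) (B := D / h ^ τ) (κ := 1) hZ.abs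
    (fun ω => abs_nonneg _) (by positivity) (NNReal.coe_pos.2 ht) ht1 hT fun r hr => by
      rw [Real.rpow_one, div_mul_eq_mul_div]
      exact hball r hr
  refine (lintegral_mono fun ω => ofReal_rpow_neg_le_of_le (le_max_right _ _)).trans
    (hbound.trans_eq ?_)
  have hpow : (h ^ (-(t * τ))) ^ (1 - 1 / (t : ℝ)) = h ^ (-(t * τ)) * h ^ τ := by
    rw [← Real.rpow_mul hh.le, ← Real.rpow_add hh]
    have : (t : ℝ) ≠ 0 := (NNReal.coe_pos.2 ht).ne'
    congr 1
    field_simp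
    ring
  rw [measure_univ, mul_one, ← ENNReal.ofReal_add hT.le (by positivity), hpow]
  congr 1
  field_simp

lemma lintegral_max_abs_rpow_neg_le_of_one_lt (hZ : Measurable Z) (hD : 0 < D) (hh : 0 < h)
    (ht1 : 1 < t) (hball : ∀ r, 0 < r → P {ω | |Z ω| ≤ r} ≤ ENNReal.ofReal (D * r / h ^ τ)) :
    ∫⁻ ω, ENNReal.ofReal (max h |Z ω|) ^ (-t : ℝ) ∂P ≤
      ENNReal.ofReal (D / (1 - 1 / t) * h ^ (-(t + τ - 1))) := by
  refine (lintegral_rpow_neg_le_of_gt (μ := P) (B := D / h ^ τ) (κ := 1)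
    (measurable_const.max hZ.abs) hh (fun ω => le_max_left _ _) (by positivity) one_pos
    (by exact_mod_cast ht1) fun r hr => ?_).trans_eq ?_
  · rw [Real.rpow_one, div_mul_eq_mul_div]
    exact (measure_mono fun ω (hω : max h |Z ω| ≤ r) => (le_max_right _ _).trans hω).trans
      (hball r hr)
  · rw [show -((t : ℝ) + τ - 1) = 1 - t - τ by ring, Real.rpow_sub hh (1 - t)]
    congr 1
    ring

theorem ae_le_dimH_graphOn_of_measure_abs_sub_le [IsProbabilityMeasure P] {F : Ω → ℝ → ℝ}
    (hF : Measurable fun p : Ω × ℝ => F p.1 p.2) {A : Set ℝ} (hA : AnalyticSet A) {D h₀ : ℝ}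
    (hD : 0 < D) (hh₀ : 0 < h₀) {τ t : ℝ≥0} (hτ : 0 < τ)
    (hball : ∀ x y, 0 < |x - y| → |x - y| ≤ h₀ → ∀ r, 0 < r →
      P {ω | |F ω x - F ω y| ≤ r} ≤ ENNReal.ofReal (D * r / |x - y| ^ (τ : ℝ)))
    (ht : 0 < t) (ht1 : t ≠ 1) (htmul : t * τ < dimH A) (htadd : t + τ < dimH A + 1) :
    ∀ᵐ ω ∂P, (t : ℝ≥0∞) ≤ dimH (A.graphOn (F ω)) := by
  have hZ (x y : ℝ) : Measurable fun ω => F ω x - F ω y :=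
    (hF.comp measurable_prodMk_right).sub (hF.comp measurable_prodMk_right)
  rcases lt_or_gt_of_ne ht1 with hlt | hgt
  · have h1t : 0 < 1 / (t : ℝ) - 1 := sub_pos.2 ((one_lt_div (NNReal.coe_pos.2 ht)).2 hlt)
    exact ae_le_dimH_graphOn_of_lintegral_rpow_le hF hA (α := t * τ) (mul_pos ht hτ)
      (by exact_mod_cast htmul) (E := 1 + D / (1 / t - 1)) (by positivity) hh₀
      fun x y hxy hxy₀ =>
        lintegral_max_abs_rpow_neg_le_of_lt_one (hZ x y) hD hxy ht hlt (hball x y hxy hxy₀)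
  · have h1t : 0 < 1 - 1 / (t : ℝ) := sub_pos.2 ((div_lt_one (NNReal.coe_pos.2 ht)).2 hgt)
    have hle : 1 ≤ t + τ := hgt.le.trans le_self_add
    refine ae_le_dimH_graphOn_of_lintegral_rpow_le hF hA (α := t + τ - 1)
      (tsub_pos_of_lt (hgt.trans_le le_self_add)) ?_ (E := D / (1 - 1 / t)) (by positivity) hh₀
      fun x y hxy hxy₀ => ?_
    · rw [ENNReal.coe_sub, ENNReal.coe_add, ENNReal.coe_one]
      exact ENNReal.sub_lt_of_lt_add (by exact_mod_cast hle) htadd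
    · rw [NNReal.coe_sub hle]
      exact lintegral_max_abs_rpow_neg_le_of_one_lt (hZ x y) hD hxy hgt (hball x y hxy hxy₀)

end RandomGraphs

section SineSeriesGraph

lemma dimH_graphOn_le_of_forall_Icc {f : ℝ → ℝ} {γ : ℝ≥0} (hγ : 0 < γ) (hγ1 : γ ≤ 1)
    (hf : ∀ N : ℤ, ∃ C : ℝ≥0, HolderOnWith C γ f (Icc N (N + 1))) (A : Set ℝ) :
    dimH (A.graphOn f) ≤ min (dimH A / γ) (dimH A + 1 - γ) := by
  have hcover : ⋃ N : ℤ, A ∩ Icc (N : ℝ) (N + 1) = A := by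
    rw [← inter_iUnion, iUnion_Icc_intCast, inter_univ]
  rw [← hcover, graphOn, image_iUnion, dimH_iUnion, hcover]
  refine iSup_le fun N => ?_
  obtain ⟨C, hC⟩ := hf N
  have hCA : HolderOnWith C γ f (A ∩ Icc (N : ℝ) (N + 1)) := hC.mono inter_subset_right
  have hdiam : Metric.ediam (A ∩ Icc (N : ℝ) (N + 1)) ≤ (1 : ℝ≥0) := by
    refine (Metric.ediam_mono inter_subset_right).trans_eq ?_
    rw [Real.ediam_Icc, add_sub_cancel_left, ENNReal.ofReal_one, ENNReal.coe_one]
  have hmono : dimH (A ∩ Icc (N : ℝ) (N + 1)) ≤ dimH A := dimH_mono inter_subset_left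
  refine le_min ((dimH_graphOn_le_div hdiam hCA hγ hγ1).trans ?_)
    ((dimH_graphOn_le_add hCA hγ1).trans ?_) <;> gcongr

lemma dimH_graphOver_sineSeries_le_one_add {Ω : Type*} {a : ℕ → ℝ} (ha : Summable fun n => |a n|)
    (lam : ℕ → ℝ) (θ : ℕ → Ω → ℝ) (ω : Ω) (A : Set ℝ) :
    dimH (graphOver (sineSeries a lam θ ω) A) ≤ 1 + dimH A := by
  have hbounded : HolderOnWith (2 * ∑' n, |a n|).toNNReal 0 (sineSeries a lam θ ω) A :=
    holderOnWith_of_dist_le fun x _ y _ => by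
      rw [NNReal.coe_zero, Real.rpow_zero, mul_one, two_mul, Real.dist_eq]
      exact ((abs_sub _ _).trans (add_le_add (abs_sineSeries_le ha lam θ ω x)
        (abs_sineSeries_le ha lam θ ω y))).trans (Real.le_coe_toNNReal _)
  simpa only [dimH_graphOver, ENNReal.coe_zero, tsub_zero, add_comm] using
    dimH_graphOn_le_add hbounded zero_le_one

lemma eventually_mul_lt_and_add_lt {t τ : ℝ≥0} {d : ℝ≥0∞} (hmul : t * τ < d)
    (hadd : t + τ < d + 1) : ∀ᶠ τ' : ℝ≥0 in 𝓝 τ, (t * τ' : ℝ≥0∞) < d ∧ (t + τ' : ℝ≥0∞) < d + 1 := by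
  have hmul_cont : Continuous fun τ' : ℝ≥0 => ((t * τ' : ℝ≥0) : ℝ≥0∞) := by fun_prop
  have hadd_cont : Continuous fun τ' : ℝ≥0 => ((t + τ' : ℝ≥0) : ℝ≥0∞) := by fun_prop
  simp only [← ENNReal.coe_mul, ← ENNReal.coe_add] at hmul hadd ⊢
  exact (hmul_cont.continuousAt.eventually_lt_const hmul).and
    (hadd_cont.continuousAt.eventually_lt_const hadd)

lemma ae_le_of_forall_coe_lt {Ω : Type*} [MeasurableSpace Ω] {P : Measure Ω} {b : ℝ≥0∞}
    {X : Ω → ℝ≥0∞} (h : ∀ t : ℝ≥0, 0 < t → t < b → ∀ᵐ ω ∂P, t ≤ X ω) : ∀ᵐ ω ∂P, b ≤ X ω := by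
  refine eventually_const_le_iff_forall_lt_eventually_const_lt.2 fun c hc => ?_
  obtain ⟨t, hct, htb⟩ := ENNReal.lt_iff_exists_nnreal_btwn.1 hc
  filter_upwards [h t (ENNReal.coe_pos.1 (zero_le.trans_lt hct)) htb] with ω hω
  exact hct.trans_le hω

variable {Ω : Type*} [MeasurableSpace Ω] {P : Measure Ω} [IsProbabilityMeasure P]
  {θ : ℕ → Ω → ℝ} {a lam : ℕ → ℝ} {q : ℝ} {σ τ : ℝ≥0} {A : Set ℝ}

theorem ae_dimH_graphOver_sineSeries_le (hθ : IndepUniformPhases θ P)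
    (ha : Summable fun n => |a n|) (hlam : ∀ n, 1 ≤ lam n) (hq : 1 < q)
    (hσ : lowerExponent a lam q = ((σ : ℝ) : EReal)) (hσ0 : 0 < σ) (hσ1 : σ ≤ 1) (A : Set ℝ) :
    ∀ᵐ ω ∂P, dimH (graphOver (sineSeries a lam θ ω) A) ≤
      min (dimH A / σ) (dimH A + 1 - σ) := by
  obtain ⟨γ, -, hγ, hlim⟩ := exists_seq_strictMono_tendsto' hσ0
  have hholder : ∀ᵐ ω ∂P, ∀ (n : ℕ) (N : ℤ), ∃ C : ℝ≥0,
      HolderOnWith C (γ n) (sineSeries a lam θ ω) (Icc (N : ℝ) (N + 1)) :=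
    ae_all_iff.2 fun n => ae_all_iff.2 fun N =>
      ae_exists_holderOnWith_sineSeries hθ ha hlam hq hσ hσ1 (hγ n).1 (hγ n).2 N
  filter_upwards [hholder] with ω hω
  rw [dimH_graphOver]
  have hlim' : Tendsto (fun n => (γ n : ℝ≥0∞)) atTop (𝓝 σ) := ENNReal.tendsto_coe.2 hlim
  refine ge_of_tendsto' ((ENNReal.Tendsto.const_div hlim' (Or.inl ENNReal.coe_ne_top)).min
    (ENNReal.Tendsto.sub tendsto_const_nhds hlim' (Or.inr ENNReal.coe_ne_top))) fun n => ?_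
  exact dimH_graphOn_le_of_forall_Icc (hγ n).1 ((hγ n).2.le.trans hσ1) (hω n) A

lemma ae_coe_le_dimH_graphOver_sineSeries (hθ : IndepUniformPhases θ P)
    (ha : Summable fun n => |a n|) (hq : 1 < q)
    (hτ : upperExponent a lam q = ((τ : ℝ) : EReal)) (hA : AnalyticSet A) {t : ℝ≥0} (ht : 0 < t)
    (hmul : t * τ < dimH A) (hadd : t + τ < dimH A + 1) :
    ∀ᵐ ω ∂P, (t : ℝ≥0∞) ≤ dimH (graphOver (sineSeries a lam θ ω) A) := by
  wlog ht1 : t ≠ 1 generalizing t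
  · obtain ⟨t', ⟨hmul', hadd'⟩, hlt⟩ := (((eventually_mul_lt_and_add_lt (mul_comm (t : ℝ≥0∞) τ ▸
      hmul) (add_comm (t : ℝ≥0∞) τ ▸ hadd)).filter_mono nhdsWithin_le_nhds).and
      (self_mem_nhdsWithin (s := Ioi t))).exists
    rw [mul_comm] at hmul'
    rw [add_comm] at hadd'
    have htt' : t < t' := hlt
    filter_upwards [this (ht.trans htt') hmul' hadd' (not_not.1 ht1 ▸ htt'.ne')] with ω hω
    exact (ENNReal.coe_le_coe.2 htt'.le).trans hω
  obtain ⟨τ', ⟨hmul', hadd'⟩, hττ'⟩ := (((eventually_mul_lt_and_add_lt hmul hadd).filter_mono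
    nhdsWithin_le_nhds).and (self_mem_nhdsWithin (s := Ioi τ))).exists
  have hτ' : 0 < τ' := zero_le.trans_lt hττ'
  obtain ⟨D, h₀, hD, hh₀, hball⟩ := exists_measure_abs_sineSeries_sub_le hθ ha hq hτ
    (NNReal.coe_lt_coe.2 hττ') hτ'
  simp only [dimH_graphOver]
  exact ae_le_dimH_graphOn_of_measure_abs_sub_le
    (measurable_sineSeries_comp hθ.measurable ha lam measurable_fst measurable_snd) hA hD hh₀ hτ'
    hball ht ht1 hmul' hadd'

theorem ae_le_dimH_graphOver_sineSeries (hθ : IndepUniformPhases θ P)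
    (ha : Summable fun n => |a n|) (hq : 1 < q)
    (hτ : upperExponent a lam q = ((τ : ℝ) : EReal)) (hA : AnalyticSet A) :
    ∀ᵐ ω ∂P, min (dimH A / τ) (dimH A + 1 - τ) ≤ dimH (graphOver (sineSeries a lam θ ω) A) := by
  refine ae_le_of_forall_coe_lt fun t ht hlt => ?_
  obtain ⟨hdiv, hsub⟩ := lt_min_iff.1 hlt
  exact ae_coe_le_dimH_graphOver_sineSeries hθ ha hq hτ hA ht (ENNReal.mul_lt_of_lt_div hdiv)
    (lt_tsub_iff_right.1 hsub)

theorem ae_dimH_graphOver_sineSeries_eq_one_add (hθ : IndepUniformPhases θ P)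
    (ha : Summable fun n => |a n|) (hq : 1 < q) (hτ : upperExponent a lam q = 0)
    (hA : AnalyticSet A) (hA0 : 0 < dimH A) :
    ∀ᵐ ω ∂P, dimH (graphOver (sineSeries a lam θ ω) A) = 1 + dimH A := by
  filter_upwards [ae_le_dimH_graphOver_sineSeries (τ := 0) hθ ha hq (by exact_mod_cast hτ) hA]
    with ω hω
  rw [ENNReal.coe_zero, ENNReal.div_zero hA0.ne', tsub_zero, min_eq_right le_top, add_comm] at hω
  exact (dimH_graphOver_sineSeries_le_one_add ha lam θ ω A).antisymm hω

end SineSeriesGraph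

theorem theorem5p7_general {Ω : Type*} [MeasurableSpace Ω] {P : Measure Ω}
    [IsProbabilityMeasure P] {θ : ℕ → Ω → ℝ} (hθ : IndepUniformPhases θ P) {a lam : ℕ → ℝ}
    (ha : Summable fun n => |a n|) (hlam : ∀ n, 1 ≤ lam n) {q : ℝ} (hq : 1 < q) {σ τ : ℝ}
    (hσ : lowerExponent a lam q = (σ : EReal)) (hτ : upperExponent a lam q = (τ : EReal))
    {A : Set ℝ} (hA : AnalyticSet A) :
    (0 < σ → σ ≤ 1 →
      ∀ᵐ ω ∂P,
        dimH (graphOver (sineSeries a lam θ ω) A)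
            ≤ min (dimH A / ENNReal.ofReal σ) (dimH A + 1 - ENNReal.ofReal σ)) ∧
    (0 < τ →
      ∀ᵐ ω ∂P,
        min (dimH A / ENNReal.ofReal τ) (dimH A + 1 - ENNReal.ofReal τ)
            ≤ dimH (graphOver (sineSeries a lam θ ω) A)) ∧
    (τ = 0 → 0 < dimH A →
      ∀ᵐ ω ∂P, dimH (graphOver (sineSeries a lam θ ω) A) = 1 + dimH A) := by
  refine ⟨fun hσ0 hσ1 => ?_, fun hτ0 => ?_, fun hτ0 =>
    ae_dimH_graphOver_sineSeries_eq_one_add hθ ha hq (by rw [hτ, hτ0, EReal.coe_zero]) hA⟩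
  · lift σ to ℝ≥0 using hσ0.le
    simpa only [ENNReal.ofReal_coe_nnreal] using
      ae_dimH_graphOver_sineSeries_le hθ ha hlam hq hσ hσ0 hσ1 A
  · lift τ to ℝ≥0 using hτ0.le
    simpa only [ENNReal.ofReal_coe_nnreal] using ae_le_dimH_graphOver_sineSeries hθ ha hq hτ hA

theorem theorem5p7 {Ω : Type*} [MeasurableSpace Ω] (P : Measure Ω) [IsProbabilityMeasure P]
    (θ : ℕ → Ω → ℝ) (hθmeas : ∀ n, Measurable (θ n)) (hθindep : iIndepFun θ P)
    (hθunif : ∀ n, pdf.IsUniform (θ n) (Icc (0 : ℝ) 1) P volume)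
    (a : ℕ → ℝ) (ha : Summable fun n => |a n|)
    (lam : ℕ → ℝ) (hlam : Monotone lam) (hlam0 : lam 0 = 1)
    (q : ℝ) (hq : IsLUB (range fun n => lam (n + 1) / lam n) q) (hq1 : 1 < q)
    (σ τ : ℝ) (hσ : lowerExponent a lam q = (σ : EReal))
    (hτ : upperExponent a lam q = (τ : EReal))
    (A : Set ℝ) (hA : MeasurableSet A) :
    (0 < σ → σ ≤ τ → τ ≤ 1 →
      ∀ᵐ ω ∂P,
        min (dimH A / ENNReal.ofReal τ) (dimH A + 1 - ENNReal.ofReal τ)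
            ≤ dimH (graphOver (sineSeries a lam θ ω) A) ∧
        dimH (graphOver (sineSeries a lam θ ω) A)
            ≤ min (dimH A / ENNReal.ofReal σ) (dimH A + 1 - ENNReal.ofReal σ)) ∧
    (τ = 0 → 0 < dimH A →
      ∀ᵐ ω ∂P, dimH (graphOver (sineSeries a lam θ ω) A) = 1 + dimH A) := by
  obtain ⟨hupper, hlower, hone⟩ := theorem5p7_general ⟨hθmeas, hθindep, hθunif⟩ ha
    (fun n => hlam0 ▸ hlam (Nat.zero_le n)) hq1 hσ hτ hA.analyticSet
  exact ⟨fun hσ0 hστ hτ1 => (hlower (hσ0.trans_le hστ)).and (hupper hσ0 (hστ.trans hτ1)), hone⟩
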